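/- Call a finite simple graph $G$ $\beta$-tough ($\beta>0$ real) if for no integer $p\ge 2$ can $G$ be split into $p$ connected components by removing fewer than $p\beta$ vertices, and $2K_2$-free if it has no induced subgraph isomorphic to the disjoint union of two edges. For every $\epsilon>0$, every $(1+\epsilon)$-tough $2K_2$-free graph $G$ with at least two vertices is prism-Hamiltonian, i.e. the prism $G\square K_2$ (the Cartesian product of $G$ with the complete graph on two vertices) has a Hamiltonian cycle. Moreover, a Hamiltonian cycle in the prism over $G$ can be found in time polynomial in $|V(G)|$: there are one algorithm and one polynomial $q$, independent of $\epsilon$, such that for all $\epsilon>0$ and all such $G$ the algorithm, given the adjacency matrix of $G$, halts after at most $q(|V(G)|)$ steps and outputs a Hamiltonian cycle of $G\square K_2$. -/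

import Mathlib

open SimpleGraph

/-- `G` is `β`-tough: for no `p ≥ 2` can `G` be split into `p` connected components by removing
fewer than `p * β` vertices. -/
def IsTough {V : Type*} [Fintype V] (G : SimpleGraph V) (β : ℝ) : Prop :=
  ∀ p : ℕ, 2 ≤ p → ∀ S : Finset V, (S.card : ℝ) < p * β →
    Nat.card (G.induce ((S : Set V)ᶜ)).ConnectedComponent ≠ p

/-- `G` has no induced subgraph isomorphic to the disjoint union of two edges. -/
def IsTwoKTwoFree {V : Type*} (G : SimpleGraph V) : Prop :=
  ¬ (completeGraph (Fin 2) ⊕g completeGraph (Fin 2)) ⊴ G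

/-- The prism over `G`: the Cartesian product of `G` with `K₂`. -/
abbrev prism {V : Type*} (G : SimpleGraph V) : SimpleGraph (V × Fin 2) :=
  G □ completeGraph (Fin 2)

/-! ### A random access machine

The memory consists of natural-number variables and of natural-number arrays with indirect
addressing; a program, being a finite object, names only finitely many of them. The arithmetic is
addition and truncated subtraction, without multiplication, so that an execution of `t` steps only
produces numbers whose bit length is linear in `t` and in the bit length of the input: time
that is polynomial on this machine is polynomial on a Turing machine, and conversely. -/

namespace RAM

/-- The memory contents. -/
structure State where
  var : ℕ → ℕ
  arr : ℕ → ℕ → ℕ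

/-- Expressions: constants, variables, array cells `a[e]`, sums, truncated differences. -/
inductive Expr where
  | const (c : ℕ)
  | var (x : ℕ)
  | cell (a : ℕ) (e : Expr)
  | add (e f : Expr)
  | sub (e f : Expr)

/-- The value of an expression. -/
def Expr.eval (s : State) : Expr → ℕ
  | .const c => c
  | .var x => s.var x
  | .cell a e => s.arr a (e.eval s)
  | .add e f => e.eval s + f.eval s
  | .sub e f => e.eval s - f.eval s

/-- The time to evaluate an expression: one step for every node. -/
def Expr.cost : Expr → ℕ
  | .const _ => 1
  | .var _ => 1
  | .cell _ e => e.cost + 1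
  | .add e f => e.cost + f.cost + 1
  | .sub e f => e.cost + f.cost + 1

/-- Programs. `store a i e` is `a[i] := e`; `ite e P Q` and `loop e P` branch, respectively
iterate, on whether the value of `e` is nonzero. -/
inductive Program where
  | skip
  | assign (x : ℕ) (e : Expr)
  | store (a : ℕ) (i e : Expr)
  | seq (P Q : Program)
  | ite (e : Expr) (P Q : Program)
  | loop (e : Expr) (P : Program)

/-- `x := k`. -/
def State.setVar (s : State) (x k : ℕ) : State :=
  { s with var := Function.update s.var x k }

/-- `a[i] := k`. -/
def State.setCell (s : State) (a i k : ℕ) : State :=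
  { s with arr := Function.update s.arr a (Function.update (s.arr a) i k) }

/-- `Exec P s s' t`: the program `P`, started in `s`, halts in `s'` after exactly `t` steps. -/
inductive Exec : Program → State → State → ℕ → Prop where
  | skip (s : State) : Exec .skip s s 1
  | assign (x : ℕ) (e : Expr) (s : State) :
      Exec (.assign x e) s (s.setVar x (e.eval s)) (e.cost + 1)
  | store (a : ℕ) (i e : Expr) (s : State) :
      Exec (.store a i e) s (s.setCell a (i.eval s) (e.eval s)) (i.cost + e.cost + 1)
  | seq {P Q : Program} {s₁ s₂ s₃ : State} {t u : ℕ} :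
      Exec P s₁ s₂ t → Exec Q s₂ s₃ u → Exec (.seq P Q) s₁ s₃ (t + u)
  | ite_true {e : Expr} {P Q : Program} {s s' : State} {t : ℕ} :
      e.eval s ≠ 0 → Exec P s s' t → Exec (.ite e P Q) s s' (e.cost + 1 + t)
  | ite_false {e : Expr} {P Q : Program} {s s' : State} {t : ℕ} :
      e.eval s = 0 → Exec Q s s' t → Exec (.ite e P Q) s s' (e.cost + 1 + t)
  | loop_done {e : Expr} {P : Program} {s : State} :
      e.eval s = 0 → Exec (.loop e P) s s (e.cost + 1)
  | loop_step {e : Expr} {P : Program} {s₁ s₂ s₃ : State} {t u : ℕ} :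
      e.eval s₁ ≠ 0 → Exec P s₁ s₂ t → Exec (.loop e P) s₂ s₃ u →
        Exec (.loop e P) s₁ s₃ (e.cost + 1 + t + u)

open Classical in
/-- The initial state for a graph on `n` vertices: variable `0` holds `n`, array `0` holds the
adjacency matrix row by row, and everything else is `0`. -/
noncomputable def input {n : ℕ} (G : SimpleGraph (Fin n)) : State where
  var x := if x = 0 then n else 0
  arr a k := if a = 0 ∧ ∃ u v : Fin n, k = n * u + v ∧ G.Adj u v then 1 else 0

/-- The final state `s` describes the closed walk `p` in the prism: the `i`-th vertex of `p` is
the copy number `s.arr 2 i` of the vertex `s.arr 1 i` of the graph. -/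
def Outputs {n : ℕ} {G : SimpleGraph (Fin n)} {a : Fin n × Fin 2} (s : State)
    (p : (prism G).Walk a a) : Prop :=
  ∀ i ≤ p.length, s.arr 1 i = (p.getVert i).1 ∧ s.arr 2 i = (p.getVert i).2

end RAM

/-! # Tough `2K₂`-free graphs are prism-Hamiltonian, in polynomial time

Toughness implies Hall's condition for the bipartite double cover of the graph
(`IsTough.card_le_card_neighbors`), so there is a permutation `σ` of the vertices with `v` adjacent
to `σ v` for all `v`. An auction finds it with at most `n ^ 2` effective bids, since Hall's condition
also bounds the prices (`RAM.IsAuction.price_lt`).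

The prism over a cycle of `σ` has a Hamiltonian path from the entry vertex `e` in the layer `l` to
the vertex `σ^[d] e` in the layer `l + d + 1`: zigzag through the first `d` columns, then go through
the other columns in one layer and back in the other one (`traversal`). As `G` is `2K₂`-free, any
edge of one cycle is joined to any edge of another cycle, so the cycles can be traversed one after
the other in any order, leaving each of them at depth `0` or `1` (`Chain.step`). Such a chain closes
up to a Hamiltonian cycle of the prism if the last cycle is left for the entry vertex of the first
one, and if it ends in the layer in which it began. A chain has a free choice of its first cycle,
with its direction and depth, of the cycles in the second, third and fourth place, and of the depth
of the last cycle; all the other choices are forced. These are polynomially many candidates, and the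
algorithm checks all of them.

It remains to see that some candidate works (`HasCandidate`), possibly after a change of `σ`.
* A cycle of odd length serves as the first one: the two directions have different parities
  (`hasCandidate_of_odd`).
* If all cycles are even, then `σ` is replaced by a perfect matching. A matching edge in a
  triangle serves as the first one: it can be left from both of its ends
  (`hasCandidate_of_triangle`).
* Otherwise the parity of a chain depends on how the edges between any two matching edges join their
  ends. If no order of the matching edges works, then comparing the orders `p, i, j, q, …` and
  `p, j, i, q, …` shows that the matching edges join two colour classes, that all other
  edges are inside of the classes, and that the number of matching edges is odd
  (`TriangleFreeMatching.exists_coloring_mono`). With five or more matching edges this contradicts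
  `2K₂`-freeness and toughness (`TriangleFreeMatching.card_eq_six`), and with three of them `G` is the
  prism over a triangle, where any exchange of edges of the matching along a cycle of length `4`
  gives a matching edge in a triangle (`TriangleFreeMatching.hasCandidate_rematch`).

Programs for the machine are verified with a logic for total correctness (`RAM.Runs`), in which every
loop is shown to make at most `N` iterations each time it is entered. The running time is then
bounded by a polynomial in `N` that depends only on the program (`RAM.Program.bound`), here
with `N = 2 n`. The variables and arrays that a program leaves alone are read off from its text
(`RAM.Frame`).

The memory is used as follows. Array `0` contains the adjacency matrix and array `6` the offsets of
its rows; arrays `1` and `2` contain the vertices and layers of the output; arrays `3`, `4`, `5`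
the prices, holders and holdings of the auction; array `7` the permutation and its inverse; array
`8` the marks of the vertices that a chain has reached; array `9` the parities for the splitting
of even cycles. Variable `0` is the number of vertices, and variable `27` tells whether
a Hamiltonian cycle has been found.
-/

/-! ### A program logic for the random access machine -/

namespace RAM

/-- A bound for the running time of a program, all of whose loops (each time they are entered)
make at most `N` iterations. -/
def Program.bound (N : ℕ) : Program → ℕ
  | .skip => 1
  | .assign _ e => e.cost + 1
  | .store _ i e => i.cost + e.cost + 1
  | .seq P Q => P.bound N + Q.bound N
  | .ite e P Q => e.cost + 1 + (P.bound N + Q.bound N)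
  | .loop e P => N * (e.cost + 1 + P.bound N) + (e.cost + 1)

lemma Program.exists_polynomial_bound (P : Program) :
    ∃ q : Polynomial ℕ, ∀ N, P.bound N = q.eval N := by
  induction P with
  | skip => exact ⟨1, fun N => by simp [bound]⟩
  | assign x e => exact ⟨Polynomial.C (e.cost + 1), fun N => by simp [bound]⟩
  | store a i e => exact ⟨Polynomial.C (i.cost + e.cost + 1), fun N => by simp [bound]⟩
  | seq P Q hP hQ =>
    obtain ⟨p, hp⟩ := hP
    obtain ⟨q, hq⟩ := hQ
    exact ⟨p + q, fun N => by simp [bound, hp, hq]⟩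
  | ite e P Q hP hQ =>
    obtain ⟨p, hp⟩ := hP
    obtain ⟨q, hq⟩ := hQ
    exact ⟨Polynomial.C (e.cost + 1) + (p + q), fun N => by simp [bound, hp, hq]⟩
  | loop e P hP =>
    obtain ⟨p, hp⟩ := hP
    exact ⟨Polynomial.X * (Polynomial.C (e.cost + 1) + p) + Polynomial.C (e.cost + 1),
      fun N => by simp [bound, hp]⟩

/-- Whether the program contains an assignment to the variable `x`. -/
def Program.modVar (x : ℕ) : Program → Bool
  | .skip => false
  | .assign y _ => x == y
  | .store _ _ _ => false
  | .seq P Q => P.modVar x || Q.modVar x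
  | .ite _ P Q => P.modVar x || Q.modVar x
  | .loop _ P => P.modVar x

/-- Whether the program contains an assignment to a cell of the array `a`. -/
def Program.modArr (a : ℕ) : Program → Bool
  | .skip => false
  | .assign _ _ => false
  | .store b _ _ => a == b
  | .seq P Q => P.modArr a || Q.modArr a
  | .ite _ P Q => P.modArr a || Q.modArr a
  | .loop _ P => P.modArr a

/-- The states `s` and `s'` agree on everything that `P` does not assign to. -/
def Frame (P : Program) (s s' : State) : Prop :=
  (∀ x, P.modVar x = false → s'.var x = s.var x) ∧ ∀ a, P.modArr a = false → s'.arr a = s.arr a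

lemma Frame.refl (P : Program) (s : State) : Frame P s s := ⟨fun _ _ => rfl, fun _ _ => rfl⟩

lemma Frame.trans {P : Program} {s₁ s₂ s₃ : State} (h : Frame P s₁ s₂) (h' : Frame P s₂ s₃) :
    Frame P s₁ s₃ :=
  ⟨fun x hx => (h'.1 x hx).trans (h.1 x hx), fun a ha => (h'.2 a ha).trans (h.2 a ha)⟩

lemma Frame.mono {P Q : Program} {s s' : State} (h : Frame P s s')
    (hv : ∀ x, Q.modVar x = false → P.modVar x = false)
    (ha : ∀ a, Q.modArr a = false → P.modArr a = false) : Frame Q s s' :=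
  ⟨fun x hx => h.1 x (hv x hx), fun a h' => h.2 a (ha a h')⟩

lemma Exec.frame {P : Program} {s s' : State} {t : ℕ} (h : Exec P s s' t) : Frame P s s' := by
  induction h with
  | skip s => exact Frame.refl _ _
  | assign x e s =>
    refine ⟨fun y hy => ?_, fun _ _ => rfl⟩
    have : y ≠ x := by simpa [Program.modVar] using hy
    simp [State.setVar, this]
  | store a i e s =>
    refine ⟨fun _ _ => rfl, fun b hb => ?_⟩
    have : b ≠ a := by simpa [Program.modArr] using hb
    simp [State.setCell, this]
  | seq _ _ h1 h2 =>
    exact (h1.mono (fun x hx => by simp_all [Program.modVar])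
      (fun a ha => by simp_all [Program.modArr])).trans
      (h2.mono (fun x hx => by simp_all [Program.modVar])
      (fun a ha => by simp_all [Program.modArr]))
  | ite_true _ _ h1 =>
    exact h1.mono (fun x hx => by simp_all [Program.modVar])
      (fun a ha => by simp_all [Program.modArr])
  | ite_false _ _ h1 =>
    exact h1.mono (fun x hx => by simp_all [Program.modVar])
      (fun a ha => by simp_all [Program.modArr])
  | loop_done _ => exact Frame.refl _ _
  | loop_step _ _ _ h1 h2 =>
    exact (h1.mono (fun x hx => by simp_all [Program.modVar])
      (fun a ha => by simp_all [Program.modArr])).trans h2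

/-- Total correctness with time: started in `s`, the program `P` halts in a state with `Q`, within
the time that is due if no loop makes more than `N` iterations. -/
def Runs (N : ℕ) (P : Program) (s : State) (Q : State → Prop) : Prop :=
  ∃ s' t, Exec P s s' t ∧ t ≤ P.bound N ∧ Q s'

variable {N : ℕ} {P P' : Program} {s : State} {Q Q' : State → Prop}

lemma Runs.imp (h : Runs N P s Q) (hQ : ∀ s', Frame P s s' → Q s' → Q' s') : Runs N P s Q' := by
  obtain ⟨s', t, he, ht, hq⟩ := h
  exact ⟨s', t, he, ht, hQ s' he.frame hq⟩

lemma Runs.skip (h : Q s) : Runs N .skip s Q := ⟨s, 1, .skip s, le_rfl, h⟩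

lemma Runs.assign {x : ℕ} {e : Expr} (h : Q (s.setVar x (e.eval s))) :
    Runs N (.assign x e) s Q := ⟨_, _, .assign x e s, le_rfl, h⟩

lemma Runs.store {a : ℕ} {i e : Expr} (h : Q (s.setCell a (i.eval s) (e.eval s))) :
    Runs N (.store a i e) s Q := ⟨_, _, .store a i e s, le_rfl, h⟩

lemma Runs.seq (h : Runs N P s fun s' => Runs N P' s' Q) : Runs N (.seq P P') s Q := by
  obtain ⟨s', t, he, ht, s'', t', he', ht', hq⟩ := h
  exact ⟨s'', t + t', .seq he he', Nat.add_le_add ht ht', hq⟩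

/-- Sequential composition, with the frame of the first program at hand. -/
lemma Runs.seq' (h : Runs N P s Q') (h' : ∀ s', Frame P s s' → Q' s' → Runs N P' s' Q) :
    Runs N (.seq P P') s Q := Runs.seq (h.imp h')

lemma Runs.ite {e : Expr} (h1 : e.eval s ≠ 0 → Runs N P s Q) (h2 : e.eval s = 0 → Runs N P' s Q) :
    Runs N (.ite e P P') s Q := by
  by_cases h : e.eval s = 0
  · obtain ⟨s', t, he, ht, hq⟩ := h2 h
    exact ⟨s', _, .ite_false h he, by simp only [Program.bound]; omega, hq⟩
  · obtain ⟨s', t, he, ht, hq⟩ := h1 h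
    exact ⟨s', _, .ite_true h he, by simp only [Program.bound]; omega, hq⟩

/-- The rule for loops: the invariant `Inv k` says that `k` iterations have been made, and there
are at most `m ≤ N` of them. -/
lemma Runs.loop {e : Expr} (Inv : ℕ → State → Prop) {m : ℕ} (hm : m ≤ N) (h0 : Inv 0 s)
    (hlt : ∀ k s', Frame P s s' → Inv k s' → e.eval s' ≠ 0 → k < m)
    (hstep : ∀ k s', Frame P s s' → Inv k s' → e.eval s' ≠ 0 → k < m → Runs N P s' (Inv (k + 1)))
    (hQ : ∀ k s', Frame P s s' → Inv k s' → e.eval s' = 0 → Q s') :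
    Runs N (.loop e P) s Q := by
  have key : ∀ r k s', k + r = m → Frame P s s' → Inv k s' → ∃ s'' t, Exec (.loop e P) s' s'' t ∧
      t ≤ r * (e.cost + 1 + P.bound N) + (e.cost + 1) ∧ Q s'' := by
    intro r
    induction r with
    | zero =>
      intro k s' hk hf hi
      have h : e.eval s' = 0 := by
        by_contra h
        have := hlt k s' hf hi h
        omega
      exact ⟨s', _, .loop_done h, by simp, hQ k s' hf hi h⟩
    | succ r ih =>
      intro k s' hk hf hi
      by_cases h : e.eval s' = 0
      · exact ⟨s', _, .loop_done h, by simp, hQ k s' hf hi h⟩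
      · obtain ⟨s₁, t₁, he₁, ht₁, hi₁⟩ := hstep k s' hf hi h (hlt k s' hf hi h)
        obtain ⟨s₂, t₂, he₂, ht₂, hq₂⟩ := ih (k + 1) s₁ (by omega) (hf.trans he₁.frame) hi₁
        refine ⟨s₂, _, .loop_step h he₁ he₂, ?_, hq₂⟩
        rw [Nat.succ_mul]
        omega
  obtain ⟨s', t, he, ht, hq⟩ := key m 0 s (by omega) (Frame.refl _ _) h0
  refine ⟨s', t, he, ht.trans ?_, hq⟩
  simp only [Program.bound]
  gcongr

/-- `for i := 0, …, hi - 1 do P`. -/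
def Program.forLoop (i : ℕ) (hi : Expr) (P : Program) : Program :=
  .seq (.assign i (.const 0)) (.loop (.sub hi (.var i))
    (.seq P (.assign i (.add (.var i) (.const 1)))))

@[simp] lemma State.setVar_var (s : State) (x k y : ℕ) :
    (s.setVar x k).var y = if y = x then k else s.var y := by
  simp [State.setVar, Function.update_apply]

@[simp] lemma State.setVar_arr (s : State) (x k : ℕ) : (s.setVar x k).arr = s.arr := rfl

@[simp] lemma State.setCell_var (s : State) (a i k : ℕ) : (s.setCell a i k).var = s.var := rfl

@[simp] lemma State.setCell_arr (s : State) (a i k b j : ℕ) :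
    (s.setCell a i k).arr b j = if b = a ∧ j = i then k else s.arr b j := by
  by_cases hb : b = a
  · subst hb
    simp [State.setCell, Function.update_apply]
  · simp [State.setCell, hb]

lemma State.setCell_arr_ne (s : State) {a b : ℕ} (i k : ℕ) (h : b ≠ a) :
    (s.setCell a i k).arr b = s.arr b := by
  simp [State.setCell, h]

attribute [simp] Expr.eval

/-- The rule for `for` loops. The counter must not be assigned to in the body, and the upper end
must keep its value. -/
lemma Runs.forLoop {i : ℕ} {hi : Expr} (Inv : ℕ → State → Prop) (m : ℕ) (hm : m ≤ N)
    (hi_mod : P.modVar i = false) (h0 : Inv 0 (s.setVar i 0))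
    (hhi : ∀ s', Frame (Program.forLoop i hi P) s s' → hi.eval s' = m)
    (hstep : ∀ k s', k < m → Frame (Program.forLoop i hi P) s s' → s'.var i = k → Inv k s' →
      Runs N P s' fun s'' => Inv (k + 1) (s''.setVar i (k + 1)))
    (hQ : ∀ s', Frame (Program.forLoop i hi P) s s' → Inv m s' → Q s') :
    Runs N (Program.forLoop i hi P) s Q := by
  have hfr : ∀ s', Frame (.seq P (.assign i (.add (.var i) (.const 1)))) (s.setVar i 0) s' →
      Frame (Program.forLoop i hi P) s s' := by
    intro s' hf
    refine ⟨fun x hx => ?_, fun a ha => ?_⟩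
    · have hx' : x ≠ i ∧ P.modVar x = false := by
        simp [Program.forLoop, Program.modVar] at hx
        tauto
      rw [hf.1 x (by simp [Program.modVar, hx'])]
      simp [hx'.1]
    · rw [hf.2 a (by simpa [Program.forLoop, Program.modArr] using ha)]
      rfl
  refine Runs.seq (Runs.assign ?_)
  refine Runs.loop (fun k s' => Inv k s' ∧ s'.var i = k ∧ k ≤ m) hm
    ⟨by simpa using h0, by simp, Nat.zero_le _⟩ ?_ ?_ ?_
  · rintro k s' hf ⟨_, hk, _⟩ he
    have := hhi s' (hfr s' hf)
    simp [this, hk] at he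
    omega
  · rintro k s' hf ⟨hinv, hk, _⟩ he hkm
    refine Runs.seq ((hstep k s' hkm (hfr s' hf) hk hinv).imp ?_)
    intro s'' hf' h
    have hki : s''.var i = k := by rw [hf'.1 i hi_mod, hk]
    refine Runs.assign ⟨?_, ?_, hkm⟩
    · simpa [hki] using h
    · simp [hki]
  · rintro k s' hf ⟨hinv, hk, hkm⟩ he
    have := hhi s' (hfr s' hf)
    simp [this, hk] at he
    obtain rfl : k = m := by omega
    exact hQ s' (hfr s' hf) hinv

end RAM

/-! ### Toughness and forbidden `2K₂` -/

section Tough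

variable {V : Type*} {G : SimpleGraph V}

/-- In a `2K₂`-free graph two disjoint edges are joined by an edge. -/
lemma IsTwoKTwoFree.exists_adj (hG : IsTwoKTwoFree G) {a b c d : V} (hab : G.Adj a b)
    (hcd : G.Adj c d) (hac : a ≠ c) (had : a ≠ d) (hbc : b ≠ c) (hbd : b ≠ d) :
    G.Adj a c ∨ G.Adj a d ∨ G.Adj b c ∨ G.Adj b d := by
  by_contra! h
  obtain ⟨h1, h2, h3, h4⟩ := h
  apply hG
  have hab' := hab.ne
  have hcd' := hcd.ne
  have hinj : Function.Injective (Sum.elim ![a, b] ![c, d]) := by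
    rintro (x | x) (y | y) <;> fin_cases x <;> fin_cases y <;> simp_all [eq_comm]
  have hadj : ∀ x y, G.Adj (Sum.elim ![a, b] ![c, d] x) (Sum.elim ![a, b] ![c, d] y) ↔
      (completeGraph (Fin 2) ⊕g completeGraph (Fin 2)).Adj x y := by
    rintro (x | x) (y | y) <;> fin_cases x <;> fin_cases y <;>
      simp_all [SimpleGraph.adj_comm]
  exact ⟨⟨⟨_, hinj⟩, hadj _ _⟩⟩

variable [Fintype V]

/-- If `S` separates the nonempty independent set `I` from the other vertices, and at least two
components are left, then `S` is larger than `I` and has at least three vertices. -/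
lemma IsTough.card_lt {ε : ℝ} (hε : 0 < ε) (hG : IsTough G (1 + ε)) (S I : Finset V)
    (hdisj : ∀ v ∈ I, v ∉ S) (hN : ∀ v ∈ I, ∀ w, G.Adj v w → w ∈ S)
    {v w : V} (hv : v ∈ I) (hw : w ∉ S) (hvw : v ≠ w) : I.card < S.card ∧ 3 ≤ S.card := by
  classical
  set H := G.induce ((S : Set V)ᶜ) with hH
  let f : I → H.ConnectedComponent := fun x => H.connectedComponentMk ⟨x.1, by
    simpa using hdisj x.1 x.2⟩
  have key : ∀ (x : I) (y : ((S : Set V)ᶜ : Set V)),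
      f x = H.connectedComponentMk y → x.1 = y.1 := by
    intro x y h
    have hr : H.Reachable ⟨x.1, by simpa using hdisj x.1 x.2⟩ y := ConnectedComponent.exact h
    obtain ⟨p⟩ := hr
    cases p with
    | nil => rfl
    | cons hadj p =>
      rename_i u
      exact absurd (hN x.1 x.2 u.1 hadj) u.2
  have hf : Function.Injective f := by
    intro x y h
    exact Subtype.ext (key x _ h)
  have hcard : I.card ≤ Nat.card H.ConnectedComponent := by
    have := Nat.card_le_card_of_injective f hf
    simpa using this
  have htwo : 2 ≤ Nat.card H.ConnectedComponent := by
    have h : f ⟨v, hv⟩ ≠ H.connectedComponentMk ⟨w, by simpa using hw⟩ :=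
      fun h => hvw (key ⟨v, hv⟩ _ h)
    have : Nontrivial H.ConnectedComponent := ⟨_, _, h⟩
    rw [Nat.card_eq_fintype_card]
    exact Fintype.one_lt_card
  have hS : ((Nat.card H.ConnectedComponent : ℕ) : ℝ) * (1 + ε) ≤ S.card := by
    by_contra! h
    exact hG _ htwo S h rfl
  have hS' : Nat.card H.ConnectedComponent < S.card := by
    have h2 : (0 : ℝ) < (Nat.card H.ConnectedComponent : ℕ) := by
      exact_mod_cast (by omega : 0 < Nat.card H.ConnectedComponent)
    have : ((Nat.card H.ConnectedComponent : ℕ) : ℝ) < S.card := by nlinarith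
    exact_mod_cast this
  omega

open Classical in
/-- Hall's condition for the bipartite double cover of a tough graph. -/
lemma IsTough.card_le_card_neighbors {ε : ℝ} (hε : 0 < ε) (hG : IsTough G (1 + ε))
    (hV : 2 ≤ Fintype.card V) (L : Finset V) :
    L.card ≤ (Finset.univ.filter fun w => ∃ v ∈ L, G.Adj v w).card := by
  set M := Finset.univ.filter fun w => ∃ v ∈ L, G.Adj v w with hM
  by_contra! hlt
  have hcard : (M \ L).card < (L \ M).card := by
    have h1 := Finset.card_sdiff_add_card_inter M L
    have h2 := Finset.card_sdiff_add_card_inter L M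
    rw [Finset.inter_comm] at h2
    omega
  have hdisj : ∀ v ∈ L \ M, v ∉ M \ L := by
    intro v hv
    simp only [Finset.mem_sdiff] at hv ⊢
    tauto
  have hN : ∀ v ∈ L \ M, ∀ w, G.Adj v w → w ∈ M \ L := by
    intro v hv w hvw
    simp only [Finset.mem_sdiff, hM, Finset.mem_filter, Finset.mem_univ, true_and] at hv ⊢
    exact ⟨⟨v, hv.1, hvw⟩, fun hw => hv.2 ⟨w, hw, hvw.symm⟩⟩
  obtain ⟨v, hv⟩ : (L \ M).Nonempty := Finset.card_pos.mp (by omega)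
  by_cases h1 : (L \ M).card = 1
  · have h0 : M \ L = ∅ := Finset.card_eq_zero.mp (by omega)
    obtain ⟨w, hw⟩ := Fintype.exists_ne_of_one_lt_card (by omega) v
    have := (hG.card_lt hε _ _ hdisj hN hv (by simp [h0]) hw.symm).2
    simp [h0] at this
  · obtain ⟨w, hw, hwv⟩ := Finset.exists_mem_ne (s := L \ M) (by omega) v
    have := (hG.card_lt hε _ _ hdisj hN hv (hdisj w hw) hwv.symm).1
    omega

/-- The minimum degree of a tough graph that is not too small is at least three. -/
lemma IsTough.three_le_degree {ε : ℝ} (hε : 0 < ε) (hG : IsTough G (1 + ε)) (v : V)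
    [Fintype (G.neighborSet v)] (hV : G.degree v + 2 ≤ Fintype.card V) : 3 ≤ G.degree v := by
  classical
  obtain ⟨w, hw⟩ : ∃ w, w ∉ insert v (G.neighborFinset v) := by
    by_contra! h
    have h1 := Finset.card_insert_le v (G.neighborFinset v)
    rw [Finset.eq_univ_of_forall h, Finset.card_univ, G.card_neighborFinset_eq_degree] at h1
    omega
  simp only [Finset.mem_insert, not_or] at hw
  have := hG.card_lt hε (G.neighborFinset v) {v} (by simp) (by simp) (Finset.mem_singleton_self v)
    hw.2 (Ne.symm hw.1)
  simpa using this.2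

end Tough

/-! ### Traversing the prism over a cycle -/

section Traverse

variable {V : Type*}

/-- Adjacency in the prism, with layers in `ZMod 2`. -/
def PrismAdj (G : SimpleGraph V) (a b : V × ZMod 2) : Prop :=
  (G.Adj a.1 b.1 ∧ a.2 = b.2) ∨ (a.1 = b.1 ∧ a.2 ≠ b.2)

/-- The list `W` is a walk in the prism from `a` to `b`. -/
def IsTrail (G : SimpleGraph V) (a b : V × ZMod 2) (W : List (V × ZMod 2)) : Prop :=
  W.head? = some a ∧ W.getLast? = some b ∧ W.IsChain (PrismAdj G)

lemma IsTrail.append {G : SimpleGraph V} {a b c d : V × ZMod 2} {W W' : List (V × ZMod 2)}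
    (h : IsTrail G a b W) (h' : IsTrail G c d W') (hbc : PrismAdj G b c) :
    IsTrail G a d (W ++ W') := by
  obtain ⟨h1, h2, h3⟩ := h
  obtain ⟨h4, h5, h6⟩ := h'
  refine ⟨by simp [h1], by simp [h5], List.isChain_append.mpr ⟨h3, h6, ?_⟩⟩
  simp_all

lemma IsTrail.cons {G : SimpleGraph V} {a b c : V × ZMod 2} {W : List (V × ZMod 2)}
    (h : IsTrail G b c W) (hab : PrismAdj G a b) : IsTrail G a c (a :: W) :=
  IsTrail.append (W := [a]) ⟨rfl, rfl, by simp⟩ h hab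

/-- The traversal of the prism over the cycle of length `d + r` of `e` under `τ`, starting at
`(e, l)`: it zigzags through the first `d` columns, then goes through the other `r` columns in one
layer and back in the other one. It ends in the column of `τ^[d] e`, in the layer `l + d + 1`. -/
def traversal (τ : V → V) (r : ℕ) : ℕ → V → ZMod 2 → List (V × ZMod 2)
  | 0, e, l => (List.range r).map (fun i => (τ^[i] e, l)) ++
      (List.range r).map (fun i => (τ^[r - 1 - i] e, l + 1))
  | d + 1, e, l => (e, l) :: (e, l + 1) :: traversal τ r d (τ e) (l + 1)

lemma mem_traversal {τ : V → V} {r d : ℕ} {e : V} {l : ZMod 2} {p : V × ZMod 2} :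
    p ∈ traversal τ r d e l ↔ ∃ i < d + r, τ^[i] e = p.1 := by
  have hl : ∀ l l' : ZMod 2, l' = l ∨ l' = l + 1 := by decide
  obtain ⟨v, l'⟩ := p
  induction d generalizing e l with
  | zero =>
    simp only [traversal, List.mem_append, List.mem_map, List.mem_range, Prod.mk.injEq, zero_add]
    constructor
    · rintro (⟨i, hi, rfl, rfl⟩ | ⟨i, hi, rfl, rfl⟩)
      · exact ⟨i, hi, rfl⟩
      · exact ⟨r - 1 - i, by omega, rfl⟩
    · rintro ⟨i, hi, rfl⟩
      rcases hl l l' with rfl | rfl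
      · exact Or.inl ⟨i, hi, rfl, rfl⟩
      · exact Or.inr ⟨r - 1 - i, by omega, by congr 1; omega, rfl⟩
  | succ d ih =>
    simp only [traversal, List.mem_cons, ih, Prod.mk.injEq]
    constructor
    · rintro (⟨rfl, -⟩ | ⟨rfl, -⟩ | ⟨i, hi, rfl⟩)
      · exact ⟨0, by omega, rfl⟩
      · exact ⟨0, by omega, rfl⟩
      · exact ⟨i + 1, by omega, rfl⟩
    · rintro ⟨_ | i, hi, rfl⟩
      · rcases hl l l' with rfl | rfl <;> simp
      · exact Or.inr (Or.inr ⟨i, by omega, rfl⟩)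

lemma traversal_nodup {τ : V → V} {r d : ℕ} {e : V} {l : ZMod 2}
    (h : ∀ i j, i < d + r → j < d + r → τ^[i] e = τ^[j] e → i = j) :
    (traversal τ r d e l).Nodup := by
  have hl : ∀ l : ZMod 2, l ≠ l + 1 := by decide
  induction d generalizing e l with
  | zero =>
    refine List.nodup_append.mpr ⟨?_, ?_, ?_⟩
    · refine List.Nodup.map_on ?_ List.nodup_range
      intro i hi j hj hij
      simp only [List.mem_range, Prod.mk.injEq] at hi hj hij
      exact h i j (by omega) (by omega) hij.1
    · refine List.Nodup.map_on ?_ List.nodup_range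
      intro i hi j hj hij
      simp only [List.mem_range, Prod.mk.injEq] at hi hj hij
      have := h _ _ (by omega) (by omega) hij.1
      omega
    · intro a ha b hb hab
      simp only [List.mem_map] at ha hb
      obtain ⟨i, -, rfl⟩ := ha
      obtain ⟨j, -, rfl⟩ := hb
      exact hl l (Prod.ext_iff.mp hab).2
  | succ d ih =>
    have he : ∀ l', (e, l') ∉ traversal τ r d (τ e) (l + 1) := by
      intro l' hmem
      obtain ⟨i, hi, hie⟩ := mem_traversal.mp hmem
      have := h (i + 1) 0 (by omega) (by omega) hie
      omega
    have hd : (traversal τ r d (τ e) (l + 1)).Nodup := by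
      refine ih fun i j hi hj hij => ?_
      have := h (i + 1) (j + 1) (by omega) (by omega) hij
      omega
    simp only [traversal, List.nodup_cons, List.mem_cons, Prod.mk.injEq, true_and, not_or]
    exact ⟨⟨hl l, he l⟩, he _, hd⟩

lemma traversal_isTrail {G : SimpleGraph V} {τ : V → V} (hτ : ∀ v, G.Adj v (τ v)) {r : ℕ}
    (hr : 0 < r) (d : ℕ) (e : V) (l : ZMod 2) :
    IsTrail G (e, l) (τ^[d] e, l + d + 1) (traversal τ r d e l) := by
  have hl : ∀ l : ZMod 2, l ≠ l + 1 := by decide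
  induction d generalizing e l with
  | zero =>
    obtain ⟨r, rfl⟩ := Nat.exists_eq_succ_of_ne_zero hr.ne'
    refine IsTrail.append (b := (τ^[r] e, l)) (c := (τ^[r] e, l + 1)) ⟨?_, ?_, ?_⟩ ⟨?_, ?_, ?_⟩ ?_
    · simp [List.range_succ_eq_map]
    · simp [List.range_succ]
    · rw [List.isChain_iff_getElem]
      intro i hi
      simp only [List.getElem_map, List.getElem_range]
      exact Or.inl ⟨by rw [Function.iterate_succ_apply']; exact hτ _, rfl⟩
    · simp [List.range_succ_eq_map]
    · simp [List.range_succ]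
    · rw [List.isChain_iff_getElem]
      intro i hi
      simp only [List.length_map, List.length_range] at hi
      simp only [List.getElem_map, List.getElem_range]
      refine Or.inl ⟨?_, rfl⟩
      have : r + 1 - 1 - i = (r + 1 - 1 - (i + 1)) + 1 := by omega
      rw [this, Function.iterate_succ_apply']
      exact (hτ _).symm
    · exact Or.inr ⟨rfl, hl l⟩
  | succ d ih =>
    have := ((ih (τ e) (l + 1)).cons (a := (e, l + 1)) (Or.inl ⟨hτ e, rfl⟩)).cons (a := (e, l))
      (Or.inr ⟨rfl, hl l⟩)
    have h2 : l + (d + 1 : ℕ) + 1 = l + 1 + d + 1 := by push_cast; ring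
    rw [h2]
    exact this

end Traverse

/-! ### Cycles of permutations -/

section Orbit

variable {V : Type*} (τ : Equiv.Perm V)

open Function

lemma minimalPeriod_perm_pos [Finite V] (e : V) : 0 < minimalPeriod τ e :=
  minimalPeriod_pos_of_mem_periodicPts (τ.injective.mem_periodicPts e)

lemma sameCycle_iff_exists_iterate [Finite V] {e v : V} :
    τ.SameCycle e v ↔ ∃ i < minimalPeriod τ e, τ^[i] e = v := by
  constructor
  · intro h
    obtain ⟨i, hi⟩ := h.exists_nat_pow_eq
    refine ⟨i % minimalPeriod τ e, Nat.mod_lt _ (minimalPeriod_perm_pos τ e), ?_⟩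
    rw [iterate_mod_minimalPeriod_eq, Equiv.Perm.iterate_eq_pow, hi]
  · rintro ⟨i, -, rfl⟩
    exact ⟨i, by rw [Equiv.Perm.iterate_eq_pow]; simp⟩

lemma sameCycle_iterate (e : V) (i : ℕ) : τ.SameCycle e (τ^[i] e) :=
  ⟨i, by rw [Equiv.Perm.iterate_eq_pow]; simp⟩

lemma minimalPeriod_eq_of_sameCycle [Finite V] {e v : V} (h : τ.SameCycle e v) :
    minimalPeriod τ v = minimalPeriod τ e := by
  obtain ⟨i, -, rfl⟩ := (sameCycle_iff_exists_iterate τ).mp h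
  exact minimalPeriod_apply_iterate (τ.injective.mem_periodicPts e) i

lemma minimalPeriod_perm_inv (e : V) : minimalPeriod ⇑τ⁻¹ e = minimalPeriod τ e := by
  refine minimalPeriod_eq_minimalPeriod_iff.mpr fun n => ?_
  simp only [IsPeriodicPt, IsFixedPt, Equiv.Perm.iterate_eq_pow, inv_pow]
  rw [Equiv.Perm.inv_eq_iff_eq, eq_comm]

lemma iterate_injective_of_lt {e : V} {i j : ℕ} (hi : i < minimalPeriod τ e)
    (hj : j < minimalPeriod τ e) (h : τ^[i] e = τ^[j] e) : i = j :=
  (iterate_eq_iterate_iff_of_lt_minimalPeriod hi hj).mp h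

end Orbit

/-! ### Chains of cycles -/

section Chain

open Function

variable {V : Type*}

/-- The cycle of `v` under `σ`, as a set. -/
def orbitSet (σ : Equiv.Perm V) (v : V) : Set V := {w | σ.SameCycle v w}

/-- A list of prism vertices that contains each of them exactly once, in the order in which some
Hamiltonian cycle meets them. -/
def IsPrismCycle (G : SimpleGraph V) (W : List (V × ZMod 2)) : Prop :=
  W.Nodup ∧ (∀ p, p ∈ W) ∧ ∃ a b, IsTrail G a b W ∧ PrismAdj G b a

/-- A partial Hamiltonian cycle of the prism: the list `W` of the prism vertices that have been
passed, the layer `lay` in which the current cycle has been entered, its entry vertex `e`, and the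
union `U` of all the cycles that have been entered. The current cycle is in `U`, but not
in `W`, because its traversal depends on the cycle that follows. -/
structure Chain (V : Type*) where
  W : List (V × ZMod 2)
  lay : ZMod 2
  e : V
  U : Set V

variable (G : SimpleGraph V) (σ : Equiv.Perm V)

open Classical in
/-- The cycle with entry `e` is left for the cycle of `v` at `e` if this is possible, and at `σ e`
otherwise. -/
noncomputable def exitDepth (e v : V) : ℕ := if G.Adj e v ∨ G.Adj e (σ v) then 0 else 1

open Classical in
/-- The vertex, `v` or `σ v`, at which the cycle of `v` is entered. -/
noncomputable def entryVertex (e v : V) : V :=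
  if G.Adj (σ^[exitDepth G σ e v] e) v then v else σ v

/-- Append the traversal of the current cycle, with exit vertex `σ^[d] e`. -/
noncomputable def Chain.close (c : Chain V) (d : ℕ) : List (V × ZMod 2) :=
  c.W ++ traversal σ (minimalPeriod σ c.e - d) d c.e c.lay

open Classical in
/-- Extend a chain by the cycle of `v`, unless this has been entered before. -/
noncomputable def Chain.step (c : Chain V) (v : V) : Chain V :=
  if v ∈ c.U then c else
    { W := c.close σ (exitDepth G σ c.e v)
      lay := c.lay + exitDepth G σ c.e v + 1
      e := entryVertex G σ c.e v
      U := c.U ∪ orbitSet σ v }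

open Classical in
/-- The candidate for a Hamiltonian cycle of the prism that starts with the traversal of the cycle
of `s` under `τ` (which is `σ` or its inverse), goes on with the cycle of `x`, which is entered
at `x`, and then with the cycles of the elements of `vs`. In the last cycle the exit vertex
is determined by `dl`. -/
noncomputable def candidate (τ : Equiv.Perm V) (s : V) (d r : ℕ) (x : V) (vs : List V) (dl : ℕ) :
    List (V × ZMod 2) :=
  if x ∈ orbitSet σ s then traversal τ r d s 0 else
    (vs.foldl (Chain.step G σ) ⟨traversal τ r d s 0, d + 1, x, orbitSet σ s ∪ orbitSet σ x⟩).close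
      σ dl

/-- Some choice of the parameters makes the candidate a Hamiltonian cycle of the prism. Here `all`
is meant to be a list of all vertices. -/
def HasCandidate (all : List V) : Prop :=
  ∃ s, ∃ d < minimalPeriod σ s, ∃ τ, (τ = σ ∨ τ = σ⁻¹) ∧ ∃ x j q, ∃ dl < 2,
    IsPrismCycle G (candidate G σ τ s d (minimalPeriod σ s - d) x (j :: q :: all) dl)

variable {G σ}

lemma mem_orbitSet {v w : V} : w ∈ orbitSet σ v ↔ σ.SameCycle v w := Iff.rfl

lemma mem_orbitSet_self (v : V) : v ∈ orbitSet σ v := Equiv.Perm.SameCycle.refl σ v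

lemma exitDepth_le (e v : V) : exitDepth G σ e v ≤ 1 := by
  unfold exitDepth
  split_ifs <;> simp

lemma entryVertex_eq (e v : V) : entryVertex G σ e v = v ∨ entryVertex G σ e v = σ v := by
  unfold entryVertex
  split_ifs <;> simp

lemma sameCycle_entryVertex (e v : V) : σ.SameCycle v (entryVertex G σ e v) := by
  rcases entryVertex_eq (G := G) (σ := σ) e v with h | h <;> rw [h]
  simp [Equiv.Perm.SameCycle.refl]

lemma adj_exit_entry (h2 : IsTwoKTwoFree G) (hσ : ∀ v, G.Adj v (σ v)) {e v : V}
    (h : ¬ σ.SameCycle e v) : G.Adj (σ^[exitDepth G σ e v] e) (entryVertex G σ e v) := by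
  have hn : ∀ a b, σ.SameCycle e a → σ.SameCycle v b → a ≠ b := by
    rintro a b ha hb rfl
    exact h (ha.trans hb.symm)
  have he := Equiv.Perm.SameCycle.refl σ e
  have hv := Equiv.Perm.SameCycle.refl σ v
  have := h2.exists_adj (hσ e) (hσ v) (hn _ _ he hv) (hn _ _ he (by simpa using hv))
    (hn _ _ (by simpa using he) hv) (hn _ _ (by simpa using he) (by simpa using hv))
  unfold entryVertex
  split_ifs with h1
  · exact h1
  · unfold exitDepth at h1 ⊢
    split_ifs at h1 ⊢ with h3
    · exact h3.resolve_left h1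
    · simp only [iterate_one] at h1 ⊢
      tauto

/-- The invariant of the construction of a chain that starts at `a`. -/
structure Chain.Good (G : SimpleGraph V) (σ : Equiv.Perm V) (a : V × ZMod 2) (c : Chain V) :
    Prop where
  trail : ∃ y, IsTrail G a (y, c.lay) c.W ∧ G.Adj y c.e
  nodup : c.W.Nodup
  mem_iff : ∀ p, p ∈ c.W ↔ p.1 ∈ c.U ∧ ¬ σ.SameCycle c.e p.1
  closed : ∀ v w, σ.SameCycle v w → v ∈ c.U → w ∈ c.U
  e_mem : c.e ∈ c.U

lemma two_le_minimalPeriod [Finite V] (hσ : ∀ v, G.Adj v (σ v)) (v : V) :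
    2 ≤ minimalPeriod σ v := by
  have h0 := minimalPeriod_perm_pos σ v
  have h1 : minimalPeriod σ v ≠ 1 := by
    rw [Ne, minimalPeriod_eq_one_iff_isFixedPt]
    exact fun h => (hσ v).ne h.symm
  omega

lemma mem_traversal_orbit [Finite V] {τ : Equiv.Perm V} (hτ : τ = σ ∨ τ = σ⁻¹) {e : V} {d : ℕ}
    (hd : d < minimalPeriod σ e) {l : ZMod 2} {p : V × ZMod 2} :
    p ∈ traversal τ (minimalPeriod σ e - d) d e l ↔ σ.SameCycle e p.1 := by
  have hk : minimalPeriod τ e = minimalPeriod σ e := by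
    rcases hτ with rfl | rfl
    · rfl
    · exact minimalPeriod_perm_inv σ e
  have hs : τ.SameCycle e p.1 ↔ σ.SameCycle e p.1 := by
    rcases hτ with rfl | rfl
    · rfl
    · exact Equiv.Perm.sameCycle_inv
  rw [mem_traversal, ← hs, sameCycle_iff_exists_iterate, hk, Nat.add_sub_cancel' hd.le]

lemma traversal_orbit_nodup {τ : Equiv.Perm V} (hτ : τ = σ ∨ τ = σ⁻¹) {e : V} {d : ℕ}
    (hd : d < minimalPeriod σ e) {l : ZMod 2} :
    (traversal τ (minimalPeriod σ e - d) d e l).Nodup := by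
  have hk : minimalPeriod τ e = minimalPeriod σ e := by
    rcases hτ with rfl | rfl
    · rfl
    · exact minimalPeriod_perm_inv σ e
  refine traversal_nodup fun i j hi hj hij => ?_
  rw [Nat.add_sub_cancel' hd.le, ← hk] at hi hj
  exact iterate_injective_of_lt τ hi hj hij

lemma adj_perm_or_inv (hσ : ∀ v, G.Adj v (σ v)) {τ : Equiv.Perm V} (hτ : τ = σ ∨ τ = σ⁻¹)
    (v : V) : G.Adj v (τ v) := by
  rcases hτ with rfl | rfl
  · exact hσ v
  · simpa using (hσ (σ⁻¹ v)).symm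

/-- The chain that consists of one traversed cycle, and of a vertex in another one. -/
lemma Chain.Good.init [Finite V] (hσ : ∀ v, G.Adj v (σ v)) {τ : Equiv.Perm V}
    (hτ : τ = σ ∨ τ = σ⁻¹) {s x : V} {d : ℕ} (hd : d < minimalPeriod σ s)
    (hx : ¬ σ.SameCycle s x) (hadj : G.Adj (τ^[d] s) x) :
    Chain.Good G σ (s, 0) ⟨traversal τ (minimalPeriod σ s - d) d s 0, d + 1, x,
      orbitSet σ s ∪ orbitSet σ x⟩ where
  trail := ⟨_, by
    simpa using traversal_isTrail (adj_perm_or_inv hσ hτ) (by omega) d s 0, hadj⟩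
  nodup := traversal_orbit_nodup hτ hd
  mem_iff p := by
    rw [mem_traversal_orbit hτ hd]
    simp only [Set.mem_union, mem_orbitSet]
    constructor
    · intro h
      exact ⟨Or.inl h, fun h' => hx (h.trans h'.symm)⟩
    · rintro ⟨h | h, h'⟩
      · exact h
      · exact absurd h h'
  closed v w hvw := by
    simp only [Set.mem_union, mem_orbitSet]
    rintro (h | h)
    · exact Or.inl (h.trans hvw)
    · exact Or.inr (h.trans hvw)
  e_mem := Or.inr (mem_orbitSet_self x)

lemma Chain.Good.mem_close [Finite V] {a : V × ZMod 2} {c : Chain V} (hc : c.Good G σ a) {d : ℕ}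
    (hd : d < minimalPeriod σ c.e) (p : V × ZMod 2) : p ∈ c.close σ d ↔ p.1 ∈ c.U := by
  rw [Chain.close, List.mem_append, hc.mem_iff, mem_traversal_orbit (Or.inl rfl) hd]
  constructor
  · rintro (h | h)
    · exact h.1
    · exact hc.closed _ _ h hc.e_mem
  · tauto

lemma Chain.Good.nodup_close [Finite V] {a : V × ZMod 2} {c : Chain V} (hc : c.Good G σ a) {d : ℕ}
    (hd : d < minimalPeriod σ c.e) : (c.close σ d).Nodup := by
  refine List.nodup_append.mpr ⟨hc.nodup, traversal_orbit_nodup (Or.inl rfl) hd, ?_⟩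
  rintro p hp q hq rfl
  exact ((hc.mem_iff p).mp hp).2 ((mem_traversal_orbit (Or.inl rfl) hd).mp hq)

lemma Chain.Good.trail_close (hσ : ∀ v, G.Adj v (σ v)) {a : V × ZMod 2} {c : Chain V}
    (hc : c.Good G σ a) {d : ℕ} (hd : d < minimalPeriod σ c.e) :
    IsTrail G a (σ^[d] c.e, c.lay + d + 1) (c.close σ d) := by
  obtain ⟨y, hy, hadj⟩ := hc.trail
  exact hy.append (traversal_isTrail hσ (by omega) d c.e c.lay) (Or.inl ⟨hadj, rfl⟩)

lemma Chain.Good.step [Finite V] (h2 : IsTwoKTwoFree G) (hσ : ∀ v, G.Adj v (σ v))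
    {a : V × ZMod 2} {c : Chain V} (hc : c.Good G σ a) (v : V) : (c.step G σ v).Good G σ a := by
  unfold Chain.step
  split_ifs with hv
  · exact hc
  have hev : ¬ σ.SameCycle c.e v := fun h => hv (hc.closed _ _ h hc.e_mem)
  have hd : exitDepth G σ c.e v < minimalPeriod σ c.e :=
    (exitDepth_le c.e v).trans_lt (two_le_minimalPeriod hσ c.e)
  exact
    { trail := ⟨_, hc.trail_close hσ hd, adj_exit_entry h2 hσ hev⟩
      nodup := hc.nodup_close hd
      mem_iff := fun p => by
        have hs := sameCycle_entryVertex (G := G) (σ := σ) c.e v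
        rw [hc.mem_close hd]
        simp only [Set.mem_union, mem_orbitSet]
        constructor
        · intro hp
          exact ⟨Or.inl hp, fun h => hv (hc.closed _ _ (hs.trans h).symm hp)⟩
        · rintro ⟨h | h, h'⟩
          · exact h
          · exact absurd (hs.symm.trans h) h'
      closed := fun u w huw => by
        simp only [Set.mem_union, mem_orbitSet]
        rintro (h | h)
        · exact Or.inl (hc.closed _ _ huw h)
        · exact Or.inr (h.trans huw)
      e_mem := Or.inr (sameCycle_entryVertex c.e v) }

lemma Chain.Good.foldl [Finite V] (h2 : IsTwoKTwoFree G) (hσ : ∀ v, G.Adj v (σ v))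
    {a : V × ZMod 2} (vs : List V) {c : Chain V} (hc : c.Good G σ a) :
    (vs.foldl (Chain.step G σ) c).Good G σ a := by
  induction vs generalizing c with
  | nil => exact hc
  | cons v vs ih => exact ih (hc.step h2 hσ v)

lemma Chain.subset_step (c : Chain V) (v : V) : c.U ⊆ (c.step G σ v).U := by
  unfold Chain.step
  split_ifs
  · rfl
  · exact Set.subset_union_left

lemma Chain.subset_foldl (vs : List V) (c : Chain V) :
    c.U ⊆ (vs.foldl (Chain.step G σ) c).U := by
  induction vs generalizing c with
  | nil => rfl
  | cons v vs ih => exact (c.subset_step v).trans (ih _)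

lemma Chain.mem_foldl {vs : List V} {v : V} (hv : v ∈ vs) (c : Chain V) :
    v ∈ (vs.foldl (Chain.step G σ) c).U := by
  induction vs generalizing c with
  | nil => simp at hv
  | cons w vs ih =>
    rcases List.mem_cons.mp hv with rfl | hv
    · refine Chain.subset_foldl vs _ ?_
      unfold Chain.step
      split_ifs with h
      · exact h
      · exact Or.inr (mem_orbitSet_self v)
    · exact ih hv _

lemma Chain.W_subset_foldl (vs : List V) (c : Chain V) :
    c.W ⊆ (vs.foldl (Chain.step G σ) c).W := by
  induction vs generalizing c with
  | nil => exact List.Subset.refl _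
  | cons v vs ih =>
    refine List.Subset.trans ?_ (ih _)
    unfold Chain.step
    split_ifs
    · exact List.Subset.refl _
    · exact List.subset_append_left _ _

/-- The part of a chain that is still to come depends only on `e` and `U`. -/
lemma Chain.foldl_congr (vs : List V) (c c' : Chain V) (he : c'.e = c.e) (hU : c'.U = c.U) :
    (vs.foldl (Chain.step G σ) c').e = (vs.foldl (Chain.step G σ) c).e ∧
    (vs.foldl (Chain.step G σ) c').lay - c'.lay = (vs.foldl (Chain.step G σ) c).lay - c.lay := by
  induction vs generalizing c c' with
  | nil => simp [he]
  | cons v vs ih =>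
    have h1 : (c'.step G σ v).e = (c.step G σ v).e := by
      unfold Chain.step
      rw [hU]
      split_ifs <;> simp [he]
    have h2 : (c'.step G σ v).U = (c.step G σ v).U := by
      unfold Chain.step
      rw [hU]
      split_ifs <;> simp [hU]
    have h3 : (c'.step G σ v).lay - c'.lay = (c.step G σ v).lay - c.lay := by
      unfold Chain.step
      rw [hU]
      split_ifs
      · simp
      · simp only [he]
        ring
    obtain ⟨h4, h5⟩ := ih _ _ h1 h2
    refine ⟨h4, ?_⟩
    simp only [List.foldl_cons]
    linear_combination h5 + h3

/-- A chain through all cycles that can be closed up gives a Hamiltonian cycle of the prism. -/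
lemma isPrismCycle_candidate [Finite V] (h2 : IsTwoKTwoFree G) (hσ : ∀ v, G.Adj v (σ v))
    {τ : Equiv.Perm V} (hτ : τ = σ ∨ τ = σ⁻¹) {s x : V} {d : ℕ} (hd : d < minimalPeriod σ s)
    (hx : ¬ σ.SameCycle s x) (hadj : G.Adj (τ^[d] s) x) {vs : List V} (hvs : ∀ v, v ∈ vs)
    {dl : ℕ} (hdl : dl < 2) {c : Chain V} (hc : c = vs.foldl (Chain.step G σ)
      ⟨traversal τ (minimalPeriod σ s - d) d s 0, d + 1, x, orbitSet σ s ∪ orbitSet σ x⟩)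
    (hclose : G.Adj (σ^[dl] c.e) s) (hlay : c.lay + dl + 1 = 0) :
    IsPrismCycle G (candidate G σ τ s d (minimalPeriod σ s - d) x vs dl) := by
  rw [candidate, if_neg (show x ∉ orbitSet σ s from hx), ← hc]
  have hgood : c.Good G σ (s, 0) := by
    rw [hc]
    exact (Chain.Good.init hσ hτ hd hx hadj).foldl h2 hσ vs
  have hdl' : dl < minimalPeriod σ c.e := hdl.trans_le (two_le_minimalPeriod hσ c.e)
  refine ⟨hgood.nodup_close hdl', fun p => ?_, (s, 0), _, hgood.trail_close hσ hdl', ?_⟩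
  · rw [hgood.mem_close hdl', hc]
    exact Chain.mem_foldl (hvs _) _
  · exact Or.inl ⟨hclose, hlay⟩

/-- If `σ` is a single cycle, then this cycle alone is enough. -/
lemma hasCandidate_of_single [Finite V] (hσ : ∀ v, G.Adj v (σ v)) (s : V)
    (hs : ∀ v, σ.SameCycle s v) (all : List V) : HasCandidate G σ all := by
  have hk := two_le_minimalPeriod hσ s
  refine ⟨s, 1, by omega, σ, Or.inl rfl, s, s, s, 0, by omega, ?_⟩
  rw [candidate, if_pos (mem_orbitSet_self s)]
  refine ⟨traversal_orbit_nodup (Or.inl rfl) (by omega), fun p => ?_, _, _,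
    traversal_isTrail hσ (by omega) 1 s 0, Or.inl ⟨(hσ s).symm,
      show (0 : ZMod 2) + (1 : ℕ) + 1 = 0 by decide⟩⟩
  rw [mem_traversal_orbit (Or.inl rfl) (by omega)]
  exact hs _

/-- If some cycle can be traversed towards `x` with both layer parities from each of the ends
of one of its edges, then one of the parities closes the chain up. -/
lemma hasCandidate_of_two_parities [Finite V] (h2 : IsTwoKTwoFree G) (hσ : ∀ v, G.Adj v (σ v))
    {all : List V} (hall : ∀ v, v ∈ all) {o t₁ t₂ x : V} (h1 : σ.SameCycle o t₁)
    (h1' : σ.SameCycle o t₂) (ht : G.Adj t₁ t₂) (hx : ¬ σ.SameCycle o x)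
    (h : ∀ t, t = t₁ ∨ t = t₂ → ∀ π : ZMod 2, ∃ d < minimalPeriod σ t, ∃ τ, (τ = σ ∨ τ = σ⁻¹) ∧
      G.Adj (τ^[d] t) x ∧ (d : ZMod 2) + 1 = π) : HasCandidate G σ all := by
  have hot : ∀ t, t = t₁ ∨ t = t₂ → σ.SameCycle o t := by
    rintro t (rfl | rfl) <;> assumption
  have hU : ∀ t, t = t₁ ∨ t = t₂ → orbitSet σ t = orbitSet σ o := by
    intro t h'
    ext w
    exact ⟨fun hw => (hot t h').trans hw, fun hw => (hot t h').symm.trans hw⟩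
  have hxt : ∀ t, t = t₁ ∨ t = t₂ → ¬ σ.SameCycle t x := fun t h' hs => hx ((hot t h').trans hs)
  set vs := o :: o :: all with hvs
  have hvs' : ∀ v, v ∈ vs := fun v => by simp [hvs, hall v]
  -- The chain without its first cycle determines the last cycle and the parity of the rest.
  set c₀ := vs.foldl (Chain.step G σ) ⟨[], 0, x, orbitSet σ o ∪ orbitSet σ x⟩ with hc₀
  have he : ¬ σ.SameCycle o c₀.e := by
    intro hoe
    obtain ⟨d, hd, τ, hτ, hadj, -⟩ := h t₁ (Or.inl rfl) 0
    have hinit := Chain.Good.init hσ hτ hd (hxt t₁ (Or.inl rfl)) hadj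
    have hgood := hinit.foldl h2 hσ vs
    have hmem : (t₁, (0 : ZMod 2)) ∈ traversal τ (minimalPeriod σ t₁ - d) d t₁ 0 :=
      (mem_traversal_orbit hτ hd).mpr (Equiv.Perm.SameCycle.refl _ _)
    have := ((hgood.mem_iff _).mp (Chain.W_subset_foldl vs _ hmem)).2
    rw [(Chain.foldl_congr (G := G) (σ := σ) vs ⟨[], 0, x, orbitSet σ o ∪ orbitSet σ x⟩
      ⟨traversal τ (minimalPeriod σ t₁ - d) d t₁ 0, d + 1, x, orbitSet σ t₁ ∪ orbitSet σ x⟩ rfl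
      (by simp [hU t₁ (Or.inl rfl)])).1] at this
    exact this (hoe.symm.trans h1)
  have hne : ∀ a b, σ.SameCycle o a → σ.SameCycle c₀.e b → a ≠ b := by
    rintro a b ha hb rfl
    exact he (ha.trans hb.symm)
  obtain ⟨t, ht', dl, hdl, hadj'⟩ : ∃ t, (t = t₁ ∨ t = t₂) ∧ ∃ dl < 2, G.Adj t (σ^[dl] c₀.e) := by
    have hr := Equiv.Perm.SameCycle.refl σ c₀.e
    have hr' : σ.SameCycle c₀.e (σ c₀.e) := by simpa using hr
    rcases h2.exists_adj ht (hσ c₀.e) (hne _ _ h1 hr) (hne _ _ h1 hr') (hne _ _ h1' hr)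
      (hne _ _ h1' hr') with h' | h' | h' | h'
    · exact ⟨t₁, Or.inl rfl, 0, by omega, h'⟩
    · exact ⟨t₁, Or.inl rfl, 1, by omega, h'⟩
    · exact ⟨t₂, Or.inr rfl, 0, by omega, h'⟩
    · exact ⟨t₂, Or.inr rfl, 1, by omega, h'⟩
  obtain ⟨d, hd, τ, hτ, hadj, hπ⟩ := h t ht' (-(c₀.lay + dl + 1))
  have hcongr := Chain.foldl_congr (G := G) (σ := σ) vs ⟨[], 0, x, orbitSet σ o ∪ orbitSet σ x⟩
    ⟨traversal τ (minimalPeriod σ t - d) d t 0, d + 1, x, orbitSet σ t ∪ orbitSet σ x⟩ rfl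
    (by simp [hU t ht'])
  refine ⟨t, d, hd, τ, hτ, x, o, o, dl, hdl,
    isPrismCycle_candidate h2 hσ hτ hd (hxt t ht') hadj hvs' hdl rfl ?_ ?_⟩
  · rw [hcongr.1]
    exact hadj'.symm
  · have := hcongr.2
    simp only [← hc₀] at this
    linear_combination this + hπ

/-- A cycle of odd length can be traversed in both directions, with different parities. -/
lemma hasCandidate_of_odd [Finite V] (h2 : IsTwoKTwoFree G) (hσ : ∀ v, G.Adj v (σ v))
    {all : List V} (hall : ∀ v, v ∈ all) {o : V} (ho : Odd (minimalPeriod σ o)) :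
    HasCandidate G σ all := by
  by_cases hs : ∀ v, σ.SameCycle o v
  · exact hasCandidate_of_single hσ o hs all
  push Not at hs
  obtain ⟨x₀, hx₀⟩ := hs
  have hro := Equiv.Perm.SameCycle.refl σ o
  have hro' : σ.SameCycle o (σ o) := by simpa using hro
  have hrx := Equiv.Perm.SameCycle.refl σ x₀
  have hrx' : σ.SameCycle x₀ (σ x₀) := by simpa using hrx
  have hne : ∀ a b, σ.SameCycle o a → σ.SameCycle x₀ b → a ≠ b := by
    rintro a b ha hb rfl
    exact hx₀ (ha.trans hb.symm)
  obtain ⟨y, x, hy, hx, hyx⟩ : ∃ y x, σ.SameCycle o y ∧ σ.SameCycle x₀ x ∧ G.Adj y x := by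
    rcases h2.exists_adj (hσ o) (hσ x₀) (hne _ _ hro hrx) (hne _ _ hro hrx') (hne _ _ hro' hrx)
      (hne _ _ hro' hrx') with h' | h' | h' | h'
    · exact ⟨_, _, hro, hrx, h'⟩
    · exact ⟨_, _, hro, hrx', h'⟩
    · exact ⟨_, _, hro', hrx, h'⟩
    · exact ⟨_, _, hro', hrx', h'⟩
  -- The cycle leaves at `y` and starts at `σ y` or at `σ (σ y)`; going forwards and backwards takes
  -- numbers of steps whose sum is the length of the cycle.
  have hy1 : σ.SameCycle o (σ y) := by simpa using hy
  have hy2 : σ.SameCycle o (σ (σ y)) := by simpa using hy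
  have hk := two_le_minimalPeriod hσ o
  have hky := minimalPeriod_eq_of_sameCycle σ hy
  obtain ⟨m, hm⟩ := ho
  have hper : σ^[minimalPeriod σ o] y = y := by
    rw [← hky]
    exact iterate_minimalPeriod
  have hcast : ((minimalPeriod σ o : ℕ) : ZMod 2) = 1 := by
    rw [hm]
    push_cast
    have : (2 : ZMod 2) = 0 := by decide
    rw [this]
    simp
  have hπ : ∀ π : ZMod 2, π = 0 ∨ π = 1 := by decide
  refine hasCandidate_of_two_parities h2 hσ hall hy1 hy2 (hσ _)
    (fun h' => hx₀ (h'.trans hx.symm)) ?_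
  rintro t (rfl | rfl) π
  · rw [minimalPeriod_eq_of_sameCycle σ hy1]
    rcases hπ π with rfl | rfl
    · exact ⟨1, by omega, σ⁻¹, Or.inr rfl, by simpa using hyx, by decide⟩
    · refine ⟨minimalPeriod σ o - 1, by omega, σ, Or.inl rfl, ?_, ?_⟩
      · rw [← iterate_succ_apply, show (minimalPeriod σ o - 1).succ = minimalPeriod σ o by omega,
          hper]
        exact hyx
      · rw [Nat.cast_sub (by omega), hcast]
        decide
  · rw [minimalPeriod_eq_of_sameCycle σ hy2]
    rcases hπ π with rfl | rfl
    · refine ⟨minimalPeriod σ o - 2, by omega, σ, Or.inl rfl, ?_, ?_⟩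
      · rw [← iterate_succ_apply, ← iterate_succ_apply,
          show (minimalPeriod σ o - 2).succ.succ = minimalPeriod σ o by omega, hper]
        exact hyx
      · rw [Nat.cast_sub (by omega), hcast]
        decide
    · exact ⟨2, by omega, σ⁻¹, Or.inr rfl, by simpa using hyx, by decide⟩

/-- A matching edge in a triangle can be left from both of its ends, with different parities. -/
lemma hasCandidate_of_triangle [Finite V] (h2 : IsTwoKTwoFree G) (hσ : ∀ v, G.Adj v (σ v))
    (hinv : ∀ v, σ (σ v) = v) {all : List V} (hall : ∀ v, v ∈ all) {y x : V} (hyx : G.Adj y x)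
    (hyx' : G.Adj (σ y) x) : HasCandidate G σ all := by
  have hro := Equiv.Perm.SameCycle.refl σ y
  have hro' : σ.SameCycle y (σ y) := by simpa using hro
  have hx : ¬ σ.SameCycle y x := by
    rw [sameCycle_iff_exists_iterate]
    rintro ⟨i, hi, rfl⟩
    have hle : minimalPeriod σ y ≤ 2 :=
      IsPeriodicPt.minimalPeriod_le (by omega) (hinv y)
    interval_cases hki : minimalPeriod σ y <;> interval_cases i
    · exact hyx.ne rfl
    · exact hyx.ne rfl
    · exact hyx'.ne rfl
  have hπ : ∀ π : ZMod 2, π = 0 ∨ π = 1 := by decide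
  refine hasCandidate_of_two_parities h2 hσ hall hro hro' (hσ y) hx ?_
  rintro t ht π
  have hk := two_le_minimalPeriod hσ t
  rcases hπ π with rfl | rfl
  · refine ⟨1, by omega, σ, Or.inl rfl, ?_, by decide⟩
    rcases ht with rfl | rfl
    · exact hyx'
    · simpa [hinv] using hyx
  · refine ⟨0, by omega, σ, Or.inl rfl, ?_, by decide⟩
    rcases ht with rfl | rfl
    · exact hyx
    · exact hyx'

end Chain

/-! ### Perfect matchings without closing chains -/

section Matching

open Function

variable {V : Type*} {G : SimpleGraph V} {σ : Equiv.Perm V}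

lemma sameCycle_iff_of_involutive [Finite V] (hinv : ∀ v, σ (σ v) = v) {v w : V} :
    σ.SameCycle v w ↔ w = v ∨ w = σ v := by
  constructor
  · rw [sameCycle_iff_exists_iterate]
    rintro ⟨i, hi, rfl⟩
    have hle : minimalPeriod σ v ≤ 2 := IsPeriodicPt.minimalPeriod_le (by omega) (hinv v)
    obtain rfl | rfl : i = 0 ∨ i = 1 := by omega
    · exact Or.inl rfl
    · exact Or.inr rfl
  · rintro (rfl | rfl) <;> simp [Equiv.Perm.SameCycle.refl]

/-- A perfect matching, given by the involution `σ`, none of whose edges is in a triangle. -/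
structure TriangleFreeMatching (G : SimpleGraph V) (σ : Equiv.Perm V) : Prop where
  twoKTwoFree : IsTwoKTwoFree G
  adj : ∀ v, G.Adj v (σ v)
  inv : ∀ v, σ (σ v) = v
  not_adj : ∀ v x, G.Adj v x → ¬ G.Adj (σ v) x

open Classical in
/-- Whether the edges between the matching edges at `v` and at `w` join `v` to `w` or `σ v` to
`σ w`, rather than `v` to `σ w` or `σ v` to `w`. -/
noncomputable def aligned (G : SimpleGraph V) (σ : Equiv.Perm V) (v w : V) : ZMod 2 :=
  if G.Adj v w ∨ G.Adj (σ v) (σ w) then 1 else 0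

lemma aligned_comm (v w : V) : aligned G σ v w = aligned G σ w v := by
  unfold aligned
  rw [G.adj_comm w v, G.adj_comm (σ w) (σ v)]

namespace TriangleFreeMatching

variable (hM : TriangleFreeMatching G σ)

include hM

lemma aligned_apply_right [Finite V] {v w : V} (h : ¬ σ.SameCycle v w) :
    aligned G σ v (σ w) = aligned G σ v w + 1 := by
  rw [sameCycle_iff_of_involutive hM.inv, not_or] at h
  have h3 : σ v ≠ σ w := fun h' => h.1 (σ.injective h'.symm)
  have h4 : v ≠ σ w := fun h' => h.2 (by rw [h', hM.inv])
  have := hM.twoKTwoFree.exists_adj (hM.adj v) (hM.adj w) (Ne.symm h.1) h4 (Ne.symm h.2) h3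
  have e1 := hM.not_adj v w
  have e2 := hM.not_adj v (σ w)
  have e3 := hM.not_adj w v
  have e4 := hM.not_adj w (σ v)
  rw [G.adj_comm, G.adj_comm (σ w)] at e3 e4
  have h0 : (1 : ZMod 2) + 1 = 0 := by decide
  unfold aligned
  rw [hM.inv]
  split_ifs <;> first | exact h0.symm | (simp; done) | (exfalso; tauto)

lemma aligned_apply_left [Finite V] {v w : V} (h : ¬ σ.SameCycle v w) :
    aligned G σ (σ v) w = aligned G σ v w + 1 := by
  rw [aligned_comm, hM.aligned_apply_right (fun h' => h h'.symm), aligned_comm]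

omit hM in
lemma aligned_of_adj {v w : V} (h : G.Adj v w) : aligned G σ v w = 1 := by
  simp [aligned, h]

end TriangleFreeMatching

open Classical in
/-- Whether `e` is the representative `r` of its matching edge. -/
noncomputable def isRep (e r : V) : ZMod 2 := if e = r then 1 else 0

open Classical in
/-- The representatives `r, …` of the matching edges that a chain passes, and the sum of `aligned`
over consecutive ones. Only the last representative and the sum are returned. -/
noncomputable def alignedSum (G : SimpleGraph V) (σ : Equiv.Perm V) :
    V → Set V → List V → V × ZMod 2
  | r, _, [] => (r, 0)
  | r, U, v :: vs => if v ∈ U then alignedSum G σ r U vs else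
      ((alignedSum G σ v (U ∪ orbitSet σ v) vs).1,
        aligned G σ r v + (alignedSum G σ v (U ∪ orbitSet σ v) vs).2)

namespace TriangleFreeMatching

variable (hM : TriangleFreeMatching G σ)

include hM

lemma isRep_apply {e r : V} (he : e = r ∨ e = σ r) : isRep (σ e) r = isRep e r + 1 := by
  have h0 : (1 : ZMod 2) + 1 = 0 := by decide
  have h1 := (hM.adj r).ne
  rcases he with rfl | rfl
  · simp [isRep, h1.symm, h0]
  · simp [isRep, hM.inv, h1.symm]

lemma isRep_iterate {e r : V} (he : e = r ∨ e = σ r) {d : ℕ} (hd : d < 2) :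
    isRep (σ^[d] e) r = isRep e r + d ∧ (σ^[d] e = r ∨ σ^[d] e = σ r) := by
  obtain rfl | rfl : d = 0 ∨ d = 1 := by omega
  · simpa using he
  · rw [iterate_one, hM.isRep_apply he]
    refine ⟨by simp, ?_⟩
    rcases he with rfl | rfl
    · exact Or.inr rfl
    · exact Or.inl (hM.inv r)

/-- An edge between the matching edges of `r` and `v` determines `aligned`. -/
lemma aligned_eq [Finite V] {a c r v : V} (ha : a = r ∨ a = σ r) (hc : c = v ∨ c = σ v)
    (hac : G.Adj a c) (hrv : ¬ σ.SameCycle r v) :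
    aligned G σ r v = 1 + isRep a r + isRep c v := by
  have h0 : (1 : ZMod 2) + 1 = 0 := by decide
  have h1 := (hM.adj r).ne
  have h2 := (hM.adj v).ne
  have hrv' : ¬ σ.SameCycle r (σ v) := by simpa using hrv
  have key := aligned_of_adj (σ := σ) hac
  rcases ha with rfl | rfl <;> rcases hc with rfl | rfl
  · simp [key, isRep, h0]
  · rw [hM.aligned_apply_right hrv] at key
    simp [isRep, h2.symm]
    linear_combination key - h0
  · rw [hM.aligned_apply_left hrv] at key
    simp [isRep, h1.symm]
    linear_combination key - h0
  · rw [hM.aligned_apply_left hrv', hM.aligned_apply_right hrv] at key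
    simp [isRep, h1.symm, h2.symm]
    linear_combination key - h0

/-- The layer at the end of a chain, corrected by `isRep` as the last cycle may have been entered at
either end of its edge, changes by the sum of `aligned` along the chain. -/
lemma foldl_parity [Finite V] (vs : List V) (c : Chain V) (r : V) (hr : c.e = r ∨ c.e = σ r)
    (hrU : r ∈ c.U) (hU : ∀ v w, σ.SameCycle v w → v ∈ c.U → w ∈ c.U) {f : Chain V}
    (hf : f = vs.foldl (Chain.step G σ) c) {t : V × ZMod 2} (ht : t = alignedSum G σ r c.U vs) :
    (f.e = t.1 ∨ f.e = σ t.1) ∧ f.lay + isRep f.e t.1 = c.lay + isRep c.e r + t.2 := by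
  induction vs generalizing c r t with
  | nil =>
    subst hf ht
    simpa [alignedSum] using hr
  | cons v vs ih =>
    by_cases hv : v ∈ c.U
    · refine ih c r hr hrU hU ?_ ?_
      · rw [hf, List.foldl_cons, Chain.step, if_pos hv]
      · rw [ht, alignedSum, if_pos hv]
    · have hrv : ¬ σ.SameCycle r v := fun h => hv (hU _ _ h hrU)
      have hre : σ.SameCycle r c.e := (sameCycle_iff_of_involutive hM.inv).mpr hr
      have hev : ¬ σ.SameCycle c.e v := fun h => hrv (hre.trans h)
      obtain ⟨h1, h2⟩ := ih (c.step G σ v) v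
        (t := alignedSum G σ v (c.U ∪ orbitSet σ v) vs)
        (by rw [Chain.step, if_neg hv]; exact entryVertex_eq _ _)
        (by rw [Chain.step, if_neg hv]; exact Or.inr (mem_orbitSet_self v))
        (by
          rw [Chain.step, if_neg hv]
          simp only [Set.mem_union, mem_orbitSet]
          rintro u w huw (h | h)
          · exact Or.inl (hU _ _ huw h)
          · exact Or.inr (h.trans huw))
        (by rw [hf, List.foldl_cons])
        (by rw [Chain.step, if_neg hv])
      rw [alignedSum, if_neg hv] at ht
      rw [ht]
      refine ⟨h1, h2.trans ?_⟩
      obtain ⟨h3, h4⟩ := hM.isRep_iterate hr (d := exitDepth G σ c.e v)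
        (Nat.lt_succ_of_le (exitDepth_le c.e v))
      have h5 := hM.aligned_eq h4 (entryVertex_eq (G := G) (σ := σ) c.e v)
        (adj_exit_entry hM.twoKTwoFree hM.adj hev) hrv
      have h6 : (2 : ZMod 2) = 0 := by decide
      rw [Chain.step, if_neg hv]
      simp only
      rw [h5, h3]
      linear_combination (-isRep c.e r) * h6

/-- If no chain closes up, then the sums of `aligned` around all cyclic orders are `1`. -/
lemma alignedSum_of_not_hasCandidate [Finite V] {all : List V} (hall : ∀ v, v ∈ all)
    (hno : ¬ HasCandidate G σ all) {p i : V} (hpi : ¬ σ.SameCycle p i) (j q : V)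
    {t : V × ZMod 2} (ht : t = alignedSum G σ i (orbitSet σ p ∪ orbitSet σ i) (j :: q :: all)) :
    aligned G σ p i + t.2 + aligned G σ t.1 p = 1 := by
  have h6 : (2 : ZMod 2) = 0 := by decide
  have hs : ∀ {v w}, σ.SameCycle v w ↔ w = v ∨ w = σ v := sameCycle_iff_of_involutive hM.inv
  set vs := j :: q :: all with hvs
  have hvs' : ∀ v, v ∈ vs := fun v => by simp [hvs, hall v]
  -- an edge from the first to the second matching edge
  obtain ⟨y, x, hy, hx, hyx⟩ : ∃ y x, (y = p ∨ y = σ p) ∧ (x = i ∨ x = σ i) ∧ G.Adj y x := by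
    have hpe := sameCycle_entryVertex (G := G) (σ := σ) p i
    exact ⟨_, _, (hM.isRep_iterate (Or.inl rfl) (Nat.lt_succ_of_le (exitDepth_le p i))).2,
      entryVertex_eq p i, adj_exit_entry hM.twoKTwoFree hM.adj hpi⟩
  have hpy : σ.SameCycle p y := hs.mpr hy
  have hix : σ.SameCycle i x := hs.mpr hx
  have hyx' : ¬ σ.SameCycle y x := fun h => hpi (hpy.trans (h.trans hix.symm))
  have hUx : orbitSet σ x = orbitSet σ i :=
    Set.ext fun w => ⟨fun hw => hix.trans hw, fun hw => hix.symm.trans hw⟩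
  have hUt : ∀ s, σ.SameCycle p s → orbitSet σ s = orbitSet σ p := fun s hps =>
    Set.ext fun w => ⟨fun hw => hps.trans hw, fun hw => hps.symm.trans hw⟩
  have hclosed : ∀ v w, σ.SameCycle v w → v ∈ orbitSet σ p ∪ orbitSet σ i →
      w ∈ orbitSet σ p ∪ orbitSet σ i := by
    rintro v w hvw (h | h)
    · exact Or.inl (h.trans hvw)
    · exact Or.inr (h.trans hvw)
  have hper := two_le_minimalPeriod hM.adj
  set c₀ : Chain V := ⟨[], 0, x, orbitSet σ p ∪ orbitSet σ i⟩ with hc₀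
  set f := vs.foldl (Chain.step G σ) c₀ with hf
  obtain ⟨h1, h2⟩ := hM.foldl_parity vs c₀ i hx (Or.inr (mem_orbitSet_self i)) hclosed hf ht
  have hsame : σ.SameCycle t.1 f.e := hs.mpr h1
  have hcongr : ∀ s d, σ.SameCycle p s →
      let c : Chain V := ⟨traversal σ (minimalPeriod σ s - d) d s 0, d + 1, x,
        orbitSet σ s ∪ orbitSet σ x⟩
      (vs.foldl (Chain.step G σ) c).e = f.e ∧
        (vs.foldl (Chain.step G σ) c).lay - (d + 1) = f.lay := by
    intro s d hps c
    obtain ⟨h3, h4⟩ := Chain.foldl_congr (G := G) (σ := σ) vs c₀ c rfl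
      (by simp [c, hc₀, hUx, hUt s hps])
    exact ⟨h3, by simpa [hc₀, c] using h4⟩
  have hfp : ¬ σ.SameCycle p f.e := by
    intro hpf
    have hd : 0 < minimalPeriod σ y := by have := hper y; omega
    have hgood := (Chain.Good.init hM.adj (Or.inl rfl) hd hyx' hyx).foldl hM.twoKTwoFree hM.adj vs
    have hmem : (y, (0 : ZMod 2)) ∈ traversal σ (minimalPeriod σ y - 0) 0 y 0 :=
      (mem_traversal_orbit (Or.inl rfl) hd).mpr (Equiv.Perm.SameCycle.refl _ _)
    have := ((hgood.mem_iff _).mp (Chain.W_subset_foldl vs _ hmem)).2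
    rw [(hcongr y 0 hpy).1] at this
    exact this (hpf.symm.trans hpy)
  have htp : ¬ σ.SameCycle t.1 p := fun h => hfp (h.symm.trans hsame)
  -- an edge from the last to the first matching edge
  have hadj := adj_exit_entry hM.twoKTwoFree hM.adj (e := f.e) (v := p) (fun h => hfp h.symm)
  set dl := exitDepth G σ f.e p
  set s := entryVertex G σ f.e p
  have hdl : dl < 2 := Nat.lt_succ_of_le (exitDepth_le f.e p)
  have hsp : s = p ∨ s = σ p := entryVertex_eq f.e p
  have hps : σ.SameCycle p s := hs.mpr hsp
  obtain ⟨h3, h4⟩ := hM.isRep_iterate h1 hdl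
  have h5 := hM.aligned_eq h4 hsp hadj htp
  have h7 := hM.aligned_eq hy hx hyx hpi
  obtain ⟨d, hd, hdy⟩ : ∃ d < 2, σ^[d] s = y := by
    rcases hsp with h | h <;> rcases hy with h' | h' <;> rw [h, h']
    · exact ⟨0, by omega, rfl⟩
    · exact ⟨1, by omega, rfl⟩
    · exact ⟨1, by omega, hM.inv p⟩
    · exact ⟨0, by omega, rfl⟩
  have h8 := (hM.isRep_iterate hsp hd).1
  rw [hdy] at h8
  obtain ⟨h9, h10⟩ := hcongr s d hps
  have hne : f.lay + d + dl ≠ 0 := by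
    intro h0
    refine hno ⟨s, d, hd.trans_le (hper s), σ, Or.inl rfl, x, j, q, dl, hdl,
      isPrismCycle_candidate hM.twoKTwoFree hM.adj (Or.inl rfl) (hd.trans_le (hper s))
        (fun h => hpi (hps.trans (h.trans hix.symm))) (by rwa [hdy]) hvs' hdl rfl ?_ ?_⟩
    · rw [h9]
      exact hadj
    · linear_combination h10 + h0 + h6
  have hne' : f.lay + d + dl = 1 := by
    have : ∀ z : ZMod 2, z ≠ 0 → z = 1 := by decide
    exact this _ hne
  rw [h5, h7, h3, h8]
  simp only [hc₀] at h2
  linear_combination hne' - h2 + (1 + isRep s p + isRep f.e t.1) * h6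

/-- Comparison of the cyclic orders `p, i, j, q, …` and `p, j, i, q, …`. -/
lemma aligned_balanced [Finite V] {all : List V} (hall : ∀ v, v ∈ all)
    (hno : ¬ HasCandidate G σ all) {p i j q : V} (hpi : ¬ σ.SameCycle p i)
    (hpj : ¬ σ.SameCycle p j) (hpq : ¬ σ.SameCycle p q) (hij : ¬ σ.SameCycle i j)
    (hiq : ¬ σ.SameCycle i q) (hjq : ¬ σ.SameCycle j q) :
    aligned G σ p i + aligned G σ j q = aligned G σ p j + aligned G σ i q := by
  have h1 := hM.alignedSum_of_not_hasCandidate hall hno hpi j q rfl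
  have h2 := hM.alignedSum_of_not_hasCandidate hall hno hpj i q rfl
  have hji : ¬ σ.SameCycle j i := fun h => hij h.symm
  have hU : orbitSet σ p ∪ orbitSet σ j ∪ orbitSet σ i ∪ orbitSet σ q =
      orbitSet σ p ∪ orbitSet σ i ∪ orbitSet σ j ∪ orbitSet σ q := by
    rw [Set.union_right_comm (orbitSet σ p)]
  simp only [alignedSum, Set.mem_union, mem_orbitSet, hpi, hpj, hpq, hij, hji, hiq, hjq, or_self,
    if_false, hU] at h1 h2
  rw [aligned_comm j i] at h2
  linear_combination h1 - h2

/-- If no chain closes up, then the matching edges can be oriented consistently: the vertices are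
two-coloured, with different colours on matching edges, and the other edges have all equal, or
all different colours at their ends. -/
lemma exists_coloring [Finite V] [Nonempty V] {all : List V} (hall : ∀ v, v ∈ all)
    (hno : ¬ HasCandidate G σ all) : ∃ (κ : V → ZMod 2) (c : ZMod 2),
      (∀ v, κ (σ v) = κ v + 1) ∧ ∀ v w, ¬ σ.SameCycle v w → G.Adj v w → κ v + κ w = c := by
  classical
  have h2 : (2 : ZMod 2) = 0 := by decide
  obtain ⟨r⟩ := ‹Nonempty V›
  let t : V → V → ZMod 2 := fun v w => aligned G σ v w + aligned G σ r v + aligned G σ r w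
  have ht_comm : ∀ v w, t v w = t w v := by
    intro v w
    simp only [t, aligned_comm v w]
    ring
  have ht_right : ∀ a b b', ¬ σ.SameCycle r a → ¬ σ.SameCycle r b → ¬ σ.SameCycle r b' →
      ¬ σ.SameCycle a b → ¬ σ.SameCycle a b' → t a b = t a b' := by
    intro a b b' hra hrb hrb' hab hab'
    by_cases hbb' : σ.SameCycle b b'
    · rcases (sameCycle_iff_of_involutive hM.inv).mp hbb' with rfl | rfl
      · rfl
      · simp only [t, hM.aligned_apply_right hab, hM.aligned_apply_right hrb]
        linear_combination -h2
    · have := hM.aligned_balanced hall hno hab hab' (fun h => hra h.symm) hbb'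
        (fun h => hrb h.symm) (fun h => hrb' h.symm)
      rw [aligned_comm b' r, aligned_comm b r] at this
      simp only [t]
      linear_combination this + (aligned G σ r b - aligned G σ r b') * h2
  obtain ⟨τ, hτ⟩ : ∃ τ, ∀ v w, ¬ σ.SameCycle r v → ¬ σ.SameCycle r w → ¬ σ.SameCycle v w →
      t v w = τ := by
    by_cases h : ∃ v₀ w₀, ¬ σ.SameCycle r v₀ ∧ ¬ σ.SameCycle r w₀ ∧ ¬ σ.SameCycle v₀ w₀
    · obtain ⟨v₀, w₀, hv₀, hw₀, hvw₀⟩ := h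
      refine ⟨t v₀ w₀, fun v w hv hw hvw => ?_⟩
      have hwv : ¬ σ.SameCycle w v := fun h => hvw h.symm
      by_cases hw' : σ.SameCycle v₀ w
      · have hv' : ¬ σ.SameCycle v₀ v := fun h => hvw (h.symm.trans hw')
        rw [ht_right v w v₀ hv hw hv₀ hvw (fun h => hv' h.symm), ht_comm]
        exact ht_right v₀ v w₀ hv₀ hv hw₀ hv' hvw₀
      · rw [ht_comm v w, ht_right w v v₀ hw hv hv₀ hwv (fun h => hw' h.symm), ht_comm]
        exact ht_right v₀ w w₀ hv₀ hw hw₀ hw' hvw₀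
    · push Not at h
      exact ⟨0, fun v w hv hw hvw => absurd (h v w hv hw) hvw⟩
  have hr := (hM.adj r).ne
  have hs : ∀ {v}, σ.SameCycle r v ↔ v = r ∨ v = σ r := sameCycle_iff_of_involutive hM.inv
  refine ⟨fun v => if σ.SameCycle r v then isRep v (σ r) else aligned G σ r v + τ, 1 + τ,
    fun v => ?_, fun v w hvw hadj => ?_⟩
  · by_cases hv : σ.SameCycle r v
    · simp only [Equiv.Perm.sameCycle_apply_right, hv, if_true]
      refine hM.isRep_apply ?_
      rcases hs.mp hv with rfl | rfl
      · exact Or.inr (hM.inv v).symm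
      · exact Or.inl rfl
    · simp only [Equiv.Perm.sameCycle_apply_right, hv, if_false, hM.aligned_apply_right hv]
      ring
  · have key : ∀ v w, σ.SameCycle r v → ¬ σ.SameCycle r w → G.Adj v w →
        isRep v (σ r) + (aligned G σ r w + τ) = 1 + τ := by
      intro v w hv hw hadj
      have h1 := aligned_of_adj (σ := σ) hadj
      rcases hs.mp hv with rfl | rfl
      · simp [isRep, hr, h1]
      · rw [hM.aligned_apply_left hw] at h1
        simp only [isRep, if_true]
        linear_combination h1
    by_cases hv : σ.SameCycle r v <;> by_cases hw : σ.SameCycle r w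
    · exact absurd (hv.symm.trans hw) hvw
    · simpa only [hv, hw, if_true, if_false] using key v w hv hw hadj
    · have := key w v hw hv hadj.symm
      simp only [hv, hw, if_true, if_false]
      rw [add_comm]
      exact this
    · have h1 := hτ v w hv hw hvw
      simp only [t, aligned_of_adj (σ := σ) hadj] at h1
      simp only [hv, hw, if_false]
      linear_combination h1 + (τ - 1) * h2

/-- Along a chain of `m` new edges of a consistently coloured matching, the sum of the layer and the
colour of the entry vertex changes by a multiple of `m`. -/
lemma foldl_coloring [Finite V] {κ : V → ZMod 2} {c : ZMod 2} (hκ : ∀ v, κ (σ v) = κ v + 1)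
    (hc : ∀ v w, ¬ σ.SameCycle v w → G.Adj v w → κ v + κ w = c) (vs : List V) (C : Chain V)
    (heU : C.e ∈ C.U) (hU : ∀ v w, σ.SameCycle v w → v ∈ C.U → w ∈ C.U) {f : Chain V}
    (hf : f = vs.foldl (Chain.step G σ) C) : ∃ m : ℕ, f.U.ncard = C.U.ncard + 2 * m ∧
      f.lay + κ f.e = C.lay + κ C.e + (1 + c) * m := by
  have h2 : (2 : ZMod 2) = 0 := by decide
  induction vs generalizing C with
  | nil => exact ⟨0, by simp [hf], by simp [hf]⟩
  | cons v vs ih =>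
    by_cases hv : v ∈ C.U
    · refine ih C heU hU ?_
      rw [hf, List.foldl_cons, Chain.step, if_pos hv]
    · have hev : ¬ σ.SameCycle C.e v := fun h => hv (hU _ _ h heU)
      obtain ⟨m, h3, h4⟩ := ih (C.step G σ v)
        (by rw [Chain.step, if_neg hv]; exact Or.inr (sameCycle_entryVertex C.e v))
        (by
          rw [Chain.step, if_neg hv]
          simp only [Set.mem_union, mem_orbitSet]
          rintro u w huw (h | h)
          · exact Or.inl (hU _ _ huw h)
          · exact Or.inr (h.trans huw))
        (by rw [hf, List.foldl_cons])
      refine ⟨m + 1, ?_, ?_⟩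
      · rw [h3, Chain.step, if_neg hv]
        have hdisj : Disjoint C.U (orbitSet σ v) :=
          Set.disjoint_left.mpr fun w hw hw' => hv (hU _ _ (mem_orbitSet.mp hw').symm hw)
        have hcard : (orbitSet σ v).ncard = 2 := by
          have : orbitSet σ v = {v, σ v} := Set.ext fun w => by
            simp [mem_orbitSet, sameCycle_iff_of_involutive hM.inv]
          rw [this, Set.ncard_pair (hM.adj v).ne]
        rw [Set.ncard_union_eq hdisj, hcard]
        ring
      · rw [h4, Chain.step, if_neg hv]
        have hadj := adj_exit_entry hM.twoKTwoFree hM.adj hev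
        have hsame := sameCycle_entryVertex (G := G) (σ := σ) C.e v
        have h5 := hc _ _ (fun h => hev (by
          exact ((sameCycle_iterate σ C.e _).trans h).trans hsame.symm)) hadj
        have h6 : κ (σ^[exitDepth G σ C.e v] C.e) = κ C.e + exitDepth G σ C.e v := by
          have := exitDepth_le (G := G) (σ := σ) C.e v
          obtain h | h : exitDepth G σ C.e v = 0 ∨ exitDepth G σ C.e v = 1 := by omega
          · simp [h]
          · simp [h, hκ]
        rw [h6] at h5
        push_cast
        linear_combination h5 - (κ C.e) * h2

/-- If no chain closes up, then all edges except for those of the matching have equal colours at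
their ends, and the number of matching edges is odd and at least three. -/
lemma exists_coloring_mono [Fintype V] [Nonempty V] {all : List V} (hall : ∀ v, v ∈ all)
    (hno : ¬ HasCandidate G σ all) : ∃ κ : V → ZMod 2,
      (∀ v, κ (σ v) = κ v + 1) ∧ (∀ v w, ¬ σ.SameCycle v w → G.Adj v w → κ v = κ w) ∧
      ∃ m, Odd m ∧ Fintype.card V = 4 + 2 * m := by
  have h2 : (2 : ZMod 2) = 0 := by decide
  have h11 : ∀ z : ZMod 2, z + z = 0 := by decide
  obtain ⟨κ, c, hκ, hc⟩ := hM.exists_coloring hall hno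
  have hs : ∀ {v w}, σ.SameCycle v w ↔ w = v ∨ w = σ v := sameCycle_iff_of_involutive hM.inv
  have hper := two_le_minimalPeriod hM.adj
  have hκd : ∀ v d, d < 2 → κ (σ^[d] v) = κ v + d := by
    intro v d hd
    obtain rfl | rfl : d = 0 ∨ d = 1 := by omega
    · simp
    · simp [hκ]
  obtain ⟨p⟩ := ‹Nonempty V›
  obtain ⟨i, hpi⟩ : ∃ i, ¬ σ.SameCycle p i := by
    by_contra! h
    exact hno (hasCandidate_of_single hM.adj p h all)
  set vs := p :: p :: all with hvs
  have hvs' : ∀ v, v ∈ vs := fun v => by simp [hvs, hall v]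
  have hyx := adj_exit_entry hM.twoKTwoFree hM.adj hpi
  set y := σ^[exitDepth G σ p i] p
  set x := entryVertex G σ p i
  have hpy : σ.SameCycle p y := sameCycle_iterate σ p _
  have hix : σ.SameCycle i x := sameCycle_entryVertex p i
  have hpx : ¬ σ.SameCycle p x := fun h => hpi (h.trans hix.symm)
  have hyx' : ¬ σ.SameCycle y x := fun h => hpx (hpy.trans h)
  have hUp : ∀ s, σ.SameCycle p s → orbitSet σ s = orbitSet σ p := fun s hps =>
    Set.ext fun w => ⟨fun hw => hps.trans hw, fun hw => hps.symm.trans hw⟩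
  set c₀ : Chain V := ⟨[], 0, x, orbitSet σ p ∪ orbitSet σ x⟩ with hc₀
  set f := vs.foldl (Chain.step G σ) c₀ with hf
  have hclosed : ∀ v w, σ.SameCycle v w → v ∈ c₀.U → w ∈ c₀.U := by
    rintro v w hvw (h | h)
    · exact Or.inl (h.trans hvw)
    · exact Or.inr (h.trans hvw)
  obtain ⟨m, hm, hpar⟩ := hM.foldl_coloring hκ hc vs c₀ (Or.inr (mem_orbitSet_self x)) hclosed hf
  have hcongr : ∀ s d, σ.SameCycle p s →
      let c : Chain V := ⟨traversal σ (minimalPeriod σ s - d) d s 0, d + 1, x,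
        orbitSet σ s ∪ orbitSet σ x⟩
      (vs.foldl (Chain.step G σ) c).e = f.e ∧
        (vs.foldl (Chain.step G σ) c).lay - (d + 1) = f.lay := by
    intro s d hps c
    obtain ⟨h3, h4⟩ := Chain.foldl_congr (G := G) (σ := σ) vs c₀ c rfl
      (by simp [c, hc₀, hUp s hps])
    exact ⟨h3, by simpa [hc₀, c] using h4⟩
  have hfp : ¬ σ.SameCycle p f.e := by
    intro hpf
    have hd : 0 < minimalPeriod σ y := by have := hper y; omega
    have hgood := (Chain.Good.init hM.adj (Or.inl rfl) hd hyx' hyx).foldl hM.twoKTwoFree hM.adj vs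
    have hmem : (y, (0 : ZMod 2)) ∈ traversal σ (minimalPeriod σ y - 0) 0 y 0 :=
      (mem_traversal_orbit (Or.inl rfl) hd).mpr (Equiv.Perm.SameCycle.refl _ _)
    have := ((hgood.mem_iff _).mp (Chain.W_subset_foldl vs _ hmem)).2
    rw [(hcongr y 0 hpy).1] at this
    exact this (hpf.symm.trans hpy)
  have hadj := adj_exit_entry hM.twoKTwoFree hM.adj (e := f.e) (v := p) (fun h => hfp h.symm)
  have hdl : exitDepth G σ f.e p < 2 := Nat.lt_succ_of_le (exitDepth_le f.e p)
  have hps : σ.SameCycle p (entryVertex G σ f.e p) := sameCycle_entryVertex f.e p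
  set dl := exitDepth G σ f.e p
  set s := entryVertex G σ f.e p
  obtain ⟨d, hd, hdy⟩ : ∃ d < 2, σ^[d] s = y := by
    rcases hs.mp (hps.symm.trans hpy) with h' | h' <;> rw [h']
    · exact ⟨0, by omega, rfl⟩
    · exact ⟨1, by omega, rfl⟩
  obtain ⟨h9, h10⟩ := hcongr s d hps
  have hne : f.lay + d + dl ≠ 0 := by
    intro h0
    refine hno ⟨s, d, hd.trans_le (hper s), σ, Or.inl rfl, x, p, p, dl, hdl,
      isPrismCycle_candidate hM.twoKTwoFree hM.adj (Or.inl rfl) (hd.trans_le (hper s))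
        (fun h => hpx (hps.trans h)) (by rwa [hdy]) hvs' hdl rfl ?_ ?_⟩
    · rw [h9]
      exact hadj
    · linear_combination h10 + h0 + h2
  have hne' : f.lay + d + dl = 1 := by
    have : ∀ z : ZMod 2, z ≠ 0 → z = 1 := by decide
    exact this _ hne
  -- both connections of the first matching edge, in terms of the colouring
  have e1 := hc _ _ hyx' hyx
  have e2 := hc _ _ (fun h => hfp (hps.trans (((sameCycle_iterate σ f.e dl).trans h).symm))) hadj
  rw [hκd _ _ hdl] at e2
  rw [← hdy, hκd _ _ hd] at e1
  simp only [hc₀] at hpar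
  have hprod : (1 + c) * m = 1 := by
    linear_combination hne' - hpar + e1 + e2 + (c - κ s - d - dl - κ x) * h2
  have hcm : c = 0 ∧ (m : ZMod 2) = 1 := by
    have : ∀ a b : ZMod 2, (1 + a) * b = 1 → a = 0 ∧ b = 1 := by decide
    exact this _ _ hprod
  refine ⟨κ, hκ, fun v w hvw hadj => ?_, m, ?_, ?_⟩
  · have := hc v w hvw hadj
    rw [hcm.1] at this
    linear_combination this - (κ w) * h2
  · exact ZMod.natCast_eq_one_iff_odd.mp hcm.2
  · have hfU : f.U = Set.univ := Set.eq_univ_of_forall fun v => Chain.mem_foldl (hvs' v) _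
    rw [hfU, Set.ncard_univ, Nat.card_eq_fintype_card] at hm
    rw [hm, hc₀]
    have hdisj : Disjoint (orbitSet σ p) (orbitSet σ x) :=
      Set.disjoint_left.mpr fun w hw hw' => hpx (hw.trans (mem_orbitSet.mp hw').symm)
    have hcard : ∀ v, (orbitSet σ v).ncard = 2 := by
      intro v
      have : orbitSet σ v = {v, σ v} := Set.ext fun w => by
        simp [mem_orbitSet, hs]
      rw [this, Set.ncard_pair (hM.adj v).ne]
    simp only
    rw [Set.ncard_union_eq hdisj, hcard, hcard]

end TriangleFreeMatching

end Matching

/-! ### The exceptional graph on six vertices -/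

section Rematch

open Function

variable {V : Type*} {G : SimpleGraph V} {σ : Equiv.Perm V}

/-- Replace the edges `{g, σ g}` and `{h, σ h}` of a perfect matching by `{g, h}` and
`{σ g, σ h}`. -/
def rematch [DecidableEq V] (σ : Equiv.Perm V) (g h : V) : Equiv.Perm V :=
  Equiv.swap (σ g) h * Equiv.swap (σ h) g * σ

section

variable [DecidableEq V] (hσ : ∀ v, σ v ≠ v) (hinv : ∀ v, σ (σ v) = v) {g h : V} (hgh : g ≠ h)
  (hgh' : h ≠ σ g)

include hσ hinv hgh hgh'

lemma rematch_apply (v : V) : rematch σ g h v =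
    if v = g then h else if v = h then g else if v = σ g then σ h else if v = σ h then σ g
      else σ v := by
  have h1 : σ g ≠ σ h := fun h' => hgh (σ.injective h')
  have h2 : g ≠ σ h := fun h' => hgh' (by rw [h', hinv])
  have h3 := hσ g
  have h4 := hσ h
  simp only [rematch, Equiv.Perm.mul_apply]
  split_ifs with e1 e2 e3 e4
  · subst e1
    rw [Equiv.swap_apply_of_ne_of_ne h1 h3, Equiv.swap_apply_left]
  · subst e2
    rw [Equiv.swap_apply_left, Equiv.swap_apply_of_ne_of_ne h3.symm hgh]
  · subst e3
    rw [hinv, Equiv.swap_apply_right, Equiv.swap_apply_of_ne_of_ne h1.symm h4]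
  · subst e4
    rw [hinv, Equiv.swap_apply_of_ne_of_ne h4.symm hgh.symm, Equiv.swap_apply_right]
  · have e5 : σ v ≠ σ g := fun h' => e1 (σ.injective h')
    have e6 : σ v ≠ σ h := fun h' => e2 (σ.injective h')
    have e7 : σ v ≠ g := fun h' => e3 (by rw [← h', hinv])
    have e8 : σ v ≠ h := fun h' => e4 (by rw [← h', hinv])
    rw [Equiv.swap_apply_of_ne_of_ne e6 e7, Equiv.swap_apply_of_ne_of_ne e5 e8]

lemma rematch_involutive (v : V) : rematch σ g h (rematch σ g h v) = v := by
  have h1 : σ g ≠ σ h := fun h' => hgh (σ.injective h')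
  have h2 : g ≠ σ h := fun h' => hgh' (by rw [h', hinv])
  have h3 := hσ g
  have h4 := hσ h
  have key := rematch_apply hσ hinv hgh hgh'
  rw [key v]
  split_ifs with e1 e2 e3 e4
  · rw [key, if_neg hgh.symm, if_pos rfl, e1]
  · rw [key, if_pos rfl, e2]
  · rw [key, if_neg h2.symm, if_neg h4, if_neg h1.symm, if_pos rfl, e3]
  · rw [key, if_neg h3, if_neg hgh'.symm, if_pos rfl, e4]
  · have e5 : σ v ≠ σ g := fun h' => e1 (σ.injective h')
    have e6 : σ v ≠ σ h := fun h' => e2 (σ.injective h')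
    have e7 : σ v ≠ g := fun h' => e3 (by rw [← h', hinv])
    have e8 : σ v ≠ h := fun h' => e4 (by rw [← h', hinv])
    rw [key, if_neg e7, if_neg e8, if_neg e5, if_neg e6, hinv]

lemma adj_rematch (hadj : ∀ v, G.Adj v (σ v)) (h1 : G.Adj g h) (h2 : G.Adj (σ g) (σ h)) (v : V) :
    G.Adj v (rematch σ g h v) := by
  rw [rematch_apply hσ hinv hgh hgh']
  split_ifs with e1 e2 e3 e4
  · rwa [e1]
  · rw [e2]
    exact h1.symm
  · rwa [e3]
  · rw [e4]
    exact h2.symm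
  · exact hadj v

end

namespace TriangleFreeMatching

variable (hM : TriangleFreeMatching G σ)

include hM

/-- If a tough `2K₂`-free graph has a perfect matching for which no chain closes up, then it has
six vertices. Otherwise there would be five matching edges, hence edges inside of both colour
classes, because a colour class without edges violates the toughness. Then two of the matching
edges can be chosen that avoid the ends of these two edges and are joined by a third edge; this
forms a `2K₂` with one of the former. -/
lemma card_eq_six [Fintype V] {ε : ℝ} (hε : 0 < ε) (hG : IsTough G (1 + ε)) {κ : V → ZMod 2}
    (hκ : ∀ v, κ (σ v) = κ v + 1) (hmono : ∀ v w, ¬ σ.SameCycle v w → G.Adj v w → κ v = κ w)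
    {m : ℕ} (hm : Odd m) (hcard : Fintype.card V = 4 + 2 * m) : Fintype.card V = 6 := by
  classical
  have h2 : (2 : ZMod 2) = 0 := by decide
  have hs : ∀ {v w}, σ.SameCycle v w ↔ w = v ∨ w = σ v := sameCycle_iff_of_involutive hM.inv
  have hadj : ∀ {v w}, G.Adj v w → κ v ≠ κ w → w = σ v := by
    intro v w h h'
    by_contra hw
    exact h' (hmono v w (by rw [hs, not_or]; exact ⟨h.ne', hw⟩) h)
  have hz : ∀ a b c : ZMod 2, a ≠ b → a ≠ c → b = c := by decide
  have hz1 : ∀ a : ZMod 2, a + 1 ≠ a := by decide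
  -- edges in different colour classes have ends in a common matching edge
  have hcross : ∀ {u v w x}, G.Adj u v → G.Adj w x → κ u = κ v → κ w = κ x → κ u ≠ κ w →
      σ w = u ∨ σ w = v ∨ σ x = u ∨ σ x = v := by
    intro u v w x huv hwx h1 h2 h3
    rcases hM.twoKTwoFree.exists_adj huv hwx (fun h => h3 (h ▸ rfl))
      (fun h => h3 (by rw [h2, ← h])) (fun h => h3 (by rw [h1, h]))
      (fun h => h3 (by rw [h1, h2, h])) with h | h | h | h
    · have := hadj h h3
      rw [this, hM.inv]
      simp
    · have := hadj h (by rwa [← h2])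
      rw [this, hM.inv]
      simp
    · have := hadj h (by rwa [← h1])
      rw [this, hM.inv]
      simp
    · have := hadj h (by rwa [← h1, ← h2])
      rw [this, hM.inv]
      simp
  set A : ZMod 2 → Finset V := fun a => Finset.univ.filter fun v => κ v = a with hA
  have hAσ : ∀ a, (A (a + 1)).card = (A a).card := by
    intro a
    refine (Finset.card_bij (fun v _ => σ v) ?_ (fun _ _ _ _ h => σ.injective h) ?_).symm
    · intro v hv
      simp only [hA, Finset.mem_filter, Finset.mem_univ, true_and] at hv ⊢
      rw [hκ, hv]
    · intro v hv
      simp only [hA, Finset.mem_filter, Finset.mem_univ, true_and] at hv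
      refine ⟨σ v, ?_, hM.inv v⟩
      simp only [hA, Finset.mem_filter, Finset.mem_univ, true_and]
      rw [hκ, hv]
      linear_combination h2
  have hAcard : ∀ a, (A a).card = m + 2 := by
    intro a
    have hsum : (A a).card + (A (a + 1)).card = Fintype.card V := by
      rw [← Finset.card_union_of_disjoint, ← Finset.card_univ]
      · congr 1
        ext v
        simp only [hA, Finset.mem_union, Finset.mem_filter, Finset.mem_univ, true_and, iff_true]
        by_cases h : κ v = a
        · exact Or.inl h
        · exact Or.inr (hz a _ _ (Ne.symm h) (hz1 a).symm)
      · rw [Finset.disjoint_left]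
        intro v hv hv'
        simp only [hA, Finset.mem_filter, Finset.mem_univ, true_and] at hv hv'
        exact hz1 a (hv'.symm.trans hv)
    rw [hAσ] at hsum
    omega
  have hedge : ∀ a, ∃ u v, G.Adj u v ∧ κ u = a ∧ κ v = a := by
    intro a
    by_contra! hno
    obtain ⟨v, hv, w, hw, hvw⟩ := Finset.one_lt_card.mp (by rw [hAcard]; omega : 1 < (A a).card)
    have hAiff : ∀ {v b}, v ∈ A b ↔ κ v = b := by simp [hA]
    have := (hG.card_lt hε (A (a + 1)) (A a)
      (fun v hv hv' => hz1 a ((hAiff.mp hv').symm.trans (hAiff.mp hv)))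
      (fun v hv w hvw => ?_) hv
      (fun hw' => hz1 a ((hAiff.mp hw').symm.trans (hAiff.mp hw))) hvw).1
    · rw [hAcard, hAcard] at this
      exact lt_irrefl _ this
    · rw [hAiff]
      exact hz a _ _ (Ne.symm (hno v w hvw (hAiff.mp hv))) (hz1 a).symm
  by_contra hne
  have hm3 : 3 ≤ m := by
    obtain ⟨k, hk⟩ := hm
    omega
  obtain ⟨a₁, a₂, ha, ha₁, ha₂⟩ := hedge 0
  obtain ⟨b₁, b₂, hb, hb₁, hb₂⟩ := hedge 1
  have h01 : (0 : ZMod 2) ≠ 1 := by decide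
  set T : Finset V := {a₁, a₂, σ b₁, σ b₂} with hT
  have hTcard : T.card ≤ 3 := by
    have hdup : T = {a₁, a₂, σ b₁} ∨ T = {a₁, a₂, σ b₂} := by
      rcases hcross ha hb (ha₁.trans ha₂.symm) (hb₁.trans hb₂.symm) (by rw [ha₁, hb₁]; exact h01)
        with h | h | h | h
      · right; ext v; simp [hT, h]; tauto
      · right; ext v; simp [hT, h]
      · left; ext v; simp [hT, h]; tauto
      · left; ext v; simp [hT, h]; tauto
    rcases hdup with h | h <;> rw [h] <;> exact Finset.card_le_three
  have hF : 1 < (A 0 \ T).card := by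
    have := Finset.le_card_sdiff T (A 0)
    rw [hAcard] at this
    omega
  obtain ⟨c₁, hc₁, c₂, hc₂, hc⟩ := Finset.one_lt_card.mp hF
  simp only [hA, hT, Finset.mem_sdiff, Finset.mem_filter, Finset.mem_univ, true_and,
    Finset.mem_insert, Finset.mem_singleton, not_or] at hc₁ hc₂
  have hcc : ¬ c₂ = σ c₁ := fun h => by
    have := hκ c₁
    rw [← h, hc₂.1, hc₁.1] at this
    simp at this
  have hcc' : ¬ c₁ = σ c₂ := fun h => hcc (by rw [h, hM.inv])
  rcases hM.twoKTwoFree.exists_adj (hM.adj c₁) (hM.adj c₂) hc hcc' (fun h => hcc h.symm)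
    (fun h => hc (σ.injective h)) with h | h | h | h
  · rcases hcross h hb (hc₁.1.trans hc₂.1.symm) (hb₁.trans hb₂.symm)
      (by rw [hc₁.1, hb₁]; exact h01) with h' | h' | h' | h'
    · exact hc₁.2.2.2.1 h'.symm
    · exact hc₂.2.2.2.1 h'.symm
    · exact hc₁.2.2.2.2 h'.symm
    · exact hc₂.2.2.2.2 h'.symm
  · exact hc (σ.injective (hadj h (by rw [hκ, hc₁.1, hc₂.1]; decide))).symm
  · have := hadj h.symm (by rw [hκ, hc₁.1, hc₂.1]; decide)
    exact hc (σ.injective this)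
  · rcases hcross ha h (ha₁.trans ha₂.symm) (by rw [hκ, hκ, hc₁.1, hc₂.1])
      (by rw [ha₁, hκ, hc₁.1]; decide) with h' | h' | h' | h' <;> rw [hM.inv] at h'
    · exact hc₁.2.1 h'
    · exact hc₁.2.2.1 h'
    · exact hc₂.2.1 h'
    · exact hc₂.2.2.1 h'

/-- If a tough `2K₂`-free graph has a perfect matching for which no chain closes up, then it is
the prism over a triangle, and rematching any two of the matching edges helps. -/
lemma hasCandidate_rematch [Fintype V] [DecidableEq V] [Nonempty V] {ε : ℝ} (hε : 0 < ε)
    (hG : IsTough G (1 + ε)) {all : List V} (hall : ∀ v, v ∈ all)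
    (hno : ¬ HasCandidate G σ all) :
    (∃ g h, G.Adj g h ∧ h ≠ σ g ∧ G.Adj (σ g) (σ h)) ∧
      ∀ g h, G.Adj g h → h ≠ σ g → G.Adj (σ g) (σ h) → HasCandidate G (rematch σ g h) all := by
  classical
  obtain ⟨κ, hκ, hmono, m, hm, hcard⟩ := hM.exists_coloring_mono hall hno
  have h6 := hM.card_eq_six hε hG hκ hmono hm hcard
  have hs : ∀ {v w}, σ.SameCycle v w ↔ w = v ∨ w = σ v := sameCycle_iff_of_involutive hM.inv
  have hz1 : ∀ a : ZMod 2, a + 1 ≠ a := by decide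
  set C : V → Finset V := fun v => Finset.univ.filter fun w => κ w = κ v with hC
  have hCcard : ∀ v, (C v).card = 3 := by
    intro v
    have hz : ∀ a b : ZMod 2, ¬ a = b ↔ a = b + 1 := by decide
    have h1 : (C v).card + ((Finset.univ.filter fun w => ¬ κ w = κ v)).card = 6 := by
      rw [hC, Finset.card_filter_add_card_filter_not, Finset.card_univ, h6]
    have h3 : (C v).card = (Finset.univ.filter fun w => ¬ κ w = κ v).card := by
      refine Finset.card_bij (fun w _ => σ w) ?_ (fun _ _ _ _ h => σ.injective h) ?_
      · intro w hw
        simp only [hC, Finset.mem_filter, Finset.mem_univ, true_and] at hw ⊢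
        rw [hκ, hw]
        exact hz1 _
      · intro w hw
        simp only [Finset.mem_filter, Finset.mem_univ, true_and] at hw
        refine ⟨σ w, ?_, hM.inv w⟩
        simp only [hC, Finset.mem_filter, Finset.mem_univ, true_and]
        rw [hκ, (hz _ _).mp hw]
        have : ∀ a : ZMod 2, a + 1 + 1 = a := by decide
        exact this _
    omega
  -- all vertices of equal colour are adjacent
  have hclass : ∀ v w, v ≠ w → κ v = κ w → G.Adj v w := by
    intro v
    have hsub : G.neighborFinset v ⊆ insert (σ v) ((C v).erase v) := by
      intro w hw
      rw [mem_neighborFinset] at hw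
      simp only [Finset.mem_insert, Finset.mem_erase, hC, Finset.mem_filter, Finset.mem_univ,
        true_and]
      by_cases h : w = σ v
      · exact Or.inl h
      · exact Or.inr ⟨hw.ne', (hmono v w (by rw [hs, not_or]; exact ⟨hw.ne', h⟩) hw).symm⟩
    have hle : (insert (σ v) ((C v).erase v)).card ≤ 3 := by
      refine (Finset.card_insert_le _ _).trans ?_
      rw [Finset.card_erase_of_mem (by simp [hC]), hCcard]
    have hdeg : 3 ≤ G.degree v := by
      refine hG.three_le_degree hε v ?_
      have := (Finset.card_le_card hsub).trans hle
      rw [card_neighborFinset_eq_degree] at this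
      omega
    have heq := Finset.eq_of_subset_of_card_le hsub (by
      rw [card_neighborFinset_eq_degree]
      omega)
    intro w hvw hκw
    rw [← mem_neighborFinset, heq]
    simp only [Finset.mem_insert, Finset.mem_erase, hC, Finset.mem_filter, Finset.mem_univ,
      true_and]
    exact Or.inr ⟨hvw.symm, hκw.symm⟩
  have hκσ : ∀ g h, h ≠ σ g → G.Adj g h → κ g = κ h := fun g h h1 h2 =>
    hmono g h (by rw [hs, not_or]; exact ⟨h2.ne', h1⟩) h2
  constructor
  · obtain ⟨g⟩ := ‹Nonempty V›
    obtain ⟨h, hh, hne⟩ := Finset.exists_mem_ne (by rw [hCcard]; omega : 1 < (C g).card) g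
    simp only [hC, Finset.mem_filter, Finset.mem_univ, true_and] at hh
    refine ⟨g, h, hclass g h hne.symm hh.symm, ?_, hclass _ _ (fun h' => hne (σ.injective h').symm)
      (by rw [hκ, hκ, hh])⟩
    rintro rfl
    exact hz1 _ ((hκ g).symm.trans hh)
  · intro g h h1 h2 h3
    have hgh := hκσ g h h2 h1
    have hσ : ∀ v, σ v ≠ v := fun v => (hM.adj v).ne'
    obtain ⟨x, hx⟩ : ((C g).erase g |>.erase h).Nonempty := by
      rw [← Finset.card_pos, Finset.card_erase_of_mem, Finset.card_erase_of_mem, hCcard]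
      · omega
      · simp [hC]
      · simp [hC, h1.ne', hgh]
    simp only [Finset.mem_erase, hC, Finset.mem_filter, Finset.mem_univ, true_and] at hx
    refine hasCandidate_of_triangle hM.twoKTwoFree
      (adj_rematch hσ hM.inv h1.ne h2 hM.adj h1 h3)
      (rematch_involutive hσ hM.inv h1.ne h2) hall (hclass g x (Ne.symm hx.2.1) hx.2.2.symm) ?_
    rw [rematch_apply hσ hM.inv h1.ne h2, if_pos rfl]
    exact hclass h x (Ne.symm hx.1) (hgh.symm.trans hx.2.2.symm)

end TriangleFreeMatching

/-! ### Splitting cycles of even length -/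

/-- If all cycles of `σ` have even length, then the vertices can be coloured with two colours that
alternate along the cycles. -/
lemma exists_alternating_coloring [Finite V] (h : ∀ v, ¬ Odd (minimalPeriod σ v)) :
    ∃ χ : V → ZMod 2, ∀ v, χ (σ v) = χ v + 1 := by
  classical
  let rep : V → V := fun v => Quotient.out (Quotient.mk (Equiv.Perm.SameCycle.setoid σ) v)
  have hrep : ∀ v, σ.SameCycle (rep v) v := fun v =>
    Quotient.mk_out (s := Equiv.Perm.SameCycle.setoid σ) v
  have hrepσ : ∀ v, rep (σ v) = rep v := fun v => by
    refine congrArg Quotient.out (Quotient.sound ?_)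
    exact Equiv.Perm.sameCycle_apply_left.mpr (Equiv.Perm.SameCycle.refl σ v)
  choose i hi hiv using fun v => (sameCycle_iff_exists_iterate σ).mp (hrep v)
  refine ⟨fun v => i v, fun v => ?_⟩
  have h1 := hiv (σ v)
  rw [hrepσ] at h1
  have h2 : σ^[i v + 1] (rep v) = σ v := by rw [iterate_succ_apply', hiv]
  have hk := h (rep v)
  rw [Nat.not_odd_iff_even] at hk
  have hmod : i (σ v) = (i v + 1) % minimalPeriod σ (rep v) := by
    refine iterate_injective_of_lt σ (e := rep v) ?_
      (Nat.mod_lt _ (minimalPeriod_perm_pos σ _)) ?_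
    · have := hi (σ v)
      rwa [hrepσ] at this
    · rw [h1, iterate_mod_minimalPeriod_eq, h2]
  rw [← Nat.cast_one, ← Nat.cast_add, ZMod.natCast_eq_natCast_iff, hmod]
  exact (Nat.mod_modEq _ _).of_dvd hk.two_dvd

end Rematch

/-! ### Hamiltonian cycles from sequences of vertices -/

section Walks

lemma exists_walk_of_forall_adj {W : Type*} {H : SimpleGraph W} (m : ℕ) (f : ℕ → W)
    (hadj : ∀ i < m, H.Adj (f i) (f (i + 1))) :
    ∃ p : H.Walk (f 0) (f m), p.length = m ∧ ∀ i ≤ m, p.getVert i = f i := by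
  induction m generalizing f with
  | zero => exact ⟨.nil, rfl, fun i hi => by simp [Nat.le_zero.mp hi]⟩
  | succ m ih =>
    obtain ⟨p, hp, hp'⟩ := ih (fun i => f (i + 1)) fun i hi => hadj (i + 1) (by omega)
    refine ⟨.cons (hadj 0 (by omega)) p, by simp [hp], fun i hi => ?_⟩
    cases i with
    | zero => rfl
    | succ i =>
      rw [Walk.getVert_cons_succ]
      exact hp' i (by omega)

/-- A closed sequence of adjacent vertices that contains every vertex once is a Hamiltonian
cycle. -/
lemma exists_isHamiltonianCycle_of_forall_adj {W : Type*} [Fintype W] [DecidableEq W]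
    {H : SimpleGraph W} (m : ℕ) (hm : 3 ≤ m) (hcard : Fintype.card W = m) (f : ℕ → W)
    (hadj : ∀ i < m, H.Adj (f i) (f (i + 1))) (hinj : ∀ j < m, ∀ i < j, f i ≠ f j)
    (hclose : f m = f 0) :
    ∃ p : H.Walk (f 0) (f 0), p.IsHamiltonianCycle ∧ ∀ i ≤ p.length, p.getVert i = f i := by
  obtain ⟨m, rfl⟩ : ∃ k, m = k + 1 := ⟨m - 1, by omega⟩
  obtain ⟨q, hq, hq'⟩ := exists_walk_of_forall_adj m (fun i => f (i + 1))
    fun i hi => hadj (i + 1) (by omega)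
  have hinj' : ∀ i j, i < m + 1 → j < m + 1 → f i = f j → i = j := by
    intro i j hi hj h
    rcases lt_trichotomy i j with h' | h' | h'
    · exact absurd h (hinj j hj i h')
    · exact h'
    · exact absurd h.symm (hinj i hi j h')
  have hpath : q.IsPath := by
    rw [← Walk.IsPath.getVert_injOn_iff]
    intro i hi j hj hij
    simp only [Set.mem_ofPred_eq, hq] at hi hj
    rw [hq' i hi, hq' j hj] at hij
    rcases Nat.lt_or_ge i m with h1 | h1 <;> rcases Nat.lt_or_ge j m with h2 | h2
    · have := hinj' _ _ (by omega) (by omega) hij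
      omega
    · obtain rfl : j = m := by omega
      rw [hclose] at hij
      have := hinj' _ _ (by omega) (by omega) hij
      omega
    · obtain rfl : i = m := by omega
      rw [hclose] at hij
      have := hinj' _ _ (by omega) (by omega) hij
      omega
    · omega
  have hlen : (Walk.cons (hadj 0 (by omega)) q).length = m + 1 := by simp [hq]
  have hvert : ∀ i ≤ m + 1, (Walk.cons (hadj 0 (by omega)) q).getVert i = f i := by
    intro i hi
    cases i with
    | zero => rfl
    | succ i =>
      rw [Walk.getVert_cons_succ]
      exact hq' i (by omega)
  refine ⟨(Walk.cons (hadj 0 (by omega)) q).copy rfl hclose, ?_, ?_⟩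
  · rw [Walk.isHamiltonianCycle_iff_isCycle_and_length_eq]
    refine ⟨?_, by simp [hq, hcard]⟩
    have : (Walk.cons (hadj 0 (by omega)) q).copy rfl hclose =
        Walk.cons (hadj 0 (by omega)) (q.copy rfl hclose) := by
      rw [Walk.copy_cons]
    rw [this, Walk.cons_isCycle_iff]
    refine ⟨by simpa using hpath, ?_⟩
    rw [Walk.edges_copy, Walk.mk_mem_edges_iff_exists]
    rintro ⟨i, hi, h⟩
    rw [hq] at hi
    rw [hq' i hi.le, hq' (i + 1) hi, Sym2.eq_iff] at h
    rcases h with ⟨h, -⟩ | ⟨h, h'⟩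
    · have := hinj' _ _ (by omega) (by omega) h
      omega
    · have h1 := hinj' _ _ (by omega) (by omega) h
      obtain rfl : i = 0 := by omega
      have := hinj' _ _ (by omega) (by omega) h'
      omega
  · intro i hi
    rw [Walk.getVert_copy]
    refine hvert i ?_
    simpa [hq] using hi

end Walks

/-! ### Invariance under isomorphisms -/

section Transport

variable {V W : Type*} {G : SimpleGraph V} {H : SimpleGraph W}

lemma IsTwoKTwoFree.of_iso (e : G ≃g H) (h : IsTwoKTwoFree G) : IsTwoKTwoFree H :=
  fun ⟨f⟩ => h ⟨f.trans e.symm.toEmbedding⟩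

lemma IsTough.of_iso [Fintype V] [Fintype W] (e : G ≃g H) {β : ℝ} (h : IsTough G β) :
    IsTough H β := by
  classical
  intro p hp S hS
  have hbij : Set.BijOn e ((S.map e.symm.toEquiv.toEmbedding : Finset V) : Set V)ᶜ
      (S : Set W)ᶜ := by
    refine ⟨?_, e.injective.injOn, ?_⟩
    · intro v hv hv'
      refine hv ?_
      simp only [Finset.coe_map, Set.mem_image]
      exact ⟨e v, hv', e.symm_apply_apply v⟩
    · intro w hw
      refine ⟨e.symm w, ?_, e.apply_symm_apply w⟩
      simp only [Finset.coe_map, Set.mem_compl_iff, Set.mem_image, not_exists, not_and]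
      intro u hu hu'
      exact hw (e.symm.injective hu' ▸ hu)
  rw [← Nat.card_congr (e.induce hbij).connectedComponentEquiv]
  exact h p hp _ (by simpa using hS)

lemma isHamiltonian_prism_of_iso [Fintype V] [Fintype W] [DecidableEq V] [DecidableEq W]
    (e : G ≃g H) (h : (prism G).IsHamiltonian) : (prism H).IsHamiltonian := by
  let E : prism G ≃g prism H :=
    { toEquiv := e.toEquiv.prodCongr (Equiv.refl (Fin 2))
      map_rel_iff' := by
        have := fun a b => e.map_rel_iff' (a := a) (b := b)
        simp_all [boxProd_adj] }
  intro hcard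
  rw [← Fintype.card_congr E.toEquiv] at hcard
  obtain ⟨a, p, hp⟩ := h hcard
  exact ⟨E a, p.map E.toHom, hp.map E.bijective⟩

end Transport

/-! ### Traversing a cycle on the machine -/

namespace RAM

open Function

/-- `a ≠ b` as an expression. -/
def Expr.ne (a b : Expr) : Expr := .add (.sub a b) (.sub b a)

@[simp] lemma Expr.eval_ne (a b : Expr) (s : State) :
    (Expr.ne a b).eval s = 0 ↔ a.eval s = b.eval s := by
  simp only [Expr.ne, Expr.eval]
  omega

/-- `1 - a`, the other layer. -/
def Expr.flip (a : Expr) : Expr := .sub (.const 1) a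

/-- The entry of the adjacency matrix; array `6` contains the offsets of its rows. -/
def Expr.adj (a b : Expr) : Expr := .cell 0 (.add (.cell 6 a) b)

/-- The memory contains the graph `G` in arrays `0` and `6`. -/
structure HasGraph {n : ℕ} (G : SimpleGraph (Fin n)) (s : State) : Prop where
  size : s.var 0 = n
  adj : ∀ u v : Fin n, s.arr 0 (n * u + v) ≠ 0 ↔ G.Adj u v
  row : ∀ u : Fin n, s.arr 6 u = n * u

/-- The memory contains the permutation `σ` in the first half of array `7` and its inverse in the
second half. -/
def HasPerm {n : ℕ} (σ : Equiv.Perm (Fin n)) (s : State) : Prop :=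
  ∀ u : Fin n, s.arr 7 u = σ u ∧ s.arr 7 (n + u) = (σ⁻¹ u : Fin n)

variable {n : ℕ} {G : SimpleGraph (Fin n)} {σ : Equiv.Perm (Fin n)} {s s' : State} {N : ℕ}

lemma HasGraph.congr (h : HasGraph G s) (h0 : s'.var 0 = s.var 0) (h1 : s'.arr 0 = s.arr 0)
    (h2 : s'.arr 6 = s.arr 6) : HasGraph G s' :=
  ⟨h0.trans h.size, by rw [h1]; exact h.adj, by rw [h2]; exact h.row⟩

lemma HasPerm.congr (h : HasPerm σ s) (h1 : s'.arr 7 = s.arr 7) : HasPerm σ s' := by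
  unfold HasPerm
  rw [h1]
  exact h

lemma HasGraph.eval_adj (h : HasGraph G s) {a b : Expr} {u v : Fin n} (ha : a.eval s = u)
    (hb : b.eval s = v) : (Expr.adj a b).eval s ≠ 0 ↔ G.Adj u v := by
  simp only [Expr.adj, Expr.eval, ha, hb, h.row]
  exact h.adj u v

lemma HasGraph.eval_adj_eq_zero (h : HasGraph G s) {a b : Expr} {u v : Fin n} (ha : a.eval s = u)
    (hb : b.eval s = v) : (Expr.adj a b).eval s = 0 ↔ ¬ G.Adj u v := by
  rw [← h.eval_adj ha hb, not_not]

/-- The output arrays `1` and `2` contain the list `W`, the variable `13` its length, and array `8`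
marks the vertices in `U`. -/
structure HasOutput (s : State) (W : List (Fin n × ZMod 2)) (U : Set (Fin n)) : Prop where
  length : s.var 13 = W.length
  out : ∀ i (h : i < W.length), s.arr 1 i = W[i].1 ∧ s.arr 2 i = W[i].2.val
  mark : ∀ v : Fin n, s.arr 8 v ≠ 0 ↔ v ∈ U

lemma HasOutput.congr {W : List (Fin n × ZMod 2)} {U : Set (Fin n)} (h : HasOutput s W U)
    (h0 : s'.var 13 = s.var 13) (h1 : s'.arr 1 = s.arr 1) (h2 : s'.arr 2 = s.arr 2)
    (h8 : s'.arr 8 = s.arr 8) : HasOutput s' W U :=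
  ⟨h0.trans h.length, by rw [h1, h2]; exact h.out, by rw [h8]; exact h.mark⟩

/-- Append the vertex in the variable `15` and the layer `l` to the output, and mark the vertex. -/
def emit (l : Expr) : Program :=
  .seq (.store 1 (.var 13) (.var 15)) (.seq (.store 2 (.var 13) l)
    (.seq (.store 8 (.var 15) (.const 1)) (.assign 13 (.add (.var 13) (.const 1)))))

lemma runs_emit {W : List (Fin n × ZMod 2)} {U : Set (Fin n)} {s₀ : State}
    (h₀ : HasOutput s₀ W U) (hv : s.var 13 = s₀.var 13) (ha : s.arr = s₀.arr) {c : Fin n}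
    (hc : s.var 15 = c) {l : Expr} {z : ZMod 2} (hl : ∀ s', s'.var = s.var → l.eval s' = z.val) :
    Runs N (emit l) s fun s' => HasOutput s' (W ++ [(c, z)]) (insert c U) := by
  have h : HasOutput s W U := h₀.congr hv (by rw [ha]) (by rw [ha]) (by rw [ha])
  refine Runs.seq (Runs.store (Runs.seq (Runs.store (Runs.seq (Runs.store (Runs.assign ?_))))))
  refine ⟨by simp [h.length], ?_, ?_⟩
  · intro i hi
    simp only [List.length_append, List.length_singleton] at hi
    simp only [Expr.eval, State.setVar_arr, State.setCell_arr, State.setCell_var, h.length]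
    by_cases h' : i < W.length
    · rw [List.getElem_append_left h']
      simpa [h'.ne] using h.out i h'
    · obtain rfl : i = W.length := by omega
      simp only [List.getElem_append_right le_rfl]
      refine ⟨by simp [hc], ?_⟩
      simp only [Nat.sub_self, List.getElem_singleton, Nat.reduceEqDiff, and_self, if_true,
        false_and, if_false]
      exact hl _ rfl
  · intro v
    have := h.mark v
    by_cases h' : v = c
    · simp [h', hc]
    · have h'' : (v : ℕ) ≠ c := fun h'' => h' (Fin.ext h'')
      simp [h', hc, h'', this]

/-- Append the traversal of the cycle of the vertex in the variable `10` to the output. The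
variable `11` is the depth, the variable `12` is `0` for the forward and `n` for the backward
direction, and the variable `14` is the layer. -/
def traverse : Program :=
  .seq (.assign 15 (.var 10)) <|
  .seq (.forLoop 16 (.var 11) (.seq (emit (.var 14)) (.seq (emit (.flip (.var 14)))
    (.seq (.assign 14 (.flip (.var 14))) (.assign 15 (.cell 7 (.add (.var 15) (.var 12)))))))) <|
  .seq (.assign 17 (.var 15)) <|
  .seq (emit (.var 14)) <|
  .seq (.loop (.ne (.cell 7 (.add (.var 15) (.var 12))) (.var 10))
    (.seq (.assign 15 (.cell 7 (.add (.var 15) (.var 12)))) (emit (.var 14)))) <|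
  .seq (.assign 14 (.flip (.var 14))) <|
  .seq (emit (.var 14)) <|
  .loop (.ne (.var 15) (.var 17))
    (.seq (.assign 15 (.cell 7 (.add (.var 15) (.sub (.var 0) (.var 12))))) (emit (.var 14)))

/-- The number of steps under `τ` from `τ^[d] e` back to `e`, counted from `1` on. -/
lemma exists_return (τ : Equiv.Perm (Fin n)) (e : Fin n) (d : ℕ) : ∃ r, 0 < r ∧
    r ≤ minimalPeriod τ e ∧ τ^[d + r] e = e ∧ (∀ i, 0 < i → i < r → τ^[d + i] e ≠ e) ∧
    (d < minimalPeriod τ e → r = minimalPeriod τ e - d) := by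
  have hk := minimalPeriod_perm_pos τ e
  set k := minimalPeriod τ e with hk'
  have hd := Nat.mod_lt d hk
  have hdiv := Nat.div_add_mod d k
  refine ⟨k - d % k, by omega, by omega, ?_, ?_, ?_⟩
  · have h : d + (k - d % k) = k * (d / k + 1) := by
      rw [mul_add]
      omega
    rw [h]
    exact isPeriodicPt_iff_minimalPeriod_dvd.mpr (Dvd.intro _ rfl)
  · intro i hi hi' h
    have h1 : k ∣ d + i := isPeriodicPt_iff_minimalPeriod_dvd.mp h
    have h2 : k ∣ d % k + i := by
      rwa [← hdiv, add_assoc, Nat.dvd_add_right (Dvd.intro _ rfl)] at h1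
    have := Nat.le_of_dvd (by omega) h2
    omega
  · intro h
    rw [Nat.mod_eq_of_lt h]

lemma minimalPeriod_le_card (τ : Equiv.Perm (Fin n)) (e : Fin n) : minimalPeriod τ e ≤ n := by
  have h : Function.Injective fun i : Fin (minimalPeriod τ e) => τ^[(i : ℕ)] e :=
    fun i j hij => Fin.ext (iterate_injective_of_lt τ i.2 j.2 hij)
  simpa using Fintype.card_le_of_injective _ h

lemma val_add_one (l : ZMod 2) : (l + 1).val = 1 - l.val := by
  revert l
  decide

/-- The machine appends `traversal τ r d e l`. The number `r` of the remaining columns is found by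
watching for the return to `e`; it is the intended one if the depth `d` is less than the length of
the cycle, and `traverse` halts in any case. -/
lemma runs_traverse (hG : HasGraph G s) (hσ : HasPerm σ s) {τ : Equiv.Perm (Fin n)}
    (hτ : (τ = σ ∧ s.var 12 = 0) ∨ (τ = σ⁻¹ ∧ s.var 12 = n)) {e : Fin n} (he : s.var 10 = e)
    {d : ℕ} (hd : s.var 11 = d) (hdN : d ≤ N) (hnN : n ≤ N) {l : ZMod 2} (hl : s.var 14 = l.val)
    {W : List (Fin n × ZMod 2)} {U : Set (Fin n)} (hW : HasOutput s W U) :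
    Runs N traverse s fun s' => ∃ r, (d < minimalPeriod σ e → r = minimalPeriod σ e - d) ∧
      HasOutput s' (W ++ traversal τ r d e l) (U ∪ orbitSet σ e) ∧
      s'.var 14 = (l + d + 1).val := by
  have hsub : ∀ l : ZMod 2, 1 - l.val = (l + 1).val := fun l => (val_add_one l).symm
  -- the successors and predecessors of vertices
  have hnext : ∀ s' : State, s'.arr 7 = s.arr 7 → s'.var 12 = s.var 12 → ∀ c : Fin n,
      s'.var 15 = c → s'.arr 7 (s'.var 15 + s'.var 12) = τ c := by
    intro s' h1 h2 c hc
    rw [h1, h2, hc]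
    rcases hτ with ⟨rfl, h⟩ | ⟨rfl, h⟩ <;> rw [h]
    · exact (hσ c).1
    · rw [add_comm]
      exact (hσ c).2
  have hprev : ∀ s' : State, s'.arr 7 = s.arr 7 → s'.var 12 = s.var 12 → s'.var 0 = s.var 0 →
      ∀ c : Fin n, s'.var 15 = τ c → s'.arr 7 (s'.var 15 + (s'.var 0 - s'.var 12)) = c := by
    intro s' h1 h2 h0 c hc
    rw [h1, h2, hc, h0, hG.size]
    rcases hτ with ⟨rfl, h⟩ | ⟨rfl, h⟩ <;> rw [h]
    · rw [Nat.sub_zero, add_comm, (hσ _).2]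
      simp
    · rw [Nat.sub_self, add_zero, (hσ _).1]
      simp
  obtain ⟨r, hr0, hrk, hret, hret', hr⟩ := exists_return τ e d
  have hkτ : minimalPeriod τ e = minimalPeriod σ e := by
    rcases hτ with ⟨rfl, -⟩ | ⟨rfl, -⟩
    · rfl
    · exact minimalPeriod_perm_inv σ e
  have hrn : r ≤ n := hrk.trans (minimalPeriod_le_card τ e)
  have hback : ∀ i, 0 < i → i < r → τ^[i] (τ^[d] e) ≠ τ^[d] e := by
    intro i hi hi' h
    rw [← iterate_add_apply, Nat.add_comm, iterate_add_apply] at h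
    have h1 : τ^[i] e = e := (τ.injective.iterate d) (by simpa using h)
    exact not_isPeriodicPt_of_pos_of_lt_minimalPeriod hi.ne' (hi'.trans_le hrk) h1
  have hU : U ∪ {v | ∃ i < d + r, τ^[i] e = v} = U ∪ orbitSet σ e := by
    congr 1
    ext v
    have hs : τ.SameCycle e v ↔ σ.SameCycle e v := by
      rcases hτ with ⟨rfl, -⟩ | ⟨rfl, -⟩
      · rfl
      · exact Equiv.Perm.sameCycle_inv
    rw [mem_orbitSet, ← hs]
    constructor
    · rintro ⟨i, -, rfl⟩
      exact sameCycle_iterate τ e i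
    · intro h
      obtain ⟨i, hi, rfl⟩ := (sameCycle_iff_exists_iterate τ).mp h
      refine ⟨i, hi.trans_le (Nat.le_of_dvd (by omega) ?_), rfl⟩
      exact isPeriodicPt_iff_minimalPeriod_dvd.mp hret
  have hUstep : ∀ k, insert (τ^[k] e) (U ∪ {v | ∃ i < k, τ^[i] e = v}) =
      U ∪ {v | ∃ i < k + 1, τ^[i] e = v} := by
    intro k
    ext v
    simp only [Set.mem_insert_iff, Set.mem_union, Set.mem_ofPred_eq, Nat.lt_succ_iff_lt_or_eq]
    constructor
    · rintro (rfl | h | ⟨i, hi, rfl⟩)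
      · exact Or.inr ⟨k, Or.inr rfl, rfl⟩
      · exact Or.inl h
      · exact Or.inr ⟨i, Or.inl hi, rfl⟩
    · rintro (h | ⟨i, hi | rfl, rfl⟩)
      · exact Or.inr (Or.inl h)
      · exact Or.inr (Or.inr ⟨i, hi, rfl⟩)
      · exact Or.inl rfl
  refine Runs.seq (Runs.assign ?_)
  -- the zigzag part
  refine Runs.seq' (Q' := fun s' => ∃ W₁, HasOutput s' W₁ (U ∪ {v | ∃ i < d, τ^[i] e = v}) ∧
    s'.var 15 = τ^[d] e ∧ s'.var 14 = (l + d).val ∧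
    W₁ ++ traversal τ r 0 (τ^[d] e) (l + d) = W ++ traversal τ r d e l) ?_ ?_
  · refine Runs.forLoop (fun k s' => ∃ W₁, HasOutput s' W₁ (U ∪ {v | ∃ i < k, τ^[i] e = v}) ∧
      s'.var 15 = τ^[k] e ∧ s'.var 14 = (l + k).val ∧
      W₁ ++ traversal τ r (d - k) (τ^[k] e) (l + k) = W ++ traversal τ r d e l)
      d hdN rfl ?_ ?_ ?_ ?_
    · have := hW.congr (s' := (s.setVar 15 (s.var 10)).setVar 16 0) (by simp) rfl rfl rfl
      exact ⟨W, by simpa using this, by simp [he], by simp [hl],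
        by simp⟩
    · intro s' hf
      have := hf.1 11 rfl
      simp [this, hd]
    · rintro k s' hk hf hki ⟨W₁, h1, h2, h3, h4⟩
      refine Runs.seq' (runs_emit h1 rfl rfl h2 (z := l + k) ?_) fun s₁ hf₁ h5 => ?_
      · intro s'' hs''
        simp [hs'', h3]
      have h6 : s₁.var 15 = τ^[k] e := (hf₁.1 15 rfl).trans h2
      have h7 : s₁.var 14 = (l + k).val := (hf₁.1 14 rfl).trans h3
      refine Runs.seq' (runs_emit h5 rfl rfl h6 (z := l + k + 1) ?_) fun s₂ hf₂ h8 => ?_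
      · intro s'' hs''
        simp [Expr.flip, hs'', h7, hsub]
      have h9 : s₂.var 15 = τ^[k] e := (hf₂.1 15 rfl).trans h6
      have h10 : s₂.var 14 = (l + k).val := (hf₂.1 14 rfl).trans h7
      have h11 : s₂.arr 7 = s.arr 7 :=
        (hf₂.2 7 rfl).trans ((hf₁.2 7 rfl).trans (hf.2 7 rfl))
      have h12 : s₂.var 12 = s.var 12 :=
        (hf₂.1 12 rfl).trans ((hf₁.1 12 rfl).trans (hf.1 12 rfl))
      refine Runs.seq (Runs.assign (Runs.assign ?_))
      rw [Set.insert_idem, hUstep] at h8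
      refine ⟨W₁ ++ [(τ^[k] e, l + k)] ++ [(τ^[k] e, l + k + 1)], ?_, ?_, ?_, ?_⟩
      · exact h8.congr (by simp) rfl rfl rfl
      · simp only [Expr.eval, State.setVar_var, State.setVar_arr]
        simp only [iterate_succ_apply']
        exact hnext s₂ h11 h12 _ h9
      · simp [Expr.flip, h10, hsub, add_assoc]
      · rw [← h4, show d - k = (d - (k + 1)) + 1 by omega, traversal, iterate_succ_apply']
        simp [add_assoc]
    · rintro s' hf ⟨W₁, h1, h2, h3, h4⟩
      exact ⟨W₁, h1, h2, h3, by simpa using h4⟩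
  rintro s₁ hf₁ ⟨W₁, h1, h2, h3, h4⟩
  have hs₁7 : s₁.arr 7 = s.arr 7 := hf₁.2 7 rfl
  have hs₁12 : s₁.var 12 = s.var 12 := hf₁.1 12 rfl
  have hs₁10 : s₁.var 10 = e := (hf₁.1 10 rfl).trans he
  have hs₁0 : s₁.var 0 = s.var 0 := hf₁.1 0 rfl
  clear hf₁
  have hUin : ∀ k < d + r, insert (τ^[k] e) (U ∪ {v | ∃ i < d + r, τ^[i] e = v}) =
      U ∪ {v | ∃ i < d + r, τ^[i] e = v} := by
    intro k hk
    exact Set.insert_eq_of_mem (Or.inr ⟨k, hk, rfl⟩)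
  refine Runs.seq (Runs.assign ?_)
  refine Runs.seq' (runs_emit (s := s₁.setVar 17 (s₁.var 15)) h1 (by simp) rfl
    (c := τ^[d] e) (by simpa using h2) (z := l + d) ?_) fun s₂ hf₂ h5 => ?_
  · intro s'' hs''
    simp [hs'', h3]
  rw [hUstep] at h5
  have hs₂7 : s₂.arr 7 = s.arr 7 := (hf₂.2 7 rfl).trans hs₁7
  have hs₂12 : s₂.var 12 = s.var 12 := (hf₂.1 12 rfl).trans (by simpa using hs₁12)
  have hs₂10 : s₂.var 10 = e := (hf₂.1 10 rfl).trans (by simpa using hs₁10)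
  have hs₂0 : s₂.var 0 = s.var 0 := (hf₂.1 0 rfl).trans (by simpa using hs₁0)
  have hs₂14 : s₂.var 14 = (l + d).val := (hf₂.1 14 rfl).trans (by simpa using h3)
  have hs₂15 : s₂.var 15 = τ^[d] e := (hf₂.1 15 rfl).trans (by simpa using h2)
  have hs₂17 : s₂.var 17 = τ^[d] e := (hf₂.1 17 rfl).trans (by simpa using h2)
  clear hf₂ hs₁7 hs₁12 hs₁10 hs₁0
  -- the remaining columns, in one layer
  refine Runs.seq' (Q' := fun s' => HasOutput s'
      (W₁ ++ (List.range r).map fun i => (τ^[i] (τ^[d] e), l + d))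
      (U ∪ {v | ∃ i < d + r, τ^[i] e = v}) ∧ s'.var 15 = τ^[d + (r - 1)] e) ?_ ?_
  · refine Runs.loop (fun t s' => t + 1 ≤ r ∧ HasOutput s'
      (W₁ ++ (List.range (t + 1)).map fun i => (τ^[i] (τ^[d] e), l + d))
      (U ∪ {v | ∃ i < d + t + 1, τ^[i] e = v}) ∧ s'.var 15 = τ^[d + t] e) (m := r - 1) (by omega)
      ⟨by omega, by simpa using h5, by simpa using hs₂15⟩ ?_ ?_ ?_
    · rintro t s' hf ⟨ht, h6, h7⟩ hne
      rw [Ne, Expr.eval_ne] at hne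
      simp only [Expr.eval] at hne
      rw [hnext s' ((hf.2 7 rfl).trans hs₂7) ((hf.1 12 rfl).trans hs₂12) _ h7,
        (hf.1 10 rfl).trans hs₂10, ← iterate_succ_apply' τ] at hne
      by_contra hlt
      obtain rfl : r = t + 1 := by omega
      exact hne (congrArg Fin.val hret)
    · rintro t s' hf ⟨ht, h6, h7⟩ hne hlt
      have h8 := hnext s' ((hf.2 7 rfl).trans hs₂7) ((hf.1 12 rfl).trans hs₂12) _ h7
      refine Runs.seq (Runs.assign ?_)
      refine (runs_emit (s := s'.setVar 15 (s'.arr 7 (s'.var 15 + s'.var 12)))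
        h6 (by simp) rfl (c := τ^[d + t + 1] e) ?_ (z := l + d)
        ?_).imp fun s'' hf' h9 => ⟨by omega, ?_, ?_⟩
      · rw [iterate_succ_apply']
        simpa using h8
      · intro s'' hs''
        have := (hf.1 14 rfl).trans hs₂14
        simp [hs'', this]
      · rw [hUstep] at h9
        have : τ^[d + t + 1] e = τ^[t + 1] (τ^[d] e) := by
          rw [← iterate_add_apply]
          congr 1
          omega
        rw [List.range_succ, List.map_append, ← List.append_assoc]
        rw [this] at h9
        exact h9
      · rw [hf'.1 15 rfl, ← add_assoc, iterate_succ_apply']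
        simpa using h8
    · rintro t s' hf ⟨ht, h6, h7⟩ heq
      rw [Expr.eval_ne] at heq
      simp only [Expr.eval] at heq
      rw [hnext s' ((hf.2 7 rfl).trans hs₂7) ((hf.1 12 rfl).trans hs₂12) _ h7,
        (hf.1 10 rfl).trans hs₂10, ← iterate_succ_apply' τ] at heq
      have : t + 1 = r := by
        by_contra hne
        exact hret' (t + 1) (by omega) (by omega) (Fin.ext heq)
      subst this
      exact ⟨h6, h7⟩
  rintro s₃ hf₃ ⟨h6, h7⟩
  have hs₃7 : s₃.arr 7 = s.arr 7 := (hf₃.2 7 rfl).trans hs₂7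
  have hs₃12 : s₃.var 12 = s.var 12 := (hf₃.1 12 rfl).trans hs₂12
  have hs₃0 : s₃.var 0 = s.var 0 := (hf₃.1 0 rfl).trans hs₂0
  have hs₃14 : s₃.var 14 = (l + d).val := (hf₃.1 14 rfl).trans hs₂14
  have hs₃17 : s₃.var 17 = τ^[d] e := (hf₃.1 17 rfl).trans hs₂17
  clear hf₃
  refine Runs.seq (Runs.assign ?_)
  refine Runs.seq' (runs_emit (s := s₃.setVar 14 ((Expr.flip (.var 14)).eval s₃))
    h6 (by simp) rfl (c := τ^[d + (r - 1)] e)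
    (by simpa using h7) (z := l + d + 1) ?_) fun s₄ hf₄ h8 => ?_
  · intro s'' hs''
    simp [hs'', Expr.flip, hs₃14, hsub]
  rw [hUin _ (by omega)] at h8
  have hs₄7 : s₄.arr 7 = s.arr 7 := (hf₄.2 7 rfl).trans hs₃7
  have hs₄12 : s₄.var 12 = s.var 12 := (hf₄.1 12 rfl).trans (by simpa using hs₃12)
  have hs₄0 : s₄.var 0 = s.var 0 := (hf₄.1 0 rfl).trans (by simpa using hs₃0)
  have hs₄14 : s₄.var 14 = (l + d + 1).val :=
    (hf₄.1 14 rfl).trans (by simp [Expr.flip, hs₃14, hsub])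
  have hs₄15 : s₄.var 15 = τ^[d + (r - 1)] e := (hf₄.1 15 rfl).trans (by simpa using h7)
  have hs₄17 : s₄.var 17 = τ^[d] e := (hf₄.1 17 rfl).trans (by simpa using hs₃17)
  clear hf₄
  have hcol : ∀ i, τ^[d + i] e = τ^[i] (τ^[d] e) := fun i => by
    rw [Nat.add_comm, iterate_add_apply]
  -- the same columns in the other layer, backwards
  refine Runs.loop (fun t s' => t + 1 ≤ r ∧ HasOutput s'
      (W₁ ++ (List.range r).map (fun i => (τ^[i] (τ^[d] e), l + d)) ++
        (List.range (t + 1)).map fun i => (τ^[r - 1 - i] (τ^[d] e), l + d + 1))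
      (U ∪ {v | ∃ i < d + r, τ^[i] e = v}) ∧ s'.var 15 = τ^[d + (r - 1 - t)] e) (m := r - 1)
      (by omega) ⟨by omega, ?_, by simpa using hs₄15⟩ ?_ ?_ ?_
  · rw [hcol] at h8
    simpa using h8
  · rintro t s' hf ⟨ht, -, h7⟩ hne
    rw [Ne, Expr.eval_ne] at hne
    simp only [Expr.eval] at hne
    rw [h7, (hf.1 17 rfl).trans hs₄17] at hne
    by_contra hlt
    obtain rfl : t = r - 1 := by omega
    exact hne (by simp)
  · rintro t s' hf ⟨ht, h9, h7⟩ hne hlt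
    have h10 : s'.var 15 = τ (τ^[d + (r - 1 - (t + 1))] e) := by
      rw [h7, ← iterate_succ_apply' τ]
      congr 3
      omega
    have h11 := hprev s' ((hf.2 7 rfl).trans hs₄7) ((hf.1 12 rfl).trans hs₄12)
      ((hf.1 0 rfl).trans hs₄0) _ h10
    refine Runs.seq (Runs.assign ?_)
    refine (runs_emit (s := s'.setVar 15 (s'.arr 7 (s'.var 15 + (s'.var 0 - s'.var 12))))
      h9 (by simp) rfl (c := τ^[d + (r - 1 - (t + 1))] e)
      (by simpa using h11) (z := l + d + 1) ?_).imp fun s'' hf' h12 => ⟨by omega, ?_, ?_⟩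
    · intro s'' hs''
      have := (hf.1 14 rfl).trans hs₄14
      simp [hs'', this]
    · rw [hUin _ (by omega), hcol] at h12
      rw [List.range_succ, List.map_append, ← List.append_assoc]
      simpa using h12
    · rw [hf'.1 15 rfl]
      simpa using h11
  · rintro t s' hf ⟨ht, h9, h7⟩ heq
    rw [Expr.eval_ne] at heq
    simp only [Expr.eval] at heq
    rw [h7, (hf.1 17 rfl).trans hs₄17, hcol] at heq
    have : t = r - 1 := by
      by_contra hne
      exact hback (r - 1 - t) (by omega) (by omega) (Fin.ext heq)
    subst this
    rw [Nat.sub_add_cancel hr0] at h9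
    refine ⟨r, by rwa [← hkτ], ?_, (hf.1 14 rfl).trans hs₄14⟩
    rw [hU] at h9
    rw [← h4]
    simpa [traversal] using h9

end RAM

/-! ### Building a candidate on the machine -/

namespace RAM

open Function

variable {n : ℕ} {G : SimpleGraph (Fin n)} {σ : Equiv.Perm (Fin n)} {s s' : State} {N : ℕ}
  {P : Program}

lemma HasGraph.of_frame (h : HasGraph G s) (hf : Frame P s s') (h0 : P.modVar 0 = false)
    (h1 : P.modArr 0 = false) (h2 : P.modArr 6 = false) : HasGraph G s' :=
  h.congr (hf.1 0 h0) (hf.2 0 h1) (hf.2 6 h2)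

lemma HasPerm.of_frame (h : HasPerm σ s) (hf : Frame P s s') (h1 : P.modArr 7 = false) :
    HasPerm σ s' :=
  h.congr (hf.2 7 h1)

lemma HasGraph.setVar (h : HasGraph G s) {x k : ℕ} (hx : 0 ≠ x) : HasGraph G (s.setVar x k) :=
  h.congr (by simp [hx]) rfl rfl

lemma HasPerm.setVar (h : HasPerm σ s) (x k : ℕ) : HasPerm σ (s.setVar x k) := h.congr rfl

lemma HasOutput.of_append {W W' : List (Fin n × ZMod 2)} {U : Set (Fin n)}
    (h : HasOutput s (W ++ W') U) (h0 : s'.var 13 = W.length) (h1 : s'.arr = s.arr) :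
    HasOutput s' W U := by
  refine ⟨h0, fun i hi => ?_, by rw [h1]; exact h.mark⟩
  have := h.out i (by simp; omega)
  rwa [List.getElem_append_left hi, ← h1] at this

/-- The memory contains the chain `c`: its list is the part of the output of the length that is
stored in the variable `18`; the output may go on, as the current cycle is traversed already when
it is entered, in order to mark its vertices. -/
structure HasChain (σ : Equiv.Perm (Fin n)) (s : State) (c : Chain (Fin n)) : Prop where
  entry : s.var 10 = c.e
  layer : s.var 19 = c.lay.val
  output : HasOutput (s.setVar 13 (s.var 18)) c.W c.U
  subset : orbitSet σ c.e ⊆ c.U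

/-- Enter the cycle of the vertex in the variable `30`. -/
def enter : Program :=
  .seq (.assign 18 (.var 13)) <| .seq (.assign 19 (.var 14)) <| .seq (.assign 10 (.var 30)) <|
  .seq (.assign 11 (.const 0)) <| .seq (.assign 12 (.const 0)) traverse

lemma runs_enter (hG : HasGraph G s) (hσ : HasPerm σ s) (hnN : n ≤ N) {e : Fin n}
    (he : s.var 30 = e) {l : ZMod 2} (hl : s.var 14 = l.val) {W : List (Fin n × ZMod 2)}
    {U : Set (Fin n)} (hW : HasOutput s W U) :
    Runs N enter s fun s' => HasChain σ s' ⟨W, l, e, U ∪ orbitSet σ e⟩ := by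
  refine Runs.seq (Runs.assign (Runs.seq (Runs.assign (Runs.seq (Runs.assign (Runs.seq
    (Runs.assign (Runs.seq (Runs.assign ?_)))))))))
  refine Runs.imp (runs_traverse (e := e) (d := 0) (l := l) (W := W) (U := U) (G := G) (σ := σ) ?_ ?_
    (Or.inl ⟨rfl, ?_⟩) ?_ ?_ (Nat.zero_le _) hnN ?_ ?_) ?_
  · exact hG.congr (by simp) rfl rfl
  · exact hσ.congr rfl
  · simp
  · simp [he]
  · simp
  · simp [hl]
  · exact hW.congr (by simp) rfl rfl rfl
  rintro s' hf ⟨r, -, h, -⟩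
  refine ⟨?_, ?_, h.of_append ?_ rfl, Set.subset_union_right⟩
  · rw [hf.1 10 rfl]
    simp [he]
  · rw [hf.1 19 rfl]
    simp [hl]
  · rw [State.setVar_var, if_pos rfl, hf.1 18 rfl]
    simp [hW.length]

/-- Output the traversal of the current cycle of a chain; the variable `11` contains the depth. -/
def closeCycle : Program :=
  .seq (.assign 13 (.var 18)) <| .seq (.assign 14 (.var 19)) <|
  .seq (.assign 12 (.const 0)) traverse

lemma runs_closeCycle (hG : HasGraph G s) (hσ : HasPerm σ s) (hnN : n ≤ N)
    {c : Chain (Fin n)} (hc : HasChain σ s c) {d : ℕ} (hd : s.var 11 = d) (hdN : d ≤ N)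
    (hdk : d < minimalPeriod σ c.e) : Runs N closeCycle s fun s' =>
      HasOutput s' (c.close σ d) c.U ∧ s'.var 14 = (c.lay + d + 1).val := by
  refine Runs.seq (Runs.assign (Runs.seq (Runs.assign (Runs.seq (Runs.assign ?_)))))
  refine Runs.imp (runs_traverse (e := c.e) (d := d) (l := c.lay) (W := c.W) (U := c.U) (G := G)
    (σ := σ) ?_ ?_ (Or.inl ⟨rfl, ?_⟩) ?_ ?_ hdN hnN ?_ ?_) ?_
  · exact hG.congr (by simp) rfl rfl
  · exact hσ.congr rfl
  · simp
  · simp [hc.entry]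
  · simp [hd]
  · simp [hc.layer]
  · exact hc.output.congr (by simp) rfl rfl rfl
  rintro s' hf ⟨r, hr, h, h'⟩
  rw [hr hdk, Set.union_eq_self_of_subset_right hc.subset] at h
  exact ⟨h, h'⟩

/-- Determine the depth (variable `11`) at which the current cycle is left for the cycle of the vertex
in the variable `31`, and the vertex (variable `30`) at which the latter is entered. -/
def extendArgs : Program :=
  .ite (.adj (.var 10) (.var 31)) (.seq (.assign 11 (.const 0)) (.assign 30 (.var 31))) <|
  .ite (.adj (.var 10) (.cell 7 (.var 31)))
    (.seq (.assign 11 (.const 0)) (.assign 30 (.cell 7 (.var 31)))) <|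
  .seq (.assign 11 (.const 1)) <|
  .ite (.adj (.cell 7 (.var 10)) (.var 31)) (.assign 30 (.var 31))
    (.assign 30 (.cell 7 (.var 31)))

lemma runs_extendArgs (hG : HasGraph G s) (hσ : HasPerm σ s) {e v : Fin n} (he : s.var 10 = e)
    (hv : s.var 31 = v) : Runs N extendArgs s fun s' =>
      s'.var 11 = exitDepth G σ e v ∧ s'.var 30 = entryVertex G σ e v := by
  have h7 : ∀ u : Fin n, s.arr 7 u = σ u := fun u => (hσ u).1
  have h1 := hG.eval_adj (a := .var 10) (b := .var 31) (u := e) (v := v) (by simpa) (by simpa)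
  have h2 := hG.eval_adj (a := .var 10) (b := .cell 7 (.var 31)) (u := e) (v := σ v) (by simpa)
    (by simp [hv, h7])
  have h3 := (hG.congr (s' := s.setVar 11 1) (by simp) rfl rfl).eval_adj
    (a := .cell 7 (.var 10)) (b := .var 31) (u := σ e) (v := v)
    (by simp [he, h7]) (by simpa)
  refine Runs.ite (fun h => ?_) fun h => Runs.ite (fun h' => ?_) fun h' => ?_
  · rw [h1] at h
    refine Runs.seq (Runs.assign (Runs.assign ?_))
    simp [exitDepth, entryVertex, h, hv]
  · have h : ¬ G.Adj e v := by rw [← h1, not_not, h]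
    rw [h2] at h'
    refine Runs.seq (Runs.assign (Runs.assign ?_))
    simp [exitDepth, entryVertex, h, h', hv, h7]
  · have h : ¬ G.Adj e v := by rw [← h1, not_not, h]
    have h' : ¬ G.Adj e (σ v) := by rw [← h2, not_not, h']
    refine Runs.seq (Runs.assign (Runs.ite (fun h'' => ?_) fun h'' => ?_))
    · replace h'' := h3.mp h''
      refine Runs.assign ?_
      simp [exitDepth, entryVertex, h, h', h'', hv]
    · have h'' : ¬ G.Adj (σ e) v := fun h4 => h3.mpr h4 h''
      refine Runs.assign ?_
      simp [exitDepth, entryVertex, h, h', h'', hv, h7]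

/-- Extend the chain by the cycle of the vertex in the variable `31`, unless it is marked. -/
def extend : Program :=
  .ite (.cell 8 (.var 31)) .skip (.seq extendArgs (.seq closeCycle enter))

lemma runs_extend (hG : HasGraph G s) (hσ : HasPerm σ s) (hadj : ∀ v, G.Adj v (σ v))
    (hnN : n ≤ N) {c : Chain (Fin n)} (hc : HasChain σ s c) {v : Fin n} (hv : s.var 31 = v) :
    Runs N extend s fun s' => HasChain σ s' (c.step G σ v) := by
  have hmark : s.arr 8 v ≠ 0 ↔ v ∈ c.U := hc.output.mark v
  have hn : 1 ≤ n := Nat.one_le_of_lt v.2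
  refine Runs.ite (fun h => ?_) fun h => ?_
  · rw [Expr.eval, Expr.eval, hv, hmark] at h
    rw [Chain.step, if_pos h]
    exact Runs.skip hc
  · rw [Expr.eval, Expr.eval, hv] at h
    have h : v ∉ c.U := by rw [← hmark, not_not, h]
    rw [Chain.step, if_neg h]
    refine Runs.seq' (runs_extendArgs hG hσ hc.entry hv) ?_
    rintro s₁ hf₁ ⟨h1, h2⟩
    have hG₁ := hG.of_frame hf₁ rfl rfl rfl
    have hσ₁ := hσ.of_frame hf₁ rfl
    have hd := exitDepth_le (G := G) (σ := σ) c.e v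
    have hc₁ : HasChain σ s₁ c := by
      refine ⟨(hf₁.1 10 rfl).trans hc.entry, (hf₁.1 19 rfl).trans hc.layer,
        hc.output.congr ?_ (hf₁.2 1 rfl) (hf₁.2 2 rfl) (hf₁.2 8 rfl), hc.subset⟩
      simpa using hf₁.1 18 rfl
    refine Runs.seq' (runs_closeCycle hG₁ hσ₁ hnN hc₁ h1 (by omega) ?_) ?_
    · have := two_le_minimalPeriod hadj c.e
      omega
    rintro s₂ hf₂ ⟨h3, h4⟩
    have hO : orbitSet σ v = orbitSet σ (entryVertex G σ c.e v) := by
      ext w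
      have := sameCycle_entryVertex (G := G) (σ := σ) c.e v
      exact ⟨fun h => this.symm.trans h, fun h => this.trans h⟩
    rw [hO]
    exact runs_enter (hG₁.of_frame hf₂ rfl rfl rfl) (hσ₁.of_frame hf₂ rfl) hnN
      ((hf₂.1 30 rfl).trans h2) h4 h3

/-- Build a candidate; the parameters of the candidate are in the variables `20` to `26`. -/
def build : Program :=
  .seq (.forLoop 28 (.var 0) (.store 8 (.var 28) (.const 0))) <|
  .seq (.assign 13 (.const 0)) <| .seq (.assign 14 (.const 0)) <|
  .seq (.assign 10 (.var 20)) <| .seq (.assign 11 (.var 21)) <|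
  .seq (.ite (.var 22) (.assign 12 (.var 0)) (.assign 12 (.const 0))) <|
  .seq traverse <|
  .ite (.cell 8 (.var 23)) .skip <|
  .seq (.assign 30 (.var 23)) <| .seq enter <|
  .seq (.assign 31 (.var 24)) <| .seq extend <|
  .seq (.assign 31 (.var 25)) <| .seq extend <|
  .seq (.forLoop 28 (.var 0) (.seq (.assign 31 (.var 28)) extend)) <|
  .seq (.assign 11 (.var 26)) closeCycle

/-- The machine outputs the candidate. The hypothesis on `d` in the conclusion excludes the depths
that are tried, but exceed the length of the cycle of `e`. -/
lemma runs_build (hG : HasGraph G s) (hσ : HasPerm σ s) (hadj : ∀ v, G.Adj v (σ v))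
    (hnN : n ≤ N) {e x j q : Fin n} {d dl : ℕ} (he : s.var 20 = e) (hd : s.var 21 = d)
    (hdN : d ≤ N) {τ : Equiv.Perm (Fin n)}
    (hτ : (τ = σ ∧ s.var 22 = 0) ∨ (τ = σ⁻¹ ∧ s.var 22 = 1)) (hx : s.var 23 = x)
    (hj : s.var 24 = j) (hq : s.var 25 = q) (hdl : s.var 26 = dl) (hdl2 : dl < 2) :
    Runs N build s fun s' => ∃ r, (d < minimalPeriod σ e → r = minimalPeriod σ e - d) ∧
      ∃ U, HasOutput s' (candidate G σ τ e d r x (j :: q :: List.finRange n) dl) U := by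
  have hn : 1 ≤ n := Nat.one_le_of_lt e.2
  refine Runs.seq' (Q' := fun s' => ∀ u < n, s'.arr 8 u = 0) ?_ ?_
  · refine Runs.forLoop (fun k s' => ∀ u < k, s'.arr 8 u = 0) n hnN rfl (by simp) ?_ ?_ ?_
    · intro s' hf
      simpa [hG.size] using hf.1 0 rfl
    · intro k s' hk hf hki h
      refine Runs.store fun u hu => ?_
      by_cases hu' : u = k
      · simp [hki, hu']
      · simpa [hki, hu'] using h u (by omega)
    · exact fun s' _ h => h
  intro s₁ hf₁ h1
  refine Runs.seq (Runs.assign (Runs.seq (Runs.assign (Runs.seq (Runs.assign (Runs.seq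
    (Runs.assign ?_)))))))
  set s₂ := (((s₁.setVar 13 _).setVar 14 _).setVar 10 _).setVar 11 _ with hs₂
  have hv : ∀ i, 20 ≤ i → i ≤ 26 → s₂.var i = s.var i := by
    intro i hi hi'
    rw [← hf₁.1 i (by simp [Program.modVar, Program.forLoop]; omega), hs₂]
    simp only [State.setVar_var]
    rw [if_neg (by omega), if_neg (by omega), if_neg (by omega), if_neg (by omega)]
  have hG₂ : HasGraph G s₂ :=
    (hG.of_frame hf₁ rfl rfl rfl).congr (by simp [hs₂]) rfl rfl
  have hσ₂ : HasPerm σ s₂ := (hσ.of_frame hf₁ rfl).congr rfl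
  have h10 : s₂.var 10 = e := by
    have := hf₁.1 20 rfl
    simp [hs₂, this, he]
  have h11 : s₂.var 11 = d := by
    have := hf₁.1 21 rfl
    simp [hs₂, this, hd]
  have h14 : s₂.var 14 = (0 : ZMod 2).val := by simp [hs₂]
  have hO₂ : HasOutput s₂ [] (∅ : Set (Fin n)) := by
    refine ⟨by simp [hs₂], by simp, fun v => ?_⟩
    simpa [hs₂] using h1 v v.2
  refine Runs.seq' (Q' := fun s' => (τ = σ ∧ s'.var 12 = 0) ∨ (τ = σ⁻¹ ∧ s'.var 12 = n)) ?_ ?_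
  · have h0 := hG₂.size
    have h22 := hv 22 (by omega) (by omega)
    refine Runs.ite (fun h => Runs.assign ?_) fun h => Runs.assign ?_ <;>
    · rw [Expr.eval, h22] at h
      rcases hτ with hτ | hτ <;> simp_all
  intro s₃ hf₃ h3
  have hG₃ := hG₂.of_frame hf₃ rfl rfl rfl
  have hσ₃ := hσ₂.of_frame hf₃ rfl
  refine Runs.seq' (runs_traverse hG₃ hσ₃ h3 ((hf₃.1 10 rfl).trans h10)
    ((hf₃.1 11 rfl).trans h11) hdN hnN (l := 0) ((hf₃.1 14 rfl).trans h14)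
    (hO₂.congr (hf₃.1 13 rfl) (hf₃.2 1 rfl) (hf₃.2 2 rfl) (hf₃.2 8 rfl))) ?_
  rintro s₄ hf₄ ⟨r, hr, h4, h5⟩
  have hG₄ := hG₃.of_frame hf₄ rfl rfl rfl
  have hσ₄ := hσ₃.of_frame hf₄ rfl
  have hv₄ : ∀ i, 23 ≤ i → i ≤ 26 → s₄.var i = s.var i := by
    intro i hi hi'
    rw [← hv i (by omega) hi']
    interval_cases i <;> exact (hf₄.1 _ rfl).trans (hf₃.1 _ rfl)
  have h23 := (hv₄ 23 (by omega) (by omega)).trans hx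
  have h24 := (hv₄ 24 (by omega) (by omega)).trans hj
  have h25 := (hv₄ 25 (by omega) (by omega)).trans hq
  have h26 := (hv₄ 26 (by omega) (by omega)).trans hdl
  rw [List.nil_append, Set.empty_union] at h4
  have hmark := h4.mark x
  refine Runs.ite (fun h => Runs.skip ⟨r, hr, orbitSet σ e, ?_⟩) fun h => ?_
  · rw [Expr.eval, Expr.eval, h23, hmark] at h
    rw [candidate, if_pos h]
    exact h4
  rw [Expr.eval, Expr.eval, h23] at h
  have h : x ∉ orbitSet σ e := by rw [← hmark, not_not, h]
  have hgoal : ∀ s', (∃ U, HasOutput s' (((j :: q :: List.finRange n).foldl (Chain.step G σ)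
      ⟨traversal τ r d e 0, d + 1, x, orbitSet σ e ∪ orbitSet σ x⟩).close σ dl) U) →
      ∃ r, (d < minimalPeriod σ e → r = minimalPeriod σ e - d) ∧
      ∃ U, HasOutput s' (candidate G σ τ e d r x (j :: q :: List.finRange n) dl) U := by
    intro s' h'
    refine ⟨r, hr, ?_⟩
    rwa [candidate, if_neg h]
  set c : Chain (Fin n) := ⟨traversal τ r d e 0, d + 1, x, orbitSet σ e ∪ orbitSet σ x⟩
  clear_value s₂
  refine Runs.seq (Runs.assign ?_)
  refine Runs.seq' (runs_enter (s := s₄.setVar 30 ((Expr.var 23).eval s₄))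
    (hG₄.congr (by simp) rfl rfl) (hσ₄.congr rfl) hnN (e := x) (by simp [h23])
    (l := d + 1) (by simpa using h5) (h4.congr (by simp) rfl rfl rfl)) ?_
  intro s₅ hf₅ h6
  have hG₅ := (hG₄.setVar (by omega)).of_frame hf₅ rfl rfl rfl
  have hσ₅ := (hσ₄.setVar _ _).of_frame hf₅ rfl
  have h24' : s₅.var 24 = j := (hf₅.1 24 rfl).trans (by simp [h24])
  have h25' : s₅.var 25 = q := (hf₅.1 25 rfl).trans (by simp [h25])
  have h26' : s₅.var 26 = dl := (hf₅.1 26 rfl).trans (by simp [h26])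
  have hcongr : ∀ {s s' : State} {c : Chain (Fin n)}, HasChain σ s c → s'.var 10 = s.var 10 →
      s'.var 19 = s.var 19 → s'.var 18 = s.var 18 → s'.arr = s.arr → HasChain σ s' c := by
    intro s s' c hc h1 h2 h3 h4
    exact ⟨h1.trans hc.entry, h2.trans hc.layer,
      hc.output.congr (by simp [h3]) (by simp [h4]) (by simp [h4]) (by simp [h4]), hc.subset⟩
  clear hf₅
  refine Runs.seq (Runs.assign ?_)
  refine Runs.seq' (runs_extend (s := s₅.setVar 31 ((Expr.var 24).eval s₅))
    (hG₅.congr (by simp) rfl rfl) (hσ₅.congr rfl) hadj hnN (v := j)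
    (hcongr h6 (by simp) (by simp) (by simp) rfl) (by simp [h24'])) ?_
  intro s₆ hf₆ h7
  have hG₆ := (hG₅.setVar (by omega)).of_frame hf₆ rfl rfl rfl
  have hσ₆ := (hσ₅.setVar _ _).of_frame hf₆ rfl
  have h25'' : s₆.var 25 = q := (hf₆.1 25 rfl).trans (by simp [h25'])
  have h26'' : s₆.var 26 = dl := (hf₆.1 26 rfl).trans (by simp [h26'])
  refine Runs.seq (Runs.assign ?_)
  refine Runs.seq' (runs_extend (s := s₆.setVar 31 ((Expr.var 25).eval s₆))
    (hG₆.congr (by simp) rfl rfl) (hσ₆.congr rfl) hadj hnN (v := q)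
    (hcongr h7 (by simp) (by simp) (by simp) rfl) (by simp [h25''])) ?_
  intro s₇ hf₇ h8
  have hG₇ := (hG₆.setVar (by omega)).of_frame hf₇ rfl rfl rfl
  have hσ₇ := (hσ₆.setVar _ _).of_frame hf₇ rfl
  have h26₇ : s₇.var 26 = dl := (hf₇.1 26 rfl).trans (by simp [h26''])
  set c' := Chain.step G σ (Chain.step G σ c j) q with hc'
  refine Runs.seq' (Q' := fun s' => HasChain σ s' ((List.finRange n).foldl (Chain.step G σ) c'))
    ?_ ?_
  · refine Runs.forLoop (fun k s' =>
      HasChain σ s' (((List.finRange n).take k).foldl (Chain.step G σ) c')) n hnN rfl ?_ ?_ ?_ ?_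
    · exact hcongr h8 (by simp) (by simp) (by simp) rfl
    · intro s' hf
      simpa [hG₇.size] using hf.1 0 rfl
    · intro k s' hk hf hki h9
      refine Runs.seq (Runs.assign ?_)
      refine (runs_extend (s := s'.setVar 31 ((Expr.var 28).eval s'))
        ((hG₇.of_frame hf rfl rfl rfl).congr (by simp) rfl rfl)
        ((hσ₇.of_frame hf rfl).congr rfl) hadj hnN (v := ⟨k, hk⟩)
        (hcongr h9 (by simp) (by simp) (by simp) rfl) (by simp [hki])).imp fun s'' _ h10 => ?_
      have : (List.finRange n).take (k + 1) = (List.finRange n).take k ++ [⟨k, hk⟩] := by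
        rw [List.take_add_one, List.getElem?_eq_getElem (by simpa using hk)]
        simp
      rw [this, List.foldl_append]
      exact hcongr h10 (by simp) (by simp) (by simp) rfl
    · intro s' hf h9
      rwa [List.take_of_length_le (by simp)] at h9
  intro s₈ hf₈ h9
  refine Runs.seq (Runs.assign ?_)
  have h26₈ : s₈.var 26 = dl := (hf₈.1 26 rfl).trans h26₇
  refine (runs_closeCycle (s := s₈.setVar 11 ((Expr.var 26).eval s₈))
    ((hG₇.of_frame hf₈ rfl rfl rfl).congr (by simp) rfl rfl)
    ((hσ₇.of_frame hf₈ rfl).congr rfl) hnN (hcongr h9 (by simp) (by simp) (by simp) rfl)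
    (d := dl) (by simp [h26₈]) (by omega) ?_).imp fun s' _ h10 => hgoal s' ⟨_, h10.1⟩
  have := two_le_minimalPeriod hadj ((List.finRange n).foldl (Chain.step G σ) c').e
  omega

end RAM

/-! ### Checking a candidate on the machine -/

namespace RAM

variable {n : ℕ} {G : SimpleGraph (Fin n)} {σ : Equiv.Perm (Fin n)} {s s' : State} {N : ℕ}
  {P : Program}

/-- Negation of a condition. -/
def Expr.not (a : Expr) : Expr := .sub (.const 1) a

/-- Conjunction of conditions. -/
def Expr.and (a b : Expr) : Expr := .sub (.const 1) (.add (.not a) (.not b))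

@[simp] lemma Expr.eval_not (a : Expr) (s : State) : (Expr.not a).eval s = 0 ↔ a.eval s ≠ 0 := by
  simp only [Expr.not, Expr.eval]
  omega

@[simp] lemma Expr.eval_and (a b : Expr) (s : State) :
    (Expr.and a b).eval s = 0 ↔ a.eval s = 0 ∨ b.eval s = 0 := by
  simp only [Expr.and, Expr.not, Expr.eval]
  omega

/-- The positions `i` and `i + 1` of the closed walk with vertices `f` and layers `g` are adjacent
vertices of the prism. -/
def StepOk (G : SimpleGraph (Fin n)) (f g : ℕ → ℕ) (i : ℕ) : Prop :=
  f i < n ∧ f (i + 1) < n ∧ g i < 2 ∧ ((f i = f (i + 1) ∧ g i ≠ g (i + 1)) ∨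
    (g i = g (i + 1) ∧ ∃ u v : Fin n, f i = u ∧ f (i + 1) = v ∧ G.Adj u v))

/-- The functions `f` and `g` are the vertices and the layers of a Hamiltonian cycle of the prism.
-/
def IsCycleCode (G : SimpleGraph (Fin n)) (f g : ℕ → ℕ) : Prop :=
  f (n + n) = f 0 ∧ g (n + n) = g 0 ∧
    ∀ i < n + n, StepOk G f g i ∧ ∀ j < i, ¬ (f i = f j ∧ g i = g j)

/-- What passes the check is a Hamiltonian cycle, in the form in which the output is read. -/
lemma IsCycleCode.exists_isHamiltonianCycle {f g : ℕ → ℕ} (h : IsCycleCode G f g) (hn : 2 ≤ n) :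
    ∃ (a : Fin n × Fin 2) (p : (prism G).Walk a a), p.IsHamiltonianCycle ∧
      ∀ i ≤ p.length, f i = (p.getVert i).1 ∧ g i = (p.getVert i).2 := by
  obtain ⟨hf, hg, h⟩ := h
  have hlt : ∀ i ≤ n + n, f i < n ∧ g i < 2 := by
    intro i hi
    rcases hi.lt_or_eq with hi | rfl
    · exact ⟨(h i hi).1.1, (h i hi).1.2.2.1⟩
    · rw [hf, hg]
      exact ⟨(h 0 (by omega)).1.1, (h 0 (by omega)).1.2.2.1⟩
  let F : ℕ → Fin n × Fin 2 := fun i =>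
    (⟨f i % n, Nat.mod_lt _ (by omega)⟩, ⟨g i % 2, Nat.mod_lt _ (by omega)⟩)
  have hF : ∀ i ≤ n + n, ((F i).1 : ℕ) = f i ∧ ((F i).2 : ℕ) = g i := fun i hi =>
    ⟨Nat.mod_eq_of_lt (hlt i hi).1, Nat.mod_eq_of_lt (hlt i hi).2⟩
  have hcard : Fintype.card (Fin n × Fin 2) = n + n := by
    rw [Fintype.card_prod, Fintype.card_fin, Fintype.card_fin]
    omega
  have hadj : ∀ i < n + n, (prism G).Adj (F i) (F (i + 1)) := by
    intro i hi
    obtain ⟨-, -, -, ⟨h1, h2⟩ | ⟨h1, u, v, h2, h3, h4⟩⟩ := (h i hi).1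
    · rw [boxProd_adj]
      refine Or.inr ⟨?_, Fin.ext ?_⟩
      · intro h3
        rw [← (hF i hi.le).2, ← (hF (i + 1) hi).2, h3] at h2
        exact h2 rfl
      · rw [(hF i hi.le).1, (hF (i + 1) hi).1, h1]
    · rw [boxProd_adj]
      refine Or.inl ⟨?_, Fin.ext ?_⟩
      · have hu : (F i).1 = u := Fin.ext ((hF i hi.le).1.trans h2)
        have hv : (F (i + 1)).1 = v := Fin.ext ((hF (i + 1) hi).1.trans h3)
        rw [hu, hv]
        exact h4
      · rw [(hF i hi.le).2, (hF (i + 1) hi).2, h1]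
  have hinj : ∀ j < n + n, ∀ i < j, F i ≠ F j := by
    intro j hj i hij heq
    refine (h j hj).2 i hij ⟨?_, ?_⟩
    · rw [← (hF j hj.le).1, ← (hF i (by omega)).1, heq]
    · rw [← (hF j hj.le).2, ← (hF i (by omega)).2, heq]
  have hclose : F (n + n) = F 0 := by
    refine Prod.ext (Fin.ext ?_) (Fin.ext ?_)
    · rw [(hF _ le_rfl).1, (hF 0 (by omega)).1, hf]
    · rw [(hF _ le_rfl).2, (hF 0 (by omega)).2, hg]
  obtain ⟨p, hp, hp'⟩ :=
    exists_isHamiltonianCycle_of_forall_adj (n + n) (by omega) hcard F hadj hinj hclose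
  refine ⟨_, p, hp, fun i hi => ?_⟩
  rw [hp' i hi]
  have hi' : i ≤ n + n := by
    rwa [hp.length_eq, hcard] at hi
  exact ⟨(hF i hi').1.symm, (hF i hi').2.symm⟩

lemma IsPrismCycle.length_eq {W : List (Fin n × ZMod 2)} (h : IsPrismCycle G W) :
    W.length = n + n := by
  have h1 : W.toFinset = Finset.univ := by
    ext p
    simpa using h.2.1 p
  have h2 := List.toFinset_card_of_nodup h.1
  rw [h1, Finset.card_univ, Fintype.card_prod, Fintype.card_fin, ZMod.card] at h2
  omega

/-- A good candidate passes the check. -/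
lemma IsPrismCycle.isCycleCode {W : List (Fin n × ZMod 2)} (h : IsPrismCycle G W) {f g : ℕ → ℕ}
    (hfg : ∀ i (h : i < W.length), f i = W[i].1 ∧ g i = W[i].2.val) (hf : f (n + n) = f 0)
    (hg : g (n + n) = g 0) : IsCycleCode G f g := by
  have hlen := IsPrismCycle.length_eq h
  obtain ⟨hnd, hmem, a, b, ⟨h1, h2, h3⟩, hba⟩ := h
  have hval : ∀ p q : Fin n × ZMod 2, PrismAdj G p q → ∀ i, f i = p.1 → f (i + 1) = q.1 →
      g i = p.2.val → g (i + 1) = q.2.val → StepOk G f g i := by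
    intro p q hpq i h4 h5 h6 h7
    refine ⟨by rw [h4]; exact p.1.2, by rw [h5]; exact q.1.2, by rw [h6]; exact p.2.val_lt, ?_⟩
    rcases hpq with ⟨h8, h9⟩ | ⟨h8, h9⟩
    · exact Or.inr ⟨by rw [h6, h7, h9], p.1, q.1, h4, h5, h8⟩
    · exact Or.inl ⟨by rw [h4, h5, h8], by rw [h6, h7]; exact fun h => h9 (ZMod.val_injective 2 h)⟩
  refine ⟨hf, hg, fun i hi => ⟨?_, ?_⟩⟩
  · have hi' : i < W.length := by omega
    by_cases hi₁ : i + 1 < W.length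
    · exact hval _ _ (List.isChain_iff_getElem.mp h3 i hi₁) i (hfg i hi').1 (hfg _ hi₁).1
        (hfg i hi').2 (hfg _ hi₁).2
    · have h0 : 0 < W.length := by omega
      have hi₂ : i + 1 = n + n := by omega
      have hb : W[i] = b := by
        rw [List.getLast?_eq_getElem?, List.getElem?_eq_some_iff] at h2
        obtain ⟨h4, h5⟩ := h2
        rw [← h5]
        congr 1
        omega
      have ha : W[0] = a := by
        rw [List.head?_eq_getElem?, List.getElem?_eq_some_iff] at h1
        exact h1.2
      refine hval b a hba i ?_ ?_ ?_ ?_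
      · rw [(hfg i hi').1, hb]
      · rw [hi₂, hf, (hfg 0 h0).1, ha]
      · rw [(hfg i hi').2, hb]
      · rw [hi₂, hg, (hfg 0 h0).2, ha]
  · rintro j hj ⟨h4, h5⟩
    have hi' : i < W.length := by omega
    have hj' : j < W.length := by omega
    rw [(hfg i hi').1, (hfg j hj').1] at h4
    rw [(hfg i hi').2, (hfg j hj').2] at h5
    have := (hnd.getElem_inj_iff (hi := hi') (hj := hj')).mp
      (Prod.ext (Fin.ext h4) (ZMod.val_injective 2 h5))
    omega

/-- The condition `StepOk` for the position in the variable `33`. -/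
def stepExpr : Expr :=
  .and (.sub (.var 0) (.cell 1 (.var 33))) <|
  .and (.sub (.var 0) (.cell 1 (.add (.var 33) (.const 1)))) <|
  .and (.sub (.const 2) (.cell 2 (.var 33))) <|
  .add (.and (.not (.ne (.cell 1 (.var 33)) (.cell 1 (.add (.var 33) (.const 1)))))
      (.ne (.cell 2 (.var 33)) (.cell 2 (.add (.var 33) (.const 1)))))
    (.and (.not (.ne (.cell 2 (.var 33)) (.cell 2 (.add (.var 33) (.const 1)))))
      (.adj (.cell 1 (.var 33)) (.cell 1 (.add (.var 33) (.const 1)))))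

lemma eval_stepExpr (hG : HasGraph G s) :
    stepExpr.eval s ≠ 0 ↔ StepOk G (s.arr 1) (s.arr 2) (s.var 33) := by
  simp only [stepExpr, Ne, Expr.eval_and, Expr.eval, Expr.eval_not, Expr.eval_ne, StepOk, hG.size,
    Nat.add_eq_zero_iff]
  by_cases h1 : s.arr 1 (s.var 33) < n
  · by_cases h2 : s.arr 1 (s.var 33 + 1) < n
    · have h := hG.eval_adj_eq_zero (a := .cell 1 (.var 33))
        (b := .cell 1 (.add (.var 33) (.const 1))) (u := ⟨_, h1⟩) (v := ⟨_, h2⟩) rfl rfl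
      have h' : (∃ u v : Fin n, s.arr 1 (s.var 33) = u ∧ s.arr 1 (s.var 33 + 1) = v ∧ G.Adj u v) ↔
          G.Adj ⟨_, h1⟩ ⟨_, h2⟩ := by
        constructor
        · rintro ⟨⟨u, hu⟩, ⟨v, hv⟩, rfl, rfl, h⟩
          exact h
        · exact fun h => ⟨_, _, rfl, rfl, h⟩
      have h3 : 2 - s.arr 2 (s.var 33) = 0 ↔ ¬ s.arr 2 (s.var 33) < 2 := by omega
      have h4 : n - s.arr 1 (s.var 33) ≠ 0 := by omega
      have h5 : n - s.arr 1 (s.var 33 + 1) ≠ 0 := by omega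
      rw [h, h']
      tauto
    · have : n - s.arr 1 (s.var 33 + 1) = 0 := by omega
      tauto
  · have : n - s.arr 1 (s.var 33) = 0 := by omega
    tauto

/-- Set the variable `27` to a nonzero value if the output is a Hamiltonian cycle of the prism,
and to `0` otherwise. -/
def check : Program :=
  .seq (.store 1 (.add (.var 0) (.var 0)) (.cell 1 (.const 0))) <|
  .seq (.store 2 (.add (.var 0) (.var 0)) (.cell 2 (.const 0))) <|
  .seq (.assign 27 (.const 1)) <|
  .forLoop 33 (.add (.var 0) (.var 0)) <|
  .seq (.ite stepExpr .skip (.assign 27 (.const 0))) <|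
  .forLoop 34 (.var 33) <|
  .ite (.add (.ne (.cell 1 (.var 33)) (.cell 1 (.var 34)))
    (.ne (.cell 2 (.var 33)) (.cell 2 (.var 34)))) .skip (.assign 27 (.const 0))

lemma runs_check (hG : HasGraph G s) (hN : n + n ≤ N) : Runs N check s fun s' =>
    (s'.var 27 ≠ 0 ↔ IsCycleCode G (s'.arr 1) (s'.arr 2)) ∧
    (∀ i < n + n, s'.arr 1 i = s.arr 1 i ∧ s'.arr 2 i = s.arr 2 i) ∧
    s'.arr 1 (n + n) = s'.arr 1 0 ∧ s'.arr 2 (n + n) = s'.arr 2 0 := by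
  refine Runs.seq (Runs.store (Runs.seq (Runs.store (Runs.seq (Runs.assign ?_)))))
  simp only [Expr.eval, hG.size, State.setCell_var]
  set s₁ := ((s.setCell 1 (n + n) (s.arr 1 0)).setCell 2 _ _).setVar 27 1 with hs₁
  have hG₁ : HasGraph G s₁ := hG.congr (by simp [hs₁]) (by simp [hs₁, State.setCell_arr_ne])
    (by simp [hs₁, State.setCell_arr_ne])
  have h1 : ∀ i, s₁.arr 1 i = if i = n + n then s.arr 1 0 else s.arr 1 i := by simp [hs₁]
  have h2 : ∀ i, s₁.arr 2 i = if i = n + n then s.arr 2 0 else s.arr 2 i := by simp [hs₁]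
  have h3 : s₁.var 27 = 1 := by simp [hs₁]
  clear_value s₁
  have h4 : s₁.arr 1 (n + n) = s₁.arr 1 0 ∧ s₁.arr 2 (n + n) = s₁.arr 2 0 := by
    simp [h1, h2]
  refine Runs.forLoop (fun k s' => s'.var 27 ≠ 0 ↔ ∀ i < k, StepOk G (s₁.arr 1) (s₁.arr 2) i ∧
    ∀ j < i, ¬ (s₁.arr 1 i = s₁.arr 1 j ∧ s₁.arr 2 i = s₁.arr 2 j)) (n + n) hN rfl
    (by simp [h3]) ?_ ?_ ?_
  · intro s' hf
    have := (hf.1 0 rfl).trans hG₁.size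
    simp [this]
  · intro k s' hk hf hki h5
    have hG' := hG₁.of_frame hf rfl rfl rfl
    have hs'1 : s'.arr 1 = s₁.arr 1 := hf.2 1 rfl
    have hs'2 : s'.arr 2 = s₁.arr 2 := hf.2 2 rfl
    have h6 := eval_stepExpr hG'
    rw [hki, hs'1, hs'2] at h6
    refine Runs.seq' (Q' := fun s'' => s''.var 27 ≠ 0 ↔ s'.var 27 ≠ 0 ∧
      StepOk G (s₁.arr 1) (s₁.arr 2) k) ?_ ?_
    · refine Runs.ite (fun h => Runs.skip ?_) fun h => Runs.assign ?_
      · rw [h6] at h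
        simp [h]
      · have h : ¬ StepOk G (s₁.arr 1) (s₁.arr 2) k := by rw [← h6, not_not, h]
        simp [h]
    intro s₂ hf₂ h7
    have hs₂1 : s₂.arr 1 = s₁.arr 1 := (hf₂.2 1 rfl).trans hs'1
    have hs₂2 : s₂.arr 2 = s₁.arr 2 := (hf₂.2 2 rfl).trans hs'2
    have hs₂33 : s₂.var 33 = k := (hf₂.1 33 rfl).trans hki
    refine Runs.forLoop (fun l s'' => s''.var 27 ≠ 0 ↔ s₂.var 27 ≠ 0 ∧ ∀ j < l,
      ¬ (s₁.arr 1 k = s₁.arr 1 j ∧ s₁.arr 2 k = s₁.arr 2 j)) k (by omega) rfl (by simp) ?_ ?_ ?_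
    · intro s'' hf''
      simpa [hs₂33] using hf''.1 33 rfl
    · intro l s'' hl hf'' hli h8
      have hs''1 : s''.arr 1 = s₁.arr 1 := (hf''.2 1 rfl).trans hs₂1
      have hs''2 : s''.arr 2 = s₁.arr 2 := (hf''.2 2 rfl).trans hs₂2
      have hs''33 : s''.var 33 = k := (hf''.1 33 rfl).trans hs₂33
      have h9 : (Expr.add (.ne (.cell 1 (.var 33)) (.cell 1 (.var 34)))
          (.ne (.cell 2 (.var 33)) (.cell 2 (.var 34)))).eval s'' = 0 ↔
          s₁.arr 1 k = s₁.arr 1 l ∧ s₁.arr 2 k = s₁.arr 2 l := by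
        rw [Expr.eval, Nat.add_eq_zero_iff, Expr.eval_ne, Expr.eval_ne]
        simp only [Expr.eval, hs''1, hs''2, hs''33, hli]
      simp only [Nat.forall_lt_succ_right, ← and_assoc, State.setVar_var, Nat.reduceEqDiff,
        if_false, ← h8]
      refine Runs.ite (fun h => Runs.skip ?_) fun h => Runs.assign ?_
      · rw [Ne, h9] at h
        exact (and_iff_left h).symm
      · rw [h9] at h
        simp [h]
    · intro s'' hf'' h8
      simp only [Nat.forall_lt_succ_right, ← h5]
      rw [← and_assoc, ← h7, ← h8]
      rfl
  · intro s' hf h5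
    rw [hf.2 1 rfl, hf.2 2 rfl]
    refine ⟨?_, ?_, h4.1, h4.2⟩
    · rw [h5, IsCycleCode]
      exact ⟨fun h => ⟨h4.1, h4.2, h⟩, fun h => h.2.2⟩
    · intro i hi
      simp [h1, h2, hi.ne]

end RAM

/-! ### Searching for a candidate on the machine -/

namespace RAM

open Function

variable {n : ℕ} {G : SimpleGraph (Fin n)} {σ : Equiv.Perm (Fin n)} {s s' : State} {N : ℕ}
  {P : Program}

/-- The variable `27` is nonzero only if the output arrays contain a Hamiltonian cycle of the
prism. -/
def Sound (G : SimpleGraph (Fin n)) (s : State) : Prop :=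
  s.var 27 ≠ 0 → IsCycleCode G (s.arr 1) (s.arr 2)

lemma Sound.congr (h : Sound G s) (h0 : s'.var 27 = s.var 27) (h1 : s'.arr 1 = s.arr 1)
    (h2 : s'.arr 2 = s.arr 2) : Sound G s' := by
  unfold Sound
  rw [h0, h1, h2]
  exact h

/-- The program `P` keeps a Hamiltonian cycle of the prism, if one has been found, and
otherwise finds one if `C` holds. -/
def Finds (N : ℕ) (G : SimpleGraph (Fin n)) (P : Program) (s : State) (C : Prop) : Prop :=
  Runs N P s fun s' => Sound G s' ∧ (s.var 27 ≠ 0 ∨ C → s'.var 27 ≠ 0)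

lemma Finds.forLoop (hG : HasGraph G s) (hσ : HasPerm σ s) (hs : Sound G s) {x m : ℕ} {hi : Expr}
    (hm : m ≤ N) (hx : 27 ≠ x) {C : Fin m → Prop} (hxP : P.modVar x = false)
    (hhi : ∀ s', Frame (Program.forLoop x hi P) s s' → hi.eval s' = m)
    (hv : (Program.forLoop x hi P).modVar 0 = false)
    (ha : (Program.forLoop x hi P).modArr 0 = false)
    (ha6 : (Program.forLoop x hi P).modArr 6 = false)
    (ha7 : (Program.forLoop x hi P).modArr 7 = false)
    (h : ∀ (k : Fin m) (s' : State), Frame (Program.forLoop x hi P) s s' → s'.var x = k →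
      HasGraph G s' → HasPerm σ s' → Sound G s' → Finds N G P s' (C k)) :
    Finds N G (Program.forLoop x hi P) s (∃ k, C k) := by
  refine Runs.forLoop (fun k s' => Sound G s' ∧
    (s.var 27 ≠ 0 ∨ (∃ i : Fin m, i < k ∧ C i) → s'.var 27 ≠ 0)) m hm hxP ?_ hhi ?_ ?_
  · refine ⟨hs.congr (by simp [hx]) rfl rfl, ?_⟩
    rintro (h | ⟨i, hi, -⟩)
    · simpa [hx] using h
    · omega
  · rintro k s' hk hf hki ⟨h1, h2⟩
    refine Runs.imp (h ⟨k, hk⟩ s' hf hki (hG.of_frame hf hv ha ha6) (hσ.of_frame hf ha7) h1) ?_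
    rintro s'' - ⟨h3, h4⟩
    refine ⟨h3.congr (by simp [hx]) rfl rfl, ?_⟩
    rw [State.setVar_var, if_neg hx]
    rintro (h5 | ⟨i, hi, h5⟩)
    · exact h4 (Or.inl (h2 (Or.inl h5)))
    · rcases Nat.lt_succ_iff_lt_or_eq.mp hi with hi | hi
      · exact h4 (Or.inl (h2 (Or.inr ⟨i, hi, h5⟩)))
      · obtain rfl : i = ⟨k, hk⟩ := Fin.ext hi
        exact h4 (Or.inr h5)
  · rintro s' - ⟨h1, h2⟩
    exact ⟨h1, fun h3 => h2 (h3.imp_right fun ⟨i, hi⟩ => ⟨i, i.2, hi⟩)⟩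

/-- Build and check the candidate given by the variables `20` to `26`, unless a Hamiltonian cycle
has been found before. -/
def attempt : Program := .ite (.var 27) .skip (.seq build check)

lemma finds_attempt (hG : HasGraph G s) (hσ : HasPerm σ s) (hs : Sound G s)
    (hadj : ∀ v, G.Adj v (σ v)) (hN : n + n ≤ N) {e d x j q : Fin n} {b dl : Fin 2}
    (he : s.var 20 = e) (hd : s.var 21 = d) (hb : s.var 22 = b) (hx : s.var 23 = x)
    (hj : s.var 24 = j) (hq : s.var 25 = q) (hdl : s.var 26 = dl) :
    Finds N G attempt s (d < minimalPeriod σ e ∧ IsPrismCycle G (candidate G σ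
      (if b = 0 then σ else σ⁻¹) e d (minimalPeriod σ e - d) x (j :: q :: List.finRange n) dl)) := by
  refine Runs.ite (fun h => Runs.skip ⟨hs, fun _ => h⟩) fun h => ?_
  refine Runs.seq' (runs_build hG hσ hadj (by omega) he hd (by omega)
    (τ := if b = 0 then σ else σ⁻¹) ?_ hx hj hq hdl dl.2) ?_
  · rw [hb]
    fin_cases b <;> simp
  · rintro s₁ hf₁ ⟨r, hr, U, h1⟩
    refine Runs.imp (runs_check (hG.of_frame hf₁ rfl rfl rfl) hN) ?_
    rintro s₂ - ⟨h2, h3, h4, h5⟩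
    refine ⟨fun h => h2.mp h, ?_⟩
    rintro (h6 | ⟨h6, h7⟩)
    · exact absurd h h6
    · rw [← hr h6] at h7
      have hlen := IsPrismCycle.length_eq h7
      refine h2.mpr (IsPrismCycle.isCycleCode h7 (fun i hi => ?_) h4 h5)
      rw [(h3 i (by omega)).1, (h3 i (by omega)).2]
      exact h1.out i hi

/-- Try all candidates: all first cycles `20` with their depths `21` and directions `22`, all second
cycles `23`, all vertices `24`, `25` to come next, and both depths `26` of the last cycle. -/
def search : Program :=
  .forLoop 20 (.var 0) <| .forLoop 21 (.var 0) <| .forLoop 22 (.const 2) <|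
  .forLoop 23 (.var 0) <| .forLoop 24 (.var 0) <| .forLoop 25 (.var 0) <|
  .forLoop 26 (.const 2) attempt

lemma finds_search (hG : HasGraph G s) (hσ : HasPerm σ s) (hs : Sound G s)
    (hadj : ∀ v, G.Adj v (σ v)) (hN : n + n ≤ N) (hN2 : 2 ≤ N) :
    Finds N G search s (HasCandidate G σ (List.finRange n)) := by
  have hsize : ∀ (P : Program) s s', HasGraph G s → Frame P s s' → P.modVar 0 = false →
      (Expr.var 0).eval s' = n := by
    intro P s s' h hf h0
    rw [Expr.eval, hf.1 0 h0, h.size]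
  have h : Finds N G search s (∃ (e d : Fin n) (b : Fin 2) (x j q : Fin n) (dl : Fin 2),
      d < minimalPeriod σ e ∧ IsPrismCycle G (candidate G σ (if b = 0 then σ else σ⁻¹) e d
        (minimalPeriod σ e - d) x (j :: q :: List.finRange n) dl)) := by
    refine Finds.forLoop hG hσ hs (by omega) (by omega) rfl
      (fun s' hf => hsize _ s s' hG hf rfl) rfl rfl rfl rfl ?_
    intro e s₁ hf₁ h20 hG hσ hs
    refine Finds.forLoop hG hσ hs (by omega) (by omega) rfl
      (fun s' hf => hsize _ s₁ s' hG hf rfl) rfl rfl rfl rfl ?_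
    intro d s₂ hf₂ h21 hG hσ hs
    refine Finds.forLoop hG hσ hs (by omega) (by omega) rfl (fun s' hf => rfl) rfl rfl rfl rfl ?_
    intro b s₃ hf₃ h22 hG hσ hs
    refine Finds.forLoop hG hσ hs (by omega) (by omega) rfl
      (fun s' hf => hsize _ s₃ s' hG hf rfl) rfl rfl rfl rfl ?_
    intro x s₄ hf₄ h23 hG hσ hs
    refine Finds.forLoop hG hσ hs (by omega) (by omega) rfl
      (fun s' hf => hsize _ s₄ s' hG hf rfl) rfl rfl rfl rfl ?_
    intro j s₅ hf₅ h24 hG hσ hs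
    refine Finds.forLoop hG hσ hs (by omega) (by omega) rfl
      (fun s' hf => hsize _ s₅ s' hG hf rfl) rfl rfl rfl rfl ?_
    intro q s₆ hf₆ h25 hG hσ hs
    refine Finds.forLoop hG hσ hs (by omega) (by omega) rfl (fun s' hf => rfl) rfl rfl rfl rfl ?_
    intro dl s₇ hf₇ h26 hG hσ hs
    have h25 := (hf₇.1 25 rfl).trans h25
    have h24 := (hf₇.1 24 rfl).trans ((hf₆.1 24 rfl).trans h24)
    have h23 := (hf₇.1 23 rfl).trans ((hf₆.1 23 rfl).trans ((hf₅.1 23 rfl).trans h23))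
    have h22 := (hf₇.1 22 rfl).trans ((hf₆.1 22 rfl).trans ((hf₅.1 22 rfl).trans
      ((hf₄.1 22 rfl).trans h22)))
    have h21 := (hf₇.1 21 rfl).trans ((hf₆.1 21 rfl).trans ((hf₅.1 21 rfl).trans
      ((hf₄.1 21 rfl).trans ((hf₃.1 21 rfl).trans h21))))
    have h20 := (hf₇.1 20 rfl).trans ((hf₆.1 20 rfl).trans ((hf₅.1 20 rfl).trans
      ((hf₄.1 20 rfl).trans ((hf₃.1 20 rfl).trans ((hf₂.1 20 rfl).trans h20)))))
    exact finds_attempt hG hσ hs hadj hN h20 h21 h22 h23 h24 h25 h26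
  refine Runs.imp h fun s' _ h' => ⟨h'.1, fun h'' => h'.2 (h''.imp_right ?_)⟩
  rintro ⟨e, d, hd, τ, hτ, x, j, q, dl, hdl, h1⟩
  have hd' : d < n := hd.trans_le (minimalPeriod_le_card σ e)
  rcases hτ with rfl | rfl
  · exact ⟨e, ⟨d, hd'⟩, 0, x, j, q, ⟨dl, hdl⟩, hd, by simpa using h1⟩
  · exact ⟨e, ⟨d, hd'⟩, 1, x, j, q, ⟨dl, hdl⟩, hd, by simpa using h1⟩

end RAM

/-! ### The auction for a perfect matching -/

namespace RAM

open Function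

/-- The invariant of the auction: `a u` is `w + 1` if `u` holds `w`, and `0` if `u` holds nothing,
`b w` is `u + 1` in the former case and `0` if `w` is free, and `p` are the prices. Whatever is held
is a neighbour whose price exceeds the price of no other neighbour by more than `1`. -/
structure IsAuction {n : ℕ} (G : SimpleGraph (Fin n)) (p a b : ℕ → ℕ) : Prop where
  holds_iff : ∀ u w : Fin n, a u = w + 1 ↔ b w = u + 1
  holder : ∀ w : Fin n, b w ≠ 0 → ∃ u : Fin n, b w = u + 1
  adj : ∀ u w : Fin n, a u = w + 1 → G.Adj u w
  price : ∀ u w w' : Fin n, a u = w + 1 → G.Adj u w' → p w ≤ p w' + 1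
  free : ∀ w : Fin n, b w = 0 → p w = 0
  price_le : ∀ w : Fin n, p w ≤ n
  held : ∀ u : Fin n, a u ≠ 0 → ∃ w : Fin n, a u = w + 1

variable {n : ℕ} {G : SimpleGraph (Fin n)} {σ : Equiv.Perm (Fin n)} {s s' : State} {N : ℕ}
  {P : Program} {p a b : ℕ → ℕ}

open Classical in
/-- A bidder who holds nothing pays less than `n`: by Hall's condition for the holders of the
vertices of price at least `k + 1`, together with this bidder, there are more vertices of price at
least `k` than of price at least `k + 1`. -/
lemma IsAuction.price_lt (h : IsAuction G p a b)
    (hall : ∀ L : Finset (Fin n), L.card ≤ (Finset.univ.filter fun w => ∃ v ∈ L, G.Adj v w).card)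
    {u w : Fin n} (hu : a u = 0) (huw : G.Adj u w) (hmin : ∀ w', G.Adj u w' → p w ≤ p w') :
    p w < n := by
  have key : ∀ k ≤ p w, (Finset.univ.filter fun v : Fin n => k ≤ p v).card + k ≤ n := by
    intro k
    induction k with
    | zero => simp
    | succ k ih =>
      intro hk
      have hR : (Finset.univ.filter fun v : Fin n => k + 1 ≤ p v).card ≤
          (Finset.univ.filter fun v : Fin n => ∃ x : Fin n, a v = x + 1 ∧ k + 1 ≤ p x).card := by
        have hex : ∀ x : Fin n, ∃ v : Fin n, k + 1 ≤ p x → b x = v + 1 := by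
          intro x
          by_cases hx : k + 1 ≤ p x
          · have : b x ≠ 0 := fun h0 => by
              have := h.free x h0
              omega
            obtain ⟨v, hv⟩ := h.holder x this
            exact ⟨v, fun _ => hv⟩
          · exact ⟨x, fun h => absurd h hx⟩
        choose f hf using hex
        refine Finset.card_le_card_of_injOn f ?_ ?_
        · intro x hx
          simp only [Finset.coe_filter, Finset.mem_univ, true_and, Set.mem_ofPred_eq] at hx ⊢
          exact ⟨x, (h.holds_iff _ _).mpr (hf x hx), hx⟩
        · intro x hx y hy hxy
          simp only [Finset.coe_filter, Finset.mem_univ, true_and, Set.mem_ofPred_eq] at hx hy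
          have h1 := (h.holds_iff _ _).mpr (hf x hx)
          have h2 := (h.holds_iff _ _).mpr (hf y hy)
          rw [hxy, h2] at h1
          exact Fin.ext (by omega)
      have h1 := hall (insert u
        (Finset.univ.filter fun v : Fin n => ∃ x : Fin n, a v = x + 1 ∧ k + 1 ≤ p x))
      rw [Finset.card_insert_of_notMem (by simp [hu])] at h1
      have h2 : (Finset.univ.filter fun x => ∃ v ∈ insert u
          (Finset.univ.filter fun v : Fin n => ∃ x : Fin n, a v = x + 1 ∧ k + 1 ≤ p x),
          G.Adj v x) ⊆ Finset.univ.filter fun v : Fin n => k ≤ p v := by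
        intro x hx
        simp only [Finset.mem_filter, Finset.mem_univ, true_and, Finset.mem_insert] at hx ⊢
        obtain ⟨v, rfl | ⟨y, hy, hy'⟩, hvx⟩ := hx
        · have := hmin x hvx
          omega
        · have := h.price v y x hy hvx
          omega
      have h3 := Finset.card_le_card h2
      have h4 := ih (by omega)
      omega
  have h1 := key (p w) le_rfl
  have h2 : 0 < (Finset.univ.filter fun v : Fin n => p w ≤ p v).card :=
    Finset.card_pos.mpr ⟨w, by simp⟩
  omega

/-- The bid of `u` for `w`, which evicts the holder of `w`, keeps the invariant. -/
lemma IsAuction.step (h : IsAuction G p a b) {u w : Fin n} (hu : a u = 0) (huw : G.Adj u w)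
    (hmin : ∀ w', G.Adj u w' → p w ≤ p w') (hlt : p w < n) {p' a' b' : ℕ → ℕ}
    (hp : ∀ v : Fin n, p' v = if v = w then p w + 1 else p v)
    (ha : ∀ v : Fin n, a' v = if v = u then (w + 1 : ℕ) else if b w = (v + 1 : ℕ) then 0 else a v)
    (hb : ∀ v : Fin n, b' v = if v = w then (u + 1 : ℕ) else b v) : IsAuction G p' a' b' := by
  have hbu : ∀ v : Fin n, b v ≠ u + 1 := by
    intro v hv
    have := (h.holds_iff u v).mpr hv
    omega
  have hmono : ∀ v : Fin n, p v ≤ p' v := by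
    intro v
    rw [hp]
    split_ifs with hv
    · subst hv
      omega
    · exact le_rfl
  have hcases : ∀ v x : Fin n, a' v = x + 1 → (v = u ∧ x = w) ∨ (v ≠ u ∧ x ≠ w ∧ a v = x + 1) := by
    intro v x hvx
    rw [ha] at hvx
    split_ifs at hvx with h1 h2
    · exact Or.inl ⟨h1, Fin.ext (by omega)⟩
    · refine Or.inr ⟨h1, ?_, hvx⟩
      rintro rfl
      exact h2 ((h.holds_iff v x).mp hvx)
  refine ⟨fun v x => ?_, fun x hx => ?_, fun v x hvx => ?_, fun v x x' hvx hadj => ?_,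
    fun x hx => ?_, fun x => ?_, fun v hv => ?_⟩
  · constructor
    · intro hvx
      rw [hb]
      rcases hcases v x hvx with ⟨rfl, rfl⟩ | ⟨h1, h2, h3⟩
      · simp
      · rw [if_neg h2]
        exact (h.holds_iff v x).mp h3
    · intro hvx
      rw [hb] at hvx
      rw [ha]
      split_ifs at hvx with h1
      · subst h1
        rw [if_pos (Fin.ext (by omega))]
      · have h2 := (h.holds_iff v x).mpr hvx
        rw [if_neg (by rintro rfl; omega), if_neg, h2]
        intro h3
        have h4 := (h.holds_iff v w).mpr h3
        exact h1 (Fin.ext (by omega))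
  · rw [hb] at hx ⊢
    split_ifs at hx ⊢ with h1
    · exact ⟨u, rfl⟩
    · exact h.holder x hx
  · rcases hcases v x hvx with ⟨rfl, rfl⟩ | ⟨-, -, h3⟩
    · exact huw
    · exact h.adj v x h3
  · have h0 := hmono x'
    rcases hcases v x hvx with ⟨rfl, rfl⟩ | ⟨-, h2, h3⟩
    · have := hmin x' hadj
      rw [hp x, if_pos rfl]
      omega
    · have := h.price v x x' h3 hadj
      rw [hp x, if_neg h2]
      omega
  · rw [hb] at hx
    split_ifs at hx with h1
    rw [hp, if_neg h1]
    exact h.free x hx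
  · rw [hp]
    split_ifs
    · exact hlt
    · exact h.price_le x
  · rw [ha] at hv ⊢
    by_cases h1 : v = u
    · exact ⟨w, if_pos h1⟩
    · by_cases h2 : b w = v + 1
      · simp [h1, h2] at hv
      · rw [if_neg h1, if_neg h2] at hv ⊢
        exact h.held v hv

lemma IsAuction.exists_perm (h : IsAuction G p a b) (ha : ∀ u : Fin n, a u ≠ 0) :
    ∃ σ : Equiv.Perm (Fin n), (∀ v, G.Adj v (σ v)) ∧
      ∀ u : Fin n, a u = σ u + 1 ∧ b u = (σ⁻¹ u : Fin n) + 1 := by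
  choose f hf using fun u => h.held u (ha u)
  have hinj : Injective f := by
    intro u v huv
    have h1 := (h.holds_iff u (f u)).mp (hf u)
    have h2 := (h.holds_iff v (f v)).mp (hf v)
    rw [huv, h2] at h1
    exact Fin.ext (by omega)
  let σ : Equiv.Perm (Fin n) := Equiv.ofBijective f (Finite.injective_iff_bijective.mp hinj)
  have hσ : ∀ u, σ u = f u := fun u => rfl
  refine ⟨σ, fun v => h.adj v _ (hf v), fun u => ⟨hf u, ?_⟩⟩
  rw [← h.holds_iff, hf, ← hσ]
  simp

/-- One bid: a vertex that holds nothing takes its cheapest neighbour, whose price rises by `1`. -/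
def bid : Program :=
  .seq (.assign 41 (.var 0)) <|
  .seq (.forLoop 42 (.var 0) (.ite (.cell 5 (.var 42)) .skip (.assign 41 (.var 42)))) <|
  .ite (.sub (.var 0) (.var 41))
    (.seq (.assign 43 (.var 0)) <|
      .seq (.forLoop 42 (.var 0) (.ite (.and (.adj (.var 41) (.var 42))
        (.add (.not (.sub (.var 0) (.var 43))) (.sub (.cell 3 (.var 43)) (.cell 3 (.var 42)))))
        (.assign 43 (.var 42)) .skip)) <|
      .seq (.ite (.cell 4 (.var 43)) (.store 5 (.sub (.cell 4 (.var 43)) (.const 1)) (.const 0))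
        .skip) <|
      .seq (.store 5 (.var 41) (.add (.var 43) (.const 1))) <|
      .seq (.store 4 (.var 43) (.add (.var 41) (.const 1))) <|
      .store 3 (.var 43) (.add (.cell 3 (.var 43)) (.const 1)))
    .skip

/-- As long as some vertex holds nothing, every bid increases the sum of the prices. -/
lemma runs_bid (hG : HasGraph G s) (hnN : n ≤ N)
    (hall : ∀ L : Finset (Fin n), ∀ [DecidablePred fun w => ∃ v ∈ L, G.Adj v w],
      L.card ≤ (Finset.univ.filter fun w => ∃ v ∈ L, G.Adj v w).card)
    (h : IsAuction G (s.arr 3) (s.arr 5) (s.arr 4)) {c : ℕ}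
    (hc : (∃ u : Fin n, s.arr 5 u = 0) → c ≤ ∑ v : Fin n, s.arr 3 v) :
    Runs N bid s fun s' => IsAuction G (s'.arr 3) (s'.arr 5) (s'.arr 4) ∧
      ((∃ u : Fin n, s'.arr 5 u = 0) → c + 1 ≤ ∑ v : Fin n, s'.arr 3 v) := by
  classical
  refine Runs.seq (Runs.assign ?_)
  set s₀ := s.setVar 41 ((Expr.var 0).eval s) with hs₀
  have hG₀ : HasGraph G s₀ := hG.setVar (by omega)
  have h41 : s₀.var 41 = n := by simp [hs₀, hG.size]
  have harr : s₀.arr = s.arr := rfl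
  rw [← harr] at h hc
  clear_value s₀
  clear hG
  -- choose a bidder
  refine Runs.seq' (Q' := fun s' => (s'.var 41 = n ∧ ∀ u : Fin n, s₀.arr 5 u ≠ 0) ∨
    ∃ u : Fin n, s'.var 41 = u ∧ s₀.arr 5 u = 0) ?_ ?_
  · refine Runs.forLoop (fun k s' => (s'.var 41 = n ∧ ∀ u : Fin n, (u : ℕ) < k → s₀.arr 5 u ≠ 0) ∨
      ∃ u : Fin n, s'.var 41 = u ∧ s₀.arr 5 u = 0) n hnN rfl
      (Or.inl ⟨by simpa using h41, by simp⟩)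
      ?_ ?_ ?_
    · intro s' hf
      exact (hf.1 0 rfl).trans hG₀.size
    · intro k s' hk hf hki hinv
      have h5 : s'.arr 5 = s₀.arr 5 := hf.2 5 rfl
      refine Runs.ite (fun h1 => Runs.skip ?_) fun h1 => Runs.assign ?_
      · rw [Expr.eval, Expr.eval, h5, hki] at h1
        refine hinv.imp (fun ⟨h2, h3⟩ => ⟨by simpa using h2, fun u hu => ?_⟩)
          fun ⟨u, hu, hu'⟩ => ⟨u, by simpa using hu, hu'⟩
        rcases Nat.lt_succ_iff_lt_or_eq.mp hu with hu | hu
        · exact h3 u hu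
        · rwa [hu]
      · rw [Expr.eval, Expr.eval, h5, hki] at h1
        exact Or.inr ⟨⟨k, hk⟩, by simp [hki], h1⟩
    · rintro s' - (⟨h1, h2⟩ | h1)
      · exact Or.inl ⟨h1, fun u => h2 u u.2⟩
      · exact Or.inr h1
  intro s₁ hf₁ hu
  have hG₁ := hG₀.of_frame hf₁ rfl rfl rfl
  have h3 : s₁.arr 3 = s₀.arr 3 := hf₁.2 3 rfl
  have h4 : s₁.arr 4 = s₀.arr 4 := hf₁.2 4 rfl
  have h5 : s₁.arr 5 = s₀.arr 5 := hf₁.2 5 rfl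
  rw [← h3, ← h4, ← h5] at h
  rw [← h3, ← h5] at hc
  rw [← h5] at hu
  clear hf₁ h3 h4 h5 harr h41 hs₀
  refine Runs.ite (fun h1 => ?_) fun h1 => Runs.skip ⟨h, ?_⟩
  swap
  · rcases hu with ⟨-, hu⟩ | ⟨u, hu, -⟩
    · rintro ⟨u, hu'⟩
      exact absurd hu' (hu u)
    · have := u.2
      simp only [Expr.eval, hu, hG₁.size] at h1
      omega
  obtain ⟨u, hu, hu0⟩ : ∃ u : Fin n, s₁.var 41 = u ∧ s₁.arr 5 u = 0 := by
    refine hu.resolve_left ?_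
    rintro ⟨hu, -⟩
    simp [hu, hG₁.size] at h1
  have hc := hc ⟨u, hu0⟩
  clear h1
  refine Runs.seq (Runs.assign ?_)
  -- find its cheapest neighbour
  refine Runs.seq' (Q' := fun s' => ∃ w : Fin n, s'.var 43 = w ∧ G.Adj u w ∧
    ∀ w', G.Adj u w' → s₁.arr 3 w ≤ s₁.arr 3 w') ?_ ?_
  · refine Runs.forLoop (fun k s' =>
      (s'.var 43 = n ∧ ∀ w' : Fin n, (w' : ℕ) < k → ¬ G.Adj u w') ∨
      (∃ w : Fin n, s'.var 43 = w ∧ G.Adj u w ∧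
        ∀ w' : Fin n, (w' : ℕ) < k → G.Adj u w' → s₁.arr 3 w ≤ s₁.arr 3 w'))
      n hnN rfl (Or.inl ⟨by simp [hG₁.size], by simp⟩) ?_ ?_ ?_
    · intro s' hf
      exact (hf.1 0 rfl).trans (by simp [hG₁.size])
    · intro k s' hk hf hki hinv
      have h3 : s'.arr 3 = s₁.arr 3 := hf.2 3 rfl
      have hG' : HasGraph G s' := (hG₁.setVar (by omega)).of_frame hf rfl rfl rfl
      have h41 : s'.var 41 = u := (hf.1 41 rfl).trans (by simp [hu])
      have hadj := hG'.eval_adj_eq_zero (a := .var 41) (b := .var 42) (u := u) (v := ⟨k, hk⟩)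
        h41 hki
      refine Runs.ite (fun h1 => Runs.assign ?_) fun h1 => Runs.skip ?_
      · rw [Ne, Expr.eval_and, not_or, hadj, not_not] at h1
        obtain ⟨h1, h2⟩ := h1
        refine Or.inr ⟨⟨k, hk⟩, by simp [hki], h1, fun w' hw' hadj' => ?_⟩
        rcases Nat.lt_succ_iff_lt_or_eq.mp hw' with hw' | hw'
        · rcases hinv with ⟨-, h4⟩ | ⟨w, h4, h5, h6⟩
          · exact absurd hadj' (h4 w' hw')
          · have h7 := h6 w' hw' hadj'
            have h8 := w.2
            rw [Expr.eval, Nat.add_eq_zero_iff, Expr.eval_not] at h2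
            simp only [Expr.eval, h4, hG'.size, hki, h3] at h2
            change s₁.arr 3 k ≤ _
            omega
        · rw [show w' = ⟨k, hk⟩ from Fin.ext hw']
      · rw [Expr.eval_and, hadj, Expr.eval, Nat.add_eq_zero_iff, Expr.eval_not] at h1
        simp only [Expr.eval, hG'.size, hki, h3] at h1
        rcases hinv with ⟨h4, h5⟩ | ⟨w, h4, h5, h6⟩
        · refine Or.inl ⟨by simpa using h4, fun w' hw' => ?_⟩
          rcases Nat.lt_succ_iff_lt_or_eq.mp hw' with hw' | hw'
          · exact h5 w' hw'
          · rw [show w' = ⟨k, hk⟩ from Fin.ext hw']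
            refine h1.resolve_right fun h7 => ?_
            omega
        · refine Or.inr ⟨w, by simpa using h4, h5, fun w' hw' hadj' => ?_⟩
          rcases Nat.lt_succ_iff_lt_or_eq.mp hw' with hw' | hw'
          · exact h6 w' hw' hadj'
          · rw [show w' = ⟨k, hk⟩ from Fin.ext hw'] at hadj' ⊢
            have h7 := h1.resolve_left (not_not.mpr hadj')
            rw [h4] at h7
            change _ ≤ s₁.arr 3 k
            omega
    · rintro s' - (⟨h1, h2⟩ | ⟨w, h1, h2, h3⟩)
      · have h4 := hall {u}
        rw [Finset.card_singleton] at h4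
        obtain ⟨w, hw⟩ := Finset.card_pos.mp (Nat.lt_of_lt_of_le Nat.zero_lt_one h4)
        simp only [Finset.mem_filter, Finset.mem_singleton, exists_eq_left] at hw
        exact absurd hw.2 (h2 w w.2)
      · exact ⟨w, h1, h2, fun w' => h3 w' w'.2⟩
  rintro s₂ hf₂ ⟨w, hw, huw, hmin⟩
  have hu₂ : s₂.var 41 = u := (hf₂.1 41 rfl).trans (by simp [hu])
  have h3 : s₂.arr 3 = s₁.arr 3 := hf₂.2 3 rfl
  have h4 : s₂.arr 4 = s₁.arr 4 := hf₂.2 4 rfl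
  have h5 : s₂.arr 5 = s₁.arr 5 := hf₂.2 5 rfl
  rw [← h3, ← h4, ← h5] at h
  simp only [← h3] at hc hmin
  rw [← h5] at hu0
  clear hf₂ h3 h4 h5 hG₁ hG₀ hu
  have hlt := h.price_lt (fun L => hall L) hu0 huw hmin
  -- the previous holder loses it
  refine Runs.seq' (Q' := fun s' => ∀ v : Fin n, s'.arr 5 v =
    if s₂.arr 4 w = v + 1 then 0 else s₂.arr 5 v) ?_ ?_
  · refine Runs.ite (fun h1 => Runs.store fun v => ?_) fun h1 => Runs.skip fun v => ?_
    · rw [Expr.eval, Expr.eval, hw] at h1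
      simp only [Expr.eval, hw, State.setCell_arr, true_and]
      refine if_congr ?_ rfl rfl
      omega
    · rw [Expr.eval, Expr.eval, hw] at h1
      simp [h1]
  intro s₃ hf₃ h6
  have hu₃ : s₃.var 41 = u := (hf₃.1 41 rfl).trans hu₂
  have hw₃ : s₃.var 43 = w := (hf₃.1 43 rfl).trans hw
  have h3 : s₃.arr 3 = s₂.arr 3 := hf₃.2 3 rfl
  have h4 : s₃.arr 4 = s₂.arr 4 := hf₃.2 4 rfl
  refine Runs.seq (Runs.store (Runs.seq (Runs.store (Runs.store ?_))))
  have hp : ∀ v : Fin n, ((((s₃.setCell 5 u (w + 1)).setCell 4 w (u + 1)).setCell 3 w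
      (s₃.arr 3 w + 1)).arr 3 v) = if v = w then s₂.arr 3 w + 1 else s₂.arr 3 v := by
    intro v
    by_cases hv : v = w
    · simp [hv, h3]
    · have hv' : (v : ℕ) ≠ w := fun h => hv (Fin.ext h)
      simp [hv, hv', h3]
  simp only [Expr.eval, State.setCell_var, hu₃, hw₃,
    State.setCell_arr_ne _ _ _ (show 3 ≠ 4 by omega),
    State.setCell_arr_ne _ _ _ (show 3 ≠ 5 by omega)]
  refine ⟨h.step hu0 huw hmin hlt hp ?_ ?_, fun _ => ?_⟩
  · intro v
    by_cases hv : v = u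
    · simp [hv]
    · have hv' : (v : ℕ) ≠ u := fun h => hv (Fin.ext h)
      simp [hv, hv', h6]
  · intro v
    by_cases hv : v = w
    · simp [hv]
    · have hv' : (v : ℕ) ≠ w := fun h => hv (Fin.ext h)
      simp [hv, hv', h4]
  · refine (Nat.succ_le_succ hc).trans (Nat.succ_le_of_lt ?_)
    refine Finset.sum_lt_sum (fun v _ => ?_) ⟨w, Finset.mem_univ w, ?_⟩
    · rw [hp]
      split_ifs with hv
      · rw [hv]
        omega
      · exact le_rfl
    · rw [hp, if_pos rfl]
      omega

/-- Compute a permutation that maps every vertex to a neighbour, with its inverse. -/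
def matchAll : Program :=
  .seq (.forLoop 44 (.add (.var 0) (.const 1)) (.forLoop 45 (.add (.var 0) (.const 1)) bid)) <|
  .forLoop 42 (.var 0) (.seq (.store 7 (.var 42) (.sub (.cell 5 (.var 42)) (.const 1)))
    (.store 7 (.add (.var 0) (.var 42)) (.sub (.cell 4 (.var 42)) (.const 1))))

/-- There are `(n + 1) ^ 2` bids, but the prices are at most `n`, so their sum is at most `n ^ 2`: in
the end every vertex holds a neighbour. -/
lemma runs_matchAll (hG : HasGraph G s) (hnN : n + 1 ≤ N)
    (hall : ∀ L : Finset (Fin n), ∀ [DecidablePred fun w => ∃ v ∈ L, G.Adj v w],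
      L.card ≤ (Finset.univ.filter fun w => ∃ v ∈ L, G.Adj v w).card)
    (h3 : ∀ v, s.arr 3 v = 0) (h4 : ∀ v, s.arr 4 v = 0) (h5 : ∀ v, s.arr 5 v = 0) :
    Runs N matchAll s fun s' => ∃ σ : Equiv.Perm (Fin n), HasPerm σ s' ∧ ∀ v, G.Adj v (σ v) := by
  refine Runs.seq' (Q' := fun s' => IsAuction G (s'.arr 3) (s'.arr 5) (s'.arr 4) ∧
    ∀ u : Fin n, s'.arr 5 u ≠ 0) ?_ ?_
  · refine Runs.forLoop (fun k s' => IsAuction G (s'.arr 3) (s'.arr 5) (s'.arr 4) ∧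
      ((∃ u : Fin n, s'.arr 5 u = 0) → k * (n + 1) ≤ ∑ v : Fin n, s'.arr 3 v)) (n + 1) hnN rfl
      ?_ ?_ ?_ ?_
    · refine ⟨⟨?_, ?_, ?_, ?_, ?_, ?_, ?_⟩, ?_⟩ <;> simp [h3, h4, h5]
    · intro s' hf
      simpa [hG.size] using hf.1 0 rfl
    · rintro k s' hk hf hki ⟨h6, h7⟩
      have hG' := hG.of_frame hf rfl rfl rfl
      refine Runs.forLoop (fun l s' => IsAuction G (s'.arr 3) (s'.arr 5) (s'.arr 4) ∧
        ((∃ u : Fin n, s'.arr 5 u = 0) → k * (n + 1) + l ≤ ∑ v : Fin n, s'.arr 3 v)) (n + 1) hnN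
        rfl ⟨h6, h7⟩ ?_ ?_ ?_
      · intro s'' hf'
        simpa [hG'.size] using hf'.1 0 rfl
      · rintro l s'' hl hf' hli ⟨h8, h9⟩
        exact runs_bid (hG'.of_frame hf' rfl rfl rfl) (by omega) hall h8 h9
      · rintro s'' hf' ⟨h8, h9⟩
        rw [← Nat.succ_mul] at h9
        exact ⟨h8, h9⟩
    · rintro s' hf ⟨h6, h7⟩
      refine ⟨h6, fun u hu => ?_⟩
      have h8 := h7 ⟨u, hu⟩
      have h9 : ∑ v : Fin n, s'.arr 3 v ≤ n * n := by
        simpa using Finset.sum_le_card_nsmul Finset.univ (fun v : Fin n => s'.arr 3 v) n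
          fun v _ => h6.price_le v
      nlinarith
  rintro s₁ hf₁ ⟨h6, h7⟩
  have hG₁ := hG.of_frame hf₁ rfl rfl rfl
  obtain ⟨σ, hσ, hσ'⟩ := h6.exists_perm h7
  refine Runs.forLoop (fun k s' => ∀ u : Fin n, (u : ℕ) < k → s'.arr 7 u = σ u ∧
    s'.arr 7 (n + u) = (σ⁻¹ u : Fin n)) n (by omega) rfl (by simp) ?_ ?_ ?_
  · intro s' hf
    exact (hf.1 0 rfl).trans hG₁.size
  · intro k s' hk hf hki h8
    have h4 : s'.arr 4 = s₁.arr 4 := hf.2 4 rfl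
    have h5 : s'.arr 5 = s₁.arr 5 := hf.2 5 rfl
    have h0 : s'.var 0 = n := (hf.1 0 rfl).trans hG₁.size
    refine Runs.seq (Runs.store (Runs.store fun u hu => ?_))
    have hk' := hσ' ⟨k, hk⟩
    have hne : ∀ i : ℕ, (u : ℕ) ≠ n + i := fun i => by omega
    rcases Nat.lt_succ_iff_lt_or_eq.mp hu with hu | hu
    · have h1 : (n + u : ℕ) ≠ k := by omega
      simpa [hki, h0, hu.ne, hne, h1] using h8 u hu
    · obtain rfl : u = ⟨k, hk⟩ := Fin.ext hu
      simp only at hne ⊢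
      have hn : n ≠ 0 := by omega
      simp [hki, h0, h4, h5, hk', hn]
  · exact fun s' _ h8 => ⟨σ, fun u => h8 u u.2, hσ⟩

end RAM

/-! ### Splitting even cycles into edges on the machine -/

namespace RAM

open Function

variable {n : ℕ} {G : SimpleGraph (Fin n)} {σ : Equiv.Perm (Fin n)} {s s' : State} {N : ℕ}
  {P : Program}

/-- Choose every second edge of every cycle of `σ`, where `c v` is `0` or `1` according to the
parity of the number of steps from `v` to the smallest vertex of its cycle. -/
lemma exists_involution (hadj : ∀ v, G.Adj v (σ v)) (heven : ∀ v, ¬ Odd (minimalPeriod σ v))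
    {c : Fin n → ℕ} (hc : ∀ v, ∃ i, c v = i % 2 ∧ ∀ w, σ.SameCycle v w → σ^[i] v ≤ w) :
    ∃ ρ : Equiv.Perm (Fin n), (∀ v, ρ (ρ v) = v) ∧ (∀ v, G.Adj v (ρ v)) ∧
      ∀ v, ρ v = if c v = 0 then σ v else σ⁻¹ v := by
  obtain ⟨χ, hχ⟩ := exists_alternating_coloring heven
  have hχi : ∀ i v, χ (σ^[i] v) = χ v + i := by
    intro i v
    induction i with
    | zero => simp
    | succ i ih =>
      rw [iterate_succ_apply', hχ, ih]
      push_cast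
      ring
  choose i hi hi' using hc
  have hcχ : ∀ v, c v = 0 ↔ χ (σ^[i v] v) = χ v := by
    intro v
    rw [hi, ← Nat.dvd_iff_mod_eq_zero, ← ZMod.natCast_eq_zero_iff, hχi, add_eq_left]
  have hmin : ∀ v, σ^[i (σ v)] (σ v) = σ^[i v] v := by
    intro v
    refine le_antisymm (hi' _ _ ?_) (hi' _ _ ?_)
    · exact Equiv.Perm.sameCycle_apply_left.mpr (sameCycle_iterate σ v _)
    · exact Equiv.Perm.sameCycle_apply_left.mp (sameCycle_iterate σ (σ v) _)
  have hne : ∀ a b : ZMod 2, a = b + 1 ↔ ¬ a = b := by decide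
  have halt : ∀ v, c (σ v) = 0 ↔ ¬ c v = 0 := by
    intro v
    rw [hcχ, hcχ, hmin, hχ, hne]
  have hinv : Involutive fun v => if c v = 0 then σ v else σ⁻¹ v := by
    intro v
    by_cases hv : c v = 0
    · have : ¬ c (σ v) = 0 := fun h => (halt v).mp h hv
      simp [hv, this]
    · have : c (σ⁻¹ v) = 0 := by
        by_contra h
        have := (halt (σ⁻¹ v)).mpr h
        simp [hv] at this
      rw [Equiv.Perm.inv_def] at this
      simp [hv, this]
  refine ⟨hinv.toPerm _, hinv, fun v => ?_, fun v => rfl⟩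
  change G.Adj v (if c v = 0 then σ v else σ⁻¹ v)
  split_ifs
  · exact hadj v
  · simpa using (hadj (σ⁻¹ v)).symm

/-- Replace the permutation by an involution that consists of every second edge of every cycle. -/
def split : Program :=
  .seq (.forLoop 50 (.var 0) <|
    .seq (.assign 51 (.var 50)) <| .seq (.assign 52 (.var 50)) <|
    .seq (.assign 53 (.const 0)) <| .seq (.assign 54 (.const 0)) <|
    .seq (.forLoop 55 (.var 0) <| .seq (.assign 51 (.cell 7 (.var 51))) <|
      .seq (.assign 54 (.flip (.var 54))) <| .ite (.sub (.var 52) (.var 51))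
        (.seq (.assign 52 (.var 51)) (.assign 53 (.var 54))) .skip) <|
    .store 9 (.var 50) (.var 53)) <|
  .forLoop 50 (.var 0) <| .ite (.cell 9 (.var 50))
    (.store 7 (.var 50) (.cell 7 (.add (.var 0) (.var 50))))
    (.store 7 (.add (.var 0) (.var 50)) (.cell 7 (.var 50)))

lemma runs_split (hG : HasGraph G s) (hσ : HasPerm σ s) (hnN : n ≤ N)
    (hadj : ∀ v, G.Adj v (σ v)) (heven : ∀ v, ¬ Odd (minimalPeriod σ v)) :
    Runs N split s fun s' => ∃ ρ : Equiv.Perm (Fin n), HasPerm ρ s' ∧ (∀ v, ρ (ρ v) = v) ∧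
      ∀ v, G.Adj v (ρ v) := by
  refine Runs.seq' (Q' := fun s' => ∀ v : Fin n, ∃ i, s'.arr 9 v = i % 2 ∧
    ∀ w, σ.SameCycle v w → σ^[i] v ≤ w) ?_ ?_
  · refine Runs.forLoop (fun k s' => ∀ v : Fin n, (v : ℕ) < k → ∃ i, s'.arr 9 v = i % 2 ∧
      ∀ w, σ.SameCycle v w → σ^[i] v ≤ w) n hnN rfl (by simp) ?_ ?_ fun s' _ h v => h v v.2
    · intro s' hf
      exact (hf.1 0 rfl).trans hG.size
    intro k s' hk hf hki h1
    have hG' := hG.of_frame hf rfl rfl rfl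
    have hσ' := hσ.of_frame hf rfl
    refine Runs.seq (Runs.assign (Runs.seq (Runs.assign (Runs.seq (Runs.assign (Runs.seq
      (Runs.assign ?_)))))))
    set v : Fin n := ⟨k, hk⟩ with hv
    refine Runs.seq' (Q' := fun s' => ∃ i, s'.var 53 = i % 2 ∧
      ∀ w, σ.SameCycle v w → σ^[i] v ≤ w) ?_ ?_
    · refine Runs.forLoop (fun l s' => s'.var 51 = σ^[l] v ∧ s'.var 54 = l % 2 ∧
        ∃ i, s'.var 52 = σ^[i] v ∧ s'.var 53 = i % 2 ∧ ∀ j ≤ l, σ^[i] v ≤ σ^[j] v) n hnN rfl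
        ?_ ?_ ?_ ?_
      · exact ⟨by simp [hki, hv], by simp, 0, by simp [hki, hv], by simp, by simp⟩
      · intro s'' hf'
        exact (hf'.1 0 rfl).trans (by simp [hG'.size])
      · rintro l s'' hl hf' hli ⟨h2, h3, i, h4, h5, h6⟩
        have h7 := ((hσ'.congr (hf'.2 7 rfl)) (σ^[l] v)).1
        refine Runs.seq (Runs.assign (Runs.seq (Runs.assign ?_)))
        have h8 : 1 - l % 2 = (l + 1) % 2 := by omega
        refine Runs.ite (fun h => ?_) fun h => Runs.skip ?_
        · refine Runs.seq (Runs.assign (Runs.assign ?_))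
          simp [h2, h7, h4] at h
          rw [← iterate_succ_apply' (⇑σ), ← Ne, Nat.sub_ne_zero_iff_lt, ← Fin.lt_def] at h
          refine ⟨by simp [h2, h7, iterate_succ_apply', -iterate_succ],
            by simp [Expr.flip, h3, h8], l + 1,
            by simp [h2, h7, iterate_succ_apply', -iterate_succ],
            by simp [Expr.flip, h3, h8], fun j hj => ?_⟩
          rcases Nat.le_succ_iff.mp hj with hj | rfl
          · exact h.le.trans (h6 j hj)
          · exact le_rfl
        · simp [h2, h7, h4] at h
          rw [Nat.sub_eq_zero_iff_le, ← iterate_succ_apply' (⇑σ), ← Fin.le_def] at h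
          refine ⟨by simp [h2, h7, iterate_succ_apply', -iterate_succ],
            by simp [Expr.flip, h3, h8], i, by simp [h4], by simp [h5], fun j hj => ?_⟩
          rcases Nat.le_succ_iff.mp hj with hj | rfl
          · exact h6 j hj
          · exact h
      · rintro s'' - ⟨-, -, i, -, h5, h6⟩
        refine ⟨i, h5, fun w hw => ?_⟩
        obtain ⟨j, hj, rfl⟩ := (sameCycle_iff_exists_iterate σ).mp hw
        exact h6 j (hj.le.trans (minimalPeriod_le_card σ v))
    · rintro s₁ hf₁ ⟨i, h2, h3⟩
      have h9 : s₁.arr 9 = s'.arr 9 := hf₁.2 9 rfl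
      have h50 : s₁.var 50 = k := (hf₁.1 50 rfl).trans (by simp [hki])
      refine Runs.store fun u hu => ?_
      rcases Nat.lt_succ_iff_lt_or_eq.mp hu with hu | hu
      · simpa [h50, hu.ne, h9] using h1 u hu
      · obtain rfl : u = v := Fin.ext hu
        exact ⟨i, by simp [h50, hu, h2], h3⟩
  intro s₁ hf₁ h1
  have hG₁ := hG.of_frame hf₁ rfl rfl rfl
  have hσ₁ := hσ.of_frame hf₁ rfl
  obtain ⟨ρ, hρ, hρadj, hρσ⟩ := exists_involution hadj heven h1
  have hρinv : ρ⁻¹ = ρ := by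
    ext v
    rw [Equiv.Perm.inv_eq_iff_eq.mpr (hρ v).symm]
  refine Runs.forLoop (fun k s' =>
    (∀ u : Fin n, (u : ℕ) < k → s'.arr 7 u = ρ u ∧ s'.arr 7 (n + u) = ρ u) ∧
    ∀ u : Fin n, k ≤ u → s'.arr 7 u = σ u ∧ s'.arr 7 (n + u) = (σ⁻¹ u : Fin n)) n hnN rfl
    ⟨by simp, fun u _ => hσ₁ u⟩ ?_ ?_ ?_
  · intro s' hf
    exact (hf.1 0 rfl).trans hG₁.size
  · rintro k s' hk hf hki ⟨h2, h3⟩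
    have h0 : s'.var 0 = n := (hf.1 0 rfl).trans hG₁.size
    have h9 : s'.arr 9 = s₁.arr 9 := hf.2 9 rfl
    obtain ⟨h4, h5⟩ := h3 ⟨k, hk⟩ le_rfl
    have hρk := hρσ ⟨k, hk⟩
    have hn : n ≠ 0 := by omega
    have hkn : ∀ i, k ≠ n + i := fun i => by omega
    have hne : ∀ u : Fin n, n + (u : ℕ) ≠ k := fun u => by omega
    have hne' : ∀ u : Fin n, (u : ℕ) ≠ n + k := fun u => by omega
    refine Runs.ite (fun h => Runs.store ?_) fun h => Runs.store ?_
    · rw [Expr.eval, Expr.eval, hki, h9] at h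
      rw [if_neg h] at hρk
      refine ⟨fun u hu => ?_, fun u hu => ?_⟩
      · rcases Nat.lt_succ_iff_lt_or_eq.mp hu with hu | hu
        · simpa [hki, h0, hu.ne, hne] using h2 u hu
        · obtain rfl : u = ⟨k, hk⟩ := Fin.ext hu
          rw [hρk]
          simp only [State.setVar_arr, State.setCell_arr, Expr.eval, hki, h0, h5]
          simp [hn]
      · have hu' : (u : ℕ) ≠ k := by omega
        simpa [hki, h0, hu', hne] using h3 u (by omega)
    · rw [Expr.eval, Expr.eval, hki, h9] at h
      rw [if_pos h] at hρk
      refine ⟨fun u hu => ?_, fun u hu => ?_⟩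
      · rcases Nat.lt_succ_iff_lt_or_eq.mp hu with hu | hu
        · simpa [hki, h0, hu.ne, hne'] using h2 u hu
        · obtain rfl : u = ⟨k, hk⟩ := Fin.ext hu
          rw [hρk]
          simp only [State.setVar_arr, State.setCell_arr, Expr.eval, hki, h0, h4]
          simp [hn]
      · have hu' : (u : ℕ) ≠ k := by omega
        simpa [hki, h0, hu', hne'] using h3 u (by omega)
  · rintro s' - ⟨h2, -⟩
    exact ⟨ρ, fun u => by rw [hρinv]; exact h2 u u.2, hρ, hρadj⟩

/-- Find two edges of the perfect matching that lie in a cycle of length `4`, and exchange them for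
the other two edges of the cycle. -/
def rematchEdges : Program :=
  .seq (.forLoop 50 (.var 0) <| .forLoop 51 (.var 0) <|
    .ite (.and (.adj (.var 50) (.var 51)) (.and (.ne (.var 51) (.cell 7 (.var 50)))
        (.adj (.cell 7 (.var 50)) (.cell 7 (.var 51)))))
      (.seq (.assign 56 (.var 50)) (.assign 57 (.var 51))) .skip) <|
  .seq (.assign 58 (.cell 7 (.var 56))) <| .seq (.assign 59 (.cell 7 (.var 57))) <|
  .seq (.store 7 (.var 56) (.var 57)) <| .seq (.store 7 (.var 57) (.var 56)) <|
  .seq (.store 7 (.var 58) (.var 59)) <| .seq (.store 7 (.var 59) (.var 58)) <|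
  .seq (.store 7 (.add (.var 0) (.var 56)) (.var 57)) <|
  .seq (.store 7 (.add (.var 0) (.var 57)) (.var 56)) <|
  .seq (.store 7 (.add (.var 0) (.var 58)) (.var 59))
    (.store 7 (.add (.var 0) (.var 59)) (.var 58))

lemma runs_rematchEdges (hG : HasGraph G s) (hσ : HasPerm σ s) (hnN : n ≤ N)
    (hadj : ∀ v, G.Adj v (σ v)) (hinv : ∀ v, σ (σ v) = v)
    (hex : ∃ g h, G.Adj g h ∧ h ≠ σ g ∧ G.Adj (σ g) (σ h)) :
    Runs N rematchEdges s fun s' => ∃ g h, G.Adj g h ∧ h ≠ σ g ∧ G.Adj (σ g) (σ h) ∧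
      HasPerm (rematch σ g h) s' := by
  refine Runs.seq' (Q' := fun s' => ∃ g h : Fin n, (s'.var 56 = g ∧ s'.var 57 = h) ∧
    G.Adj g h ∧ h ≠ σ g ∧ G.Adj (σ g) (σ h)) ?_ ?_
  · refine Runs.forLoop (fun k s' => (∃ g h : Fin n, (g : ℕ) < k ∧ G.Adj g h ∧ h ≠ σ g ∧
      G.Adj (σ g) (σ h)) → ∃ g h : Fin n, (s'.var 56 = g ∧ s'.var 57 = h) ∧ G.Adj g h ∧ h ≠ σ g ∧
      G.Adj (σ g) (σ h)) n hnN rfl (by simp) ?_ ?_ ?_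
    · intro s' hf
      exact (hf.1 0 rfl).trans hG.size
    · intro k s' hk hf hki h1
      have hG' := hG.of_frame hf rfl rfl rfl
      have hσ' := hσ.of_frame hf rfl
      refine Runs.forLoop (fun l s' => (∃ g h : Fin n, ((g : ℕ) < k ∨ (g : ℕ) = k ∧ (h : ℕ) < l) ∧
        G.Adj g h ∧ h ≠ σ g ∧ G.Adj (σ g) (σ h)) → ∃ g h : Fin n,
        (s'.var 56 = g ∧ s'.var 57 = h) ∧ G.Adj g h ∧ h ≠ σ g ∧ G.Adj (σ g) (σ h)) n hnN rfl
        (by simpa using h1) ?_ ?_ ?_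
      · intro s'' hf'
        exact (hf'.1 0 rfl).trans hG'.size
      · intro l s'' hl hf' hli h2
        have hG'' := hG'.of_frame hf' rfl rfl rfl
        have hσ'' := hσ'.of_frame hf' rfl
        have hki' : s''.var 50 = k := (hf'.1 50 rfl).trans hki
        have h3 := hG''.eval_adj_eq_zero (a := .var 50) (b := .var 51) (u := ⟨k, hk⟩)
          (v := ⟨l, hl⟩) hki' hli
        have h4 : (Expr.cell 7 (.var 50)).eval s'' = σ ⟨k, hk⟩ := by
          rw [Expr.eval, Expr.eval, hki']
          exact (hσ'' ⟨k, hk⟩).1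
        have h5 := hG''.eval_adj_eq_zero h4 (b := .cell 7 (.var 51)) (v := σ ⟨l, hl⟩) (by
          rw [Expr.eval, Expr.eval, hli]
          exact (hσ'' ⟨l, hl⟩).1)
        have h6 : (Expr.ne (.var 51) (.cell 7 (.var 50))).eval s'' = 0 ↔
            (⟨l, hl⟩ : Fin n) = σ ⟨k, hk⟩ := by
          rw [Expr.eval_ne, h4, Expr.eval, hli, Fin.ext_iff]
        refine Runs.ite (fun h => ?_) fun h => Runs.skip ?_
        · rw [Ne, Expr.eval_and, Expr.eval_and, h3, h5, h6] at h
          push Not at h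
          refine Runs.seq (Runs.assign (Runs.assign fun _ => ?_))
          exact ⟨⟨k, hk⟩, ⟨l, hl⟩, by simp [hki', hli], h⟩
        · rw [Expr.eval_and, Expr.eval_and, h3, h5, h6] at h
          rintro ⟨g, h', h7, h8⟩
          obtain ⟨g', h'', h9⟩ := h2 ⟨g, h', by
            rcases h7 with h7 | ⟨h7, h7'⟩
            · exact Or.inl h7
            · refine Or.inr ⟨h7, (Nat.lt_succ_iff_lt_or_eq.mp h7').resolve_right fun h7' => ?_⟩
              obtain rfl : g = ⟨k, hk⟩ := Fin.ext h7
              obtain rfl : h' = ⟨l, hl⟩ := Fin.ext h7'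
              tauto, h8⟩
          exact ⟨g', h'', by simpa using h9⟩
      · rintro s'' - h2 ⟨g, h', h7, h8⟩
        refine h2 ⟨g, h', ?_, h8⟩
        rcases Nat.lt_succ_iff_lt_or_eq.mp h7 with h7 | h7
        · exact Or.inl h7
        · exact Or.inr ⟨h7, h'.2⟩
    · intro s' _ h1
      obtain ⟨g, h', h2⟩ := hex
      exact h1 ⟨g, h', g.2, h2⟩
  rintro s₁ hf₁ ⟨g, h, ⟨h1, h2⟩, h3, h4, h5⟩
  have hσ₁ := hσ.of_frame hf₁ rfl
  have h0 : s₁.var 0 = n := (hf₁.1 0 rfl).trans hG.size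
  refine Runs.seq (Runs.assign (Runs.seq (Runs.assign ?_)))
  set s₂ := (s₁.setVar 58 _).setVar 59 _ with hs₂
  have h56 : s₂.var 56 = g := by simp [hs₂, h1]
  have h57 : s₂.var 57 = h := by simp [hs₂, h2]
  have h58 : s₂.var 58 = σ g := by
    have := (hσ₁ g).1
    simp [hs₂, h1, this]
  have h59 : s₂.var 59 = σ h := by
    have := (hσ₁ h).1
    simp [hs₂, h2, this]
  have h0 : s₂.var 0 = n := by simp [hs₂, h0]
  have h7 : ∀ u : Fin n, s₂.arr 7 u = σ u ∧ s₂.arr 7 (n + u) = σ u := by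
    intro u
    have : σ⁻¹ u = σ u := by rw [Equiv.Perm.inv_eq_iff_eq, hinv]
    rw [← this]
    exact ⟨this ▸ (hσ₁ u).1, (hσ₁ u).2⟩
  clear_value s₂
  refine Runs.seq (Runs.store (Runs.seq (Runs.store (Runs.seq (Runs.store (Runs.seq (Runs.store
    (Runs.seq (Runs.store (Runs.seq (Runs.store (Runs.seq (Runs.store (Runs.store ?_))))))))))))))
  refine ⟨g, h, h3, h4, h5, fun u => ?_⟩
  have hσne : ∀ v, σ v ≠ v := fun v => (hadj v).ne'
  have hri : (rematch σ g h)⁻¹ u = rematch σ g h u := by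
    rw [Equiv.Perm.inv_eq_iff_eq, rematch_involutive hσne hinv h3.ne h4]
  rw [hri, rematch_apply hσne hinv h3.ne h4]
  have e1 : σ g ≠ σ h := fun h' => h3.ne (σ.injective h')
  have e2 : g ≠ σ h := fun h' => h4 (by rw [h', hinv])
  have e3 := hσne g
  have e4 := hσne h
  have e5 := h3.ne
  have hne : ∀ u v : Fin n, (u : ℕ) ≠ n + v := fun u v => by omega
  have hne' : ∀ u v : Fin n, n + (u : ℕ) ≠ v := fun u v => by omega
  simp only [Expr.eval, State.setCell_var, State.setCell_arr, h0, h56, h57, h58, h59, hne, hne',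
    Nat.add_left_cancel_iff, (h7 u).1, (h7 u).2, ← Fin.ext_iff, true_and, if_false]
  by_cases c1 : u = g
  · subst c1
    simp [e2, e3.symm, e5]
  · by_cases c2 : u = h
    · subst c2
      simp [h4, e4.symm, c1]
    · by_cases c3 : u = σ g
      · subst c3
        simp [e1, c1, c2]
      · by_cases c4 : u = σ h
        · subst c4
          simp [c1, c2, c3]
        · simp [c1, c2, c3, c4]

end RAM

/-! ### The algorithm -/

namespace RAM

open Function

variable {n : ℕ} {G : SimpleGraph (Fin n)} {s : State} {N : ℕ}

/-- Store the offsets of the rows of the adjacency matrix in array `6`. -/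
def rowOffsets : Program :=
  .forLoop 40 (.var 0)
    (.store 6 (.add (.var 40) (.const 1)) (.add (.cell 6 (.var 40)) (.var 0)))

lemma runs_rowOffsets (hnN : n ≤ N) : Runs N rowOffsets (input G) fun s => HasGraph G s := by
  refine Runs.forLoop (fun k s => ∀ u ≤ k, s.arr 6 u = n * u) n hnN rfl (by simp [input]) ?_ ?_ ?_
  · intro s hf
    exact (hf.1 0 rfl).trans (by simp [input])
  · intro k s hk hf hki h
    have h0 : s.var 0 = n := (hf.1 0 rfl).trans (by simp [input])
    refine Runs.store fun u hu => ?_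
    by_cases hu' : u = k + 1
    · have := h k le_rfl
      simp [hu', hki, this, h0, Nat.mul_succ]
    · simpa [hki, hu'] using h u (by omega)
  · intro s hf h
    refine ⟨(hf.1 0 rfl).trans (by simp [input]), fun u v => ?_, fun u => h u u.2.le⟩
    rw [hf.2 0 rfl]
    simp only [input, true_and, ne_eq, ite_eq_right_iff, one_ne_zero, imp_false, not_not]
    constructor
    · rintro ⟨u', v', h1, h2⟩
      have hmod := congrArg (· % n) h1
      simp only [Nat.mul_add_mod, Nat.mod_eq_of_lt v.2, Nat.mod_eq_of_lt v'.2] at hmod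
      have hmul : n * (u : ℕ) = n * u' := by omega
      have hu : (u : ℕ) = u' := Nat.eq_of_mul_eq_mul_left (by have := u.2; omega) hmul
      rwa [Fin.ext hu, Fin.ext hmod]
    · exact fun h => ⟨u, v, rfl, h⟩

/-- Find a Hamiltonian cycle in the prism: search for a chain of cycles that closes up, first with
the permutation from the auction, then with the perfect matching contained in it, and finally
after an exchange of edges in this matching. -/
def findCycle : Program :=
  .seq rowOffsets <| .seq matchAll <| .seq search <| .ite (.var 27) .skip <|
  .seq split <| .seq search <| .ite (.var 27) .skip <| .seq rematchEdges search

lemma runs_findCycle {ε : ℝ} (hε : 0 < ε) (hn : 2 ≤ n) (hT : IsTough G (1 + ε))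
    (h2 : IsTwoKTwoFree G) (hN : n + n ≤ N) :
    Runs N findCycle (input G) fun s => IsCycleCode G (s.arr 1) (s.arr 2) := by
  have hall : ∀ v, v ∈ List.finRange n := List.mem_finRange
  have : Nonempty (Fin n) := ⟨⟨0, by omega⟩⟩
  refine Runs.seq' (runs_rowOffsets (by omega)) fun s₁ hf₁ hG₁ => ?_
  refine Runs.seq' (runs_matchAll hG₁ (by omega) ?_ ?_ ?_ ?_) ?_
  · intro L _
    convert hT.card_le_card_neighbors hε ?_ L
    rw [Fintype.card_fin]
    exact hn
  · intro v
    rw [hf₁.2 3 rfl]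
    simp [input]
  · intro v
    rw [hf₁.2 4 rfl]
    simp [input]
  · intro v
    rw [hf₁.2 5 rfl]
    simp [input]
  rintro s₂ hf₂ ⟨σ, hσ₂, hadj⟩
  have hG₂ := hG₁.of_frame hf₂ rfl rfl rfl
  have hS₂ : Sound G s₂ := by
    have h27 : s₂.var 27 = 0 := (hf₂.1 27 rfl).trans ((hf₁.1 27 rfl).trans (by simp [input]))
    exact fun h => absurd h27 h
  refine Runs.seq' (finds_search hG₂ hσ₂ hS₂ hadj hN (by omega)) ?_
  rintro s₃ hf₃ ⟨hS₃, hC₃⟩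
  refine Runs.ite (fun h => Runs.skip (hS₃ h)) fun h => ?_
  have hno : ¬ HasCandidate G σ (List.finRange n) := fun h' => hC₃ (Or.inr h') h
  have hG₃ := hG₂.of_frame hf₃ rfl rfl rfl
  refine Runs.seq' (runs_split hG₃ (hσ₂.of_frame hf₃ rfl) (by omega) hadj fun v hv =>
    hno (hasCandidate_of_odd h2 hadj hall hv)) ?_
  clear hS₂ hG₂ hf₂ hG₁ hf₁ hC₃ hno hσ₂ hf₃
  rintro s₄ hf₄ ⟨ρ, hρ₄, hinv, hadj⟩
  have hG₄ := hG₃.of_frame hf₄ rfl rfl rfl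
  refine Runs.seq' (finds_search hG₄ hρ₄
    (hS₃.congr (hf₄.1 27 rfl) (hf₄.2 1 rfl) (hf₄.2 2 rfl)) hadj hN (by omega)) ?_
  rintro s₅ hf₅ ⟨hS₅, hC₅⟩
  refine Runs.ite (fun h => Runs.skip (hS₅ h)) fun h => ?_
  have hno : ¬ HasCandidate G ρ (List.finRange n) := fun h' => hC₅ (Or.inr h') h
  have hM : TriangleFreeMatching G ρ := ⟨h2, hadj, hinv, fun v x h1 h1' =>
    hno (hasCandidate_of_triangle h2 hadj hinv hall h1 h1')⟩
  obtain ⟨hex, hre⟩ := hM.hasCandidate_rematch hε hT hall hno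
  have hG₅ := hG₄.of_frame hf₅ rfl rfl rfl
  refine Runs.seq' (runs_rematchEdges hG₅ (hρ₄.of_frame hf₅ rfl) (by omega) hadj hinv hex) ?_
  rintro s₆ hf₆ ⟨a, b, h3, h4, h5, hρ₆⟩
  refine Runs.imp (finds_search (hG₅.of_frame hf₆ rfl rfl rfl) hρ₆
    (hS₅.congr (hf₆.1 27 rfl) (hf₆.2 1 rfl) (hf₆.2 2 rfl))
    (adj_rematch (fun v => (hadj v).ne') hinv h3.ne h4 hadj h3 h5) hN (by omega)) ?_
  rintro s₇ - ⟨hS₇, hC₇⟩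
  exact hS₇ (hC₇ (Or.inr (hre a b h3 h4 h5)))

lemma exists_exec_findCycle {ε : ℝ} (hε : 0 < ε) (hn : 2 ≤ n) (hT : IsTough G (1 + ε))
    (h2 : IsTwoKTwoFree G) : ∃ (s : State) (t : ℕ), Exec findCycle (input G) s t ∧
      t ≤ findCycle.bound (n + n) ∧ ∃ (a : Fin n × Fin 2) (p : (prism G).Walk a a),
        p.IsHamiltonianCycle ∧ Outputs s p := by
  obtain ⟨s, t, he, ht, hs⟩ := runs_findCycle hε hn hT h2 le_rfl
  obtain ⟨a, p, hp, hp'⟩ := hs.exists_isHamiltonianCycle hn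
  exact ⟨s, t, he, ht, a, p, hp, hp'⟩

end RAM

theorem theorem2 :
    (∀ ε : ℝ, 0 < ε → ∀ (V : Type*) [Fintype V] [DecidableEq V] (G : SimpleGraph V),
      2 ≤ Fintype.card V → IsTough G (1 + ε) → IsTwoKTwoFree G → (prism G).IsHamiltonian) ∧
    (∃ (P : RAM.Program) (q : Polynomial ℕ), ∀ ε : ℝ, 0 < ε →
      ∀ (n : ℕ) (G : SimpleGraph (Fin n)),
        2 ≤ n → IsTough G (1 + ε) → IsTwoKTwoFree G →
        ∃ (s : RAM.State) (t : ℕ), RAM.Exec P (RAM.input G) s t ∧ t ≤ q.eval n ∧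
          ∃ (a : Fin n × Fin 2) (p : (prism G).Walk a a),
            p.IsHamiltonianCycle ∧ RAM.Outputs s p) := by
  refine ⟨fun ε hε V _ _ G hV hT h2 => ?_, ?_⟩
  · let H : SimpleGraph (Fin (Fintype.card V)) := G.comap (Fintype.equivFin V).symm
    let e : H ≃g G := SimpleGraph.Iso.comap (Fintype.equivFin V).symm G
    obtain ⟨-, -, -, -, a, p, hp, -⟩ :=
      RAM.exists_exec_findCycle hε hV (hT.of_iso e.symm) (h2.of_iso e.symm)
    exact isHamiltonian_prism_of_iso e fun _ => ⟨a, p, hp⟩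
  · obtain ⟨q, hq⟩ := RAM.Program.exists_polynomial_bound RAM.findCycle
    refine ⟨RAM.findCycle, q.comp (Polynomial.X + Polynomial.X), fun ε hε n G hn hT h2 => ?_⟩
    obtain ⟨s, t, he, ht, h⟩ := RAM.exists_exec_findCycle hε hn hT h2
    refine ⟨s, t, he, ?_, h⟩
    rw [hq] at ht
    simpa using ht
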